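/- Let $\gamma>0$, $d\in[0,1)$, $\alpha>-d$, and let $G$ be a probability distribution. The beta process $\mathrm{BP}(\gamma,\alpha,d)$ is the completely random measure $\sum\theta\,\delta_\psi$ whose points $(\theta,\psi)$ form a Poisson point process with mean measure $\nu(d\theta)\,G(d\psi)$, where $$\nu(d\theta)=\gamma\,\frac{\Gamma(\alpha+1)}{\Gamma(1-d)\Gamma(\alpha+d)}\,\mathbf 1[\theta\le 1]\,\theta^{-1-d}(1-\theta)^{\alpha+d-1}\,d\theta .$$ All random variables in each of the following constructions are independent, and $\psi_{ki}\sim G$. * $\mathrm{PL\text{-}Rep}(\gamma,\alpha,d,g)$: $\Theta=\sum_{k\ge1}\sum_{i=1}^{C_k}\theta_{ki}\delta_{\psi_{ki}}$ with $C_k\sim\mathrm{Poiss}(\gamma)$, $\theta_{ki}=V_{ki}U_{kik}\prod_{j=1}^{k-1}(1-U_{kij})$, $V_{ki}\sim g$, $U_{kij}\sim\mathrm{Beta}(1-d,\alpha+jd)$. * The construction of Broderick et al.: the same without the factors $V_{ki}$. * $\mathrm{DB\text{-}Rep}(c,g,\xi)$, $\xi>0$: the same double sum with $C_k\sim\mathrm{Poiss}(c/\xi)$,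 $\theta_{ki}=V_{ki}e^{-T_{ki}}$, $V_{ki}\sim g$, $T_{ki}\sim\mathrm{Gam}(k,\xi)$ (shape, rate). Put $g_\alpha=\mathrm{Beta}(1,\alpha-1)$ for $\alpha>1$ and $g_1=\delta_1$. For such $\Theta$ let $X_1,\dots,X_N$ be, given $\Theta$, i.i.d. Bernoulli-process draws $X_n=\sum_{k,i}x_{nki}\delta_{\psi_{ki}}$, with independent $x_{nki}\sim\mathrm{Bern}(\theta_{ki})$; let $\Theta_K$ consist of the first $K$ rounds $k\le K$ of $\Theta$; and let $B_{N,K}$ be the probability that some $X_n$ charges an atom of a round $k>K$, i.e. $1-\Pr(\mathrm{supp}(X_{1:N})\subseteq\mathrm{supp}(\Theta_K))$ with atoms identified by their labels $(k,i)$. 1. The construction of Broderick et al. is $\mathrm{PL\text{-}Rep}(\gamma,\alpha,d,\delta_1)$: it is the power-law representation with $V_{ki}\equiv1$, and every $\mathrm{PL\text{-}Rep}(\gamma,\alpha,d,\delta_1)$ has almost surely these weights. It represents the beta process: $\Theta\sim\mathrm{BP}(\gamma,\alpha,d)$. 2. For the representation in 1 and all $N,K\ge0$, $$B_{N,K}\le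 N\gamma\prod_{k=1}^{K}\frac{\alpha+kd}{\alpha+kd-d+1}.$$ 3. If $\alpha\ge1$ and $\xi>0$, then $\mathrm{DB\text{-}Rep}(\gamma\alpha,g_\alpha,\xi)$ represents $\mathrm{BP}(\gamma,\alpha,0)$, and for all $N,K\ge0$ $$B_{N,K}\le N\gamma\left(\frac{\xi}{1+\xi}\right)^{K}.$$ 4. If $\alpha\ge1$, then $\mathrm{PL\text{-}Rep}(\gamma,\alpha,0,\delta_1)$ and $\mathrm{DB\text{-}Rep}(\gamma\alpha,g_\alpha,\alpha)$ have the same joint law of $(C_k),(\theta_{ki}),(\psi_{ki})$. In 2 and 3, $B_{N,K}=1-\exp\{-\int(1-(1-\theta)^N)\,\nu_K^+(d\theta)\}$, where $\nu_K^+$ is the mean measure of the weights in the rounds $k>K$. Moreover $B_{N,K}$ bounds the truncation error: if, for a Markov kernel $f$, the observations $Y_n\mid X_n\sim f(\cdot\mid X_n)$ are generated independently from $X_{1:N}$ and $W_{1:N}$ analogously from Bernoulli-process draws $Z_{1:N}$ given $\Theta_K$, then the total variation distance of the laws of $Y_{1:N}$ and $W_{1:N}$ (half the $L^1$ distance of the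 densities) is at most $B_{N,K}$. -/

import Mathlib

open MeasureTheory ProbabilityTheory
open scoped ENNReal NNReal

noncomputable section

namespace CRM

section Processes

variable {Ω : Type*} [MeasurableSpace Ω] {Ψ : Type*} [MeasurableSpace Ψ]

/-- A Poisson point process (Poisson random measure) with mean measure `μ`. -/
structure IsPoissonProcess {E : Type*} [MeasurableSpace E] (P : Measure Ω)
    (N : Ω → Measure E) (μ : Measure E) : Prop where
  measurable : Measurable N
  law_of_finite : ∀ B, MeasurableSet B → μ B ≠ ∞ →
    P.map (fun ω => N ω B) = (poissonMeasure (μ B).toNNReal).map (fun n : ℕ => (n : ℝ≥0∞))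
  law_of_infinite : ∀ B, MeasurableSet B → μ B = ∞ → ∀ᵐ ω ∂P, N ω B = ∞
  indep : ∀ (m : ℕ) (B : Fin m → Set E), (∀ j, MeasurableSet (B j)) →
    (∀ i j, i ≠ j → Disjoint (B i) (B j)) → iIndepFun (fun j ω => N ω (B j)) P

/-- `Θ ~ CRM(ν)` with atom-location distribution `G`: `Θ` is the random measure `∑ θ δ_ψ` where
`(θ, ψ)` runs through the points of a Poisson point process with mean measure `ν(dθ) G(dψ)`. -/
def IsCRM (P : Measure Ω) (Θ : Ω → Measure Ψ) (ν : Measure ℝ) (G : Measure Ψ) : Prop :=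
  ∃ N : Ω → Measure (ℝ × Ψ), IsPoissonProcess P N (ν.prod G) ∧
    ∀ᵐ ω ∂P, Θ ω = ((N ω).withDensity (fun p => ENNReal.ofReal p.1)).map Prod.snd

/-- The rate measure of the beta process `BP(γ, α, d)`. -/
def betaProcessRate (γ α d : ℝ) : Measure ℝ :=
  (volume.restrict (Set.Ioc (0 : ℝ) 1)).withDensity fun θ => ENNReal.ofReal
    (γ * (Real.Gamma (α + 1) / (Real.Gamma (1 - d) * Real.Gamma (α + d)))
      * θ ^ (-1 - d) * (1 - θ) ^ (α + d - 1))

/-! ### Superpositions of rounds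

Rounds are numbered from `0`: index `k` stands for round `k + 1`. Round `k` has `C k` atoms,
with weights `θ k i` and locations `ψ k i` for `i < C k`. -/

/-- The random measure `∑ₖ ∑_{i < Cₖ} θₖᵢ δ_{ψₖᵢ}`. -/
def superposition (C : ℕ → Ω → ℕ) (θ : ℕ → ℕ → Ω → ℝ) (ψ : ℕ → ℕ → Ω → Ψ) (ω : Ω) : Measure Ψ :=
  Measure.sum fun k => ∑ i ∈ Finset.range (C k ω),
    ENNReal.ofReal (θ k i ω) • Measure.dirac (ψ k i ω)

/-- The numbers of atoms after truncation to the first `K` rounds. -/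
def truncCount (K : ℕ) (C : ℕ → Ω → ℕ) (k : ℕ) (ω : Ω) : ℕ := if k < K then C k ω else 0

/-- The data (counts, weights, locations) that determine a superposition. -/
def atomData (C : ℕ → Ω → ℕ) (θ : ℕ → ℕ → Ω → ℝ) (ψ : ℕ → ℕ → Ω → Ψ) (ω : Ω) :
    (ℕ → ℕ) × (ℕ → ℕ → ℝ) × (ℕ → ℕ → Ψ) :=
  (fun k => C k ω, fun k i => θ k i ω, fun k i => ψ k i ω)

/-- The mean measure of the weights of the atoms in the rounds after the first `K`
(the tail measure `ν_K⁺`). -/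
def tailRate (P : Measure Ω) (C : ℕ → Ω → ℕ) (θ : ℕ → ℕ → Ω → ℝ) (K : ℕ) : Measure ℝ :=
  P.bind fun ω => Measure.sum fun k =>
    if k < K then 0 else ∑ i ∈ Finset.range (C k ω), Measure.dirac (θ k i ω)

/-! ### Likelihood process, observations and truncation error -/

/-- The Bernoulli likelihood `h(x | θ) = 1[x ≤ 1] θ^x (1 - θ)^(1 - x)`. -/
def bernoulliLik (x : ℕ) (θ : ℝ) : ℝ := if x ≤ 1 then θ ^ x * (1 - θ) ^ (1 - x) else 0

/-- Conditionally on the atoms, the values `x n k i` (of the `n`-th draw at atom `(k, i)`) are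
independent and `x n k i` has probability mass function `h(· | θ k i)`. -/
structure IsLikelihoodDraw {N : ℕ} (P : Measure Ω) (h : ℕ → ℝ → ℝ) (C : ℕ → Ω → ℕ)
    (θ : ℕ → ℕ → Ω → ℝ) (ψ : ℕ → ℕ → Ω → Ψ) (x : Fin N → ℕ → ℕ → Ω → ℕ) : Prop where
  measurable : ∀ n k i, Measurable (x n k i)
  cond_law : ∀ (A : Set Ω), MeasurableSet[MeasurableSpace.comap (atomData C θ ψ) inferInstance] A →
    ∀ (J : Finset (Fin N × ℕ × ℕ)) (a : Fin N × ℕ × ℕ → ℕ),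
      P (A ∩ {ω | ∀ j ∈ J, x j.1 j.2.1 j.2.2 ω = a j})
        = ∫⁻ ω in A, ∏ j ∈ J, ENNReal.ofReal (h (a j) (θ j.2.1 j.2.2 ω)) ∂P

/-- The draws `Xₙ = ∑ₖ ∑_{i < Cₖ} xₙₖᵢ δ_{ψₖᵢ}`, `n < N`, of the likelihood process. -/
def likelihoodProcess {N : ℕ} (C : ℕ → Ω → ℕ) (ψ : ℕ → ℕ → Ω → Ψ) (x : Fin N → ℕ → ℕ → Ω → ℕ)
    (ω : Ω) (n : Fin N) : Measure Ψ :=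
  Measure.sum fun k => ∑ i ∈ Finset.range (C k ω),
    (x n k i ω : ℝ≥0∞) • Measure.dirac (ψ k i ω)

/-- The marginal law of `Y₁, …, Y_N`, where given `X₁, …, X_N` the `Yₙ` are independent with
`Yₙ ~ f(· | Xₙ)`. -/
def obsLaw {N : ℕ} {S : Type*} [MeasurableSpace S] (P : Measure Ω)
    (X : Ω → Fin N → Measure Ψ) (f : Kernel (Measure Ψ) S) : Measure (Fin N → S) :=
  (P.map X).bind fun m => Measure.pi fun n => f (m n)

/-- Total variation distance, i.e. half the `L¹` distance of the densities. -/
def tvDist {T : Type*} [MeasurableSpace T] (μ μ' : Measure T) : ℝ :=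
  ⨆ A : {A : Set T // MeasurableSet A}, |μ.real A - μ'.real A|

/-- `B_{N,K}`: the probability that the support of some `X₁, …, X_N` is not contained in that of
the truncation to `K` rounds, i.e. that some `Xₙ` charges an atom of a later round. -/
def truncationError {N : ℕ} (P : Measure Ω) (C : ℕ → Ω → ℕ) (x : Fin N → ℕ → ℕ → Ω → ℕ)
    (K : ℕ) : ℝ :=
  1 - P.real {ω | ∀ n k i, i < C k ω → x n k i ω ≠ 0 → k < K}

/-! ### The representations -/

/-- The stick-breaking weights `Uₖᵢₖ ∏_{j < k} (1 - Uₖᵢⱼ)` of the construction of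
Broderick et al. -/
def stickWeight (U : ℕ → ℕ → ℕ → Ω → ℝ) (k i : ℕ) (ω : Ω) : ℝ :=
  U k i k ω * ∏ j ∈ Finset.range k, (1 - U k i j ω)

/-- The construction of Broderick et al. for `BP(γ, α, d)`: independent `Cₖ ~ Poiss(γ)`,
`Uₖᵢⱼ ~ Beta(1 - d, α + j d)` for `1 ≤ j ≤ k` (here `j` is shifted by one, like `k`), and
`ψₖᵢ ~ G`. -/
structure IsBroderick (P : Measure Ω) (γ α d : ℝ) (G : Measure Ψ) (C : ℕ → Ω → ℕ)
    (U : ℕ → ℕ → ℕ → Ω → ℝ) (ψ : ℕ → ℕ → Ω → Ψ) : Prop where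
  measurable_C : ∀ k, Measurable (C k)
  measurable_U : ∀ k i j, j ≤ k → Measurable (U k i j)
  measurable_ψ : ∀ k i, Measurable (ψ k i)
  law_C : ∀ k, P.map (C k) = poissonMeasure γ.toNNReal
  law_U : ∀ k i j, j ≤ k → P.map (U k i j) = betaMeasure (1 - d) (α + (j + 1) * d)
  law_ψ : ∀ k i, P.map (ψ k i) = G
  indep : iIndep (Sum.elim (fun k : ℕ => MeasurableSpace.comap (C k) inferInstance)
    (Sum.elim (fun q : ℕ × ℕ => MeasurableSpace.comap (ψ q.1 q.2) inferInstance)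
      (fun q : Σ k : ℕ, ℕ × Fin (k + 1) =>
        MeasurableSpace.comap (U q.1 q.2.1 q.2.2) inferInstance))) P

/-- The weights `Vₖᵢ Uₖᵢₖ ∏_{j < k} (1 - Uₖᵢⱼ)` of a power-law representation. -/
def plWeight (V : ℕ → ℕ → Ω → ℝ) (U : ℕ → ℕ → ℕ → Ω → ℝ) (k i : ℕ) (ω : Ω) : ℝ :=
  V k i ω * U k i k ω * ∏ j ∈ Finset.range k, (1 - U k i j ω)

/-- The power-law representation `PL-Rep(γ, α, d, g)`: independent `Cₖ ~ Poiss(γ)`, `Vₖᵢ ~ g`,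
`Uₖᵢⱼ ~ Beta(1 - d, α + j d)` for `1 ≤ j ≤ k` (here `j` is shifted by one, like `k`), and
`ψₖᵢ ~ G`. -/
structure IsPLRep (P : Measure Ω) (γ α d : ℝ) (g : Measure ℝ) (G : Measure Ψ) (C : ℕ → Ω → ℕ)
    (V : ℕ → ℕ → Ω → ℝ) (U : ℕ → ℕ → ℕ → Ω → ℝ) (ψ : ℕ → ℕ → Ω → Ψ) : Prop where
  measurable_C : ∀ k, Measurable (C k)
  measurable_V : ∀ k i, Measurable (V k i)
  measurable_U : ∀ k i j, j ≤ k → Measurable (U k i j)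
  measurable_ψ : ∀ k i, Measurable (ψ k i)
  law_C : ∀ k, P.map (C k) = poissonMeasure γ.toNNReal
  law_V : ∀ k i, P.map (V k i) = g
  law_U : ∀ k i j, j ≤ k → P.map (U k i j) = betaMeasure (1 - d) (α + (j + 1) * d)
  law_ψ : ∀ k i, P.map (ψ k i) = G
  indep : iIndep (Sum.elim (fun k : ℕ => MeasurableSpace.comap (C k) inferInstance)
    (Sum.elim (fun q : ℕ × ℕ => MeasurableSpace.comap (ψ q.1 q.2) inferInstance)
      (Sum.elim (fun q : ℕ × ℕ => MeasurableSpace.comap (V q.1 q.2) inferInstance)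
        (fun q : Σ k : ℕ, ℕ × Fin (k + 1) =>
          MeasurableSpace.comap (U q.1 q.2.1 q.2.2) inferInstance)))) P

/-- The weights `Vₖᵢ exp(-Tₖᵢ)` of a decoupled Bondesson representation. -/
def dbWeight (V T : ℕ → ℕ → Ω → ℝ) (k i : ℕ) (ω : Ω) : ℝ := V k i ω * Real.exp (-T k i ω)

/-- The decoupled Bondesson representation `DB-Rep(c, g, ξ)`: independent `Cₖ ~ Poiss(c / ξ)`,
`Vₖᵢ ~ g`, `Tₖᵢ ~ Gam(k, ξ)` (shape, rate; `k` is shifted by one) and `ψₖᵢ ~ G`. -/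
structure IsDBRep (P : Measure Ω) (c : ℝ) (g : Measure ℝ) (ξ : ℝ) (G : Measure Ψ)
    (C : ℕ → Ω → ℕ) (V T : ℕ → ℕ → Ω → ℝ) (ψ : ℕ → ℕ → Ω → Ψ) : Prop where
  measurable_C : ∀ k, Measurable (C k)
  measurable_V : ∀ k i, Measurable (V k i)
  measurable_T : ∀ k i, Measurable (T k i)
  measurable_ψ : ∀ k i, Measurable (ψ k i)
  law_C : ∀ k, P.map (C k) = poissonMeasure (c / ξ).toNNReal
  law_V : ∀ k i, P.map (V k i) = g
  law_T : ∀ k i, P.map (T k i) = gammaMeasure (k + 1) ξ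
  law_ψ : ∀ k i, P.map (ψ k i) = G
  indep : iIndep (Sum.elim (fun k : ℕ => MeasurableSpace.comap (C k) inferInstance)
    (Sum.elim (fun q : ℕ × ℕ => MeasurableSpace.comap (ψ q.1 q.2) inferInstance)
      (Sum.elim (fun q : ℕ × ℕ => MeasurableSpace.comap (V q.1 q.2) inferInstance)
        (fun q : ℕ × ℕ => MeasurableSpace.comap (T q.1 q.2) inferInstance)))) P

/-- The distribution `g_ν` belonging to `BP(γ, α, 0)`: `Beta(1, α - 1)` if `α > 1` and `δ₁` if
`α = 1`. -/
def betaBondessonLaw (α : ℝ) : Measure ℝ :=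
  if α = 1 then Measure.dirac 1 else betaMeasure 1 (α - 1)

end Processes

end CRM

end

/-! Every representation is a superposition of independent rounds: round `k` has a Poisson number of
atoms whose weights have a common law `η k`, and all counts, weights and locations are independent.
The generating functional of one round is `exp (lam * (∫ h ∂η k - 1))`, and rounds multiply. Letting
the number of rounds grow gives the joint characteristic functions of the counts, so the atoms form
a Poisson process whose intensity is the sum of the intensities of the rounds
(`PoissonRounds.isPoisson_pointMeasure`). Representing the beta process thus reduces to the identity
`∑ lam • η k = ν`.

The rate `ν` is infinite near 0, but `θ ν(dθ)` is `γ` times a beta distribution, and a finite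
measure on the unit interval is determined by its moments (`sum_smul_eq_betaProcessRate`). For
stick-breaking weights the moments telescope: what remains after a round is a beta process with
parameter `α + d`, scaled by the residual stick (`rising_ratio_recursion`, `sum_range_stickMoment`),
and the remainder vanishes because the harmonic series diverges (`tendsto_stickResidual`). For
Bondesson weights the moments form a geometric series (`hasSum_bondessonMoment`). When `d = 0` and
`ξ = α`, the moments of the two constructions agree round by round, hence so do all laws
(`stickMoment_zero_eq_bondessonMoment`).

For the truncation error, an atom of weight `θ` escapes all `N` Bernoulli draws with conditional
probability `(1 - θ) ^ N`. The generating functional of the later rounds turns this into the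
exponential formula. The inequalities `1 - exp (-x) ≤ x` and `1 - (1 - θ) ^ N ≤ N * θ` then bound
the error by `N` times the mean total weight of the later rounds, which is the telescoped remainder
or the geometric tail.

The total variation bound is a coupling. The law of the observations depends on the draws only
through their conditional law, so the truncated process may reuse the values of the full one; the
two then coincide unless a later atom is charged (`tvDist_obsLaw_le`). -/

namespace CRM

/-! ### Grouping and enlarging independent families of σ-algebras. -/

section Independence

variable {Ω : Type*} [mΩ : MeasurableSpace Ω] {P : Measure Ω}

/-- Grouping the members of an independent family of σ-algebras along a map of the index set
gives an independent family. -/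
lemma iIndep_iSup_fiber {ι κ : Type*} {m : ι → MeasurableSpace Ω} (hle : ∀ i, m i ≤ mΩ)
    (h : iIndep m P) (f : ι → κ) : iIndep (fun k => ⨆ i ∈ {i | f i = k}, m i) P := by
  classical
  have := h.isProbabilityMeasure
  rw [iIndep_iff]
  intro s
  induction s using Finset.induction_on with
  | empty => intro g _; simp
  | insert a s ha ih =>
    intro g hg
    rw [Finset.set_biInter_insert, Finset.prod_insert ha,
      ← ih fun k hk => hg k (Finset.mem_insert_of_mem hk)]
    -- Induction on the number of groups: the fibre over `a` and the indices mapped into `s` are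
    -- disjoint, so they generate independent σ-algebras.
    have hdis : Disjoint {i | f i = a} {i | f i ∈ s} := by
      rw [Set.disjoint_left]
      rintro i rfl hi
      exact ha hi
    refine (Indep_iff _ _ _).1 (indep_iSup_of_disjoint hle h hdis) _ _
      (hg a (Finset.mem_insert_self _ _)) ?_
    refine MeasurableSet.biInter s.countable_toSet fun k hk => ?_
    refine (?_ : (⨆ i ∈ {i | f i = k}, m i) ≤ _) _ (hg k (Finset.mem_insert_of_mem hk))
    exact biSup_mono fun i (hi : f i = k) => show f i ∈ s from hi ▸ hk

/-- Independence is not affected by adding trivial σ-algebras. -/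
lemma iIndep_of_trivial_off {ι κ : Type*} {m : κ → MeasurableSpace Ω} {e : ι → κ}
    (he : Function.Injective e) (h : iIndep (fun i => m (e i)) P)
    (htriv : ∀ k, k ∉ Set.range e → m k = ⊥) : iIndep m P := by
  classical
  have := h.isProbabilityMeasure
  rw [iIndep_iff]
  intro s g hg
  -- A trivial σ-algebra contains only `∅` and `univ`. An empty member makes both sides zero;
  -- otherwise the members off the range of `e` are all `univ` and drop out.
  by_cases hempty : ∃ k ∈ s, g k = ∅
  · obtain ⟨k, hk, hgk⟩ := hempty
    rw [Finset.prod_eq_zero hk (by rw [hgk, measure_empty])]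
    exact measure_mono_null (Set.biInter_subset_of_mem hk) (by rw [hgk, measure_empty])
  push Not at hempty
  have huniv : ∀ k ∈ s, k ∉ Set.range e → g k = Set.univ := by
    intro k hk hke
    have := hg k hk
    rw [htriv k hke, MeasurableSpace.measurableSet_bot_iff] at this
    exact this.resolve_left (hempty k hk).ne_empty
  have hi := h.meas_biInter (S := s.preimage e he.injOn) (s := fun i => g (e i))
    fun i hi => hg _ (Finset.mem_preimage.1 hi)
  rw [Finset.prod_preimage e s he.injOn (fun k => P (g k))] at hi
  · rw [← hi]
    congr 1
    ext ω
    simp only [Set.mem_iInter, Finset.mem_preimage]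
    refine ⟨fun H i hi => H _ hi, fun H k hk => ?_⟩
    by_cases hke : k ∈ Set.range e
    · obtain ⟨i, rfl⟩ := hke
      exact H i hk
    · rw [huniv k hk hke]; trivial
  · intro k hk hke
    rw [huniv k hk hke, measure_univ]

end Independence

/-! ### The moment problem on the unit interval; moments of beta and gamma laws. -/

section Moments

open Filter Topology

/-- Finite measures on `[0, 1]` are determined by their moments. -/
lemma measure_ext_of_moments {μ ν : Measure ℝ} [IsFiniteMeasure μ] [IsFiniteMeasure ν]
    (hμ : ∀ᵐ x ∂μ, x ∈ Set.Icc (0 : ℝ) 1) (hν : ∀ᵐ x ∂ν, x ∈ Set.Icc (0 : ℝ) 1)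
    (h : ∀ n : ℕ, ∫⁻ x, ENNReal.ofReal x ^ n ∂μ = ∫⁻ x, ENNReal.ofReal x ^ n ∂ν) : μ = ν := by
  have hmom : ∀ n : ℕ, ∫ x, x ^ n ∂μ = ∫ x, x ^ n ∂ν := by
    have key : ∀ ρ : Measure ℝ, (∀ᵐ x ∂ρ, x ∈ Set.Icc (0 : ℝ) 1) → ∀ n : ℕ,
        ∫ x, x ^ n ∂ρ = (∫⁻ x, ENNReal.ofReal x ^ n ∂ρ).toReal := by
      intro ρ hρ n
      rw [integral_eq_lintegral_of_nonneg_ae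
        (by filter_upwards [hρ] with x hx using pow_nonneg hx.1 n)
        (by fun_prop)]
      congr 1
      refine lintegral_congr_ae ?_
      filter_upwards [hρ] with x hx
      rw [ENNReal.ofReal_pow hx.1]
    intro n
    rw [key μ hμ, key ν hν, h]
  have hint : ∀ ρ : Measure ℝ, IsFiniteMeasure ρ → (∀ᵐ x ∂ρ, x ∈ Set.Icc (0 : ℝ) 1) →
      ∀ g : ℝ → ℝ, Continuous g → Integrable g ρ := by
    intro ρ _ hρ g hg
    obtain ⟨C, hC⟩ := isCompact_Icc.exists_bound_of_continuousOn (s := Set.Icc (0 : ℝ) 1)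
      hg.continuousOn
    exact Integrable.of_bound hg.aestronglyMeasurable C
      (by filter_upwards [hρ] with x hx using hC x hx)
  refine ext_of_forall_integral_eq_of_IsFiniteMeasure fun f => ?_
  refine eq_of_forall_dist_le fun ε hε => ?_
  set M := μ.real Set.univ + ν.real Set.univ with hM
  have hM0 : 0 ≤ M := by positivity
  -- Weierstrass approximation. The two errors add up to at most `ε / (M + 1) * M`, where `M` is the
  -- sum of the two masses; the `+ 1` covers `M = 0`.
  obtain ⟨p, hp⟩ := exists_polynomial_near_of_continuousOn 0 1 f f.continuous.continuousOn
    (ε / (M + 1)) (by positivity)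
  have hpeq : ∫ x, p.eval x ∂μ = ∫ x, p.eval x ∂ν := by
    simp only [Polynomial.eval_eq_sum_range]
    rw [integral_finsetSum _ fun i _ => hint μ inferInstance hμ _ (by fun_prop),
      integral_finsetSum _ fun i _ => hint ν inferInstance hν _ (by fun_prop)]
    refine Finset.sum_congr rfl fun i _ => ?_
    rw [integral_const_mul, integral_const_mul, hmom]
  have hclose : ∀ ρ : Measure ℝ, IsFiniteMeasure ρ → (∀ᵐ x ∂ρ, x ∈ Set.Icc (0 : ℝ) 1) →
      |∫ x, p.eval x ∂ρ - ∫ x, f x ∂ρ| ≤ ε / (M + 1) * ρ.real Set.univ := by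
    intro ρ _ hρ
    rw [← integral_sub (hint ρ inferInstance hρ _ p.continuous)
      (hint ρ inferInstance hρ _ f.continuous)]
    refine norm_integral_le_of_norm_le_const (μ := ρ) (f := fun x => p.eval x - f x) ?_
    filter_upwards [hρ] with x hx using (hp x hx).le
  have h1 := abs_le.1 (hclose μ inferInstance hμ)
  have h2 := abs_le.1 (hclose ν inferInstance hν)
  have h3 : ε / (M + 1) * M ≤ ε := by
    rw [div_mul_eq_mul_div, div_le_iff₀ (by positivity)]
    nlinarith
  rw [hM, mul_add] at h3
  rw [Real.dist_eq, abs_le]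
  rw [hpeq] at h1
  constructor <;> linarith [h1.1, h1.2, h2.1, h2.2]

/-- The rising factorial `a (a + 1) ⋯ (a + n - 1)`. -/
def rising (a : ℝ) (n : ℕ) : ℝ := ∏ i ∈ Finset.range n, (a + i)

@[simp] lemma rising_zero (a : ℝ) : rising a 0 = 1 := by simp [rising]

@[simp] lemma rising_one (a : ℝ) : rising a 1 = a := by simp [rising]

lemma rising_succ (a : ℝ) (n : ℕ) : rising a (n + 1) = rising a n * (a + n) := by
  simp [rising, Finset.prod_range_succ]

lemma rising_succ' (a : ℝ) (n : ℕ) : rising a (n + 1) = a * rising (a + 1) n := by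
  rw [rising, Finset.prod_range_succ', mul_comm, Nat.cast_zero, add_zero, rising]
  congr 1
  exact Finset.prod_congr rfl fun i _ => by push_cast; ring

lemma rising_pos {a : ℝ} (ha : 0 < a) (n : ℕ) : 0 < rising a n :=
  Finset.prod_pos fun i _ => by positivity

lemma Gamma_add_nat {a : ℝ} (ha : 0 < a) (n : ℕ) :
    Real.Gamma (a + n) = rising a n * Real.Gamma a := by
  induction n with
  | zero => simp
  | succ n ih =>
    have : a + (n + 1 : ℕ) = (a + n) + 1 := by push_cast; ring
    rw [this, Real.Gamma_add_one (by positivity), ih, rising_succ]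
    ring

lemma beta_add_nat_left {a b : ℝ} (ha : 0 < a) (hb : 0 < b) (n : ℕ) :
    beta (a + n) b / beta a b = rising a n / rising (a + b) n := by
  have h1 : a + n + b = a + b + n := by ring
  have h2 := Real.Gamma_pos_of_pos ha
  have h3 := Real.Gamma_pos_of_pos hb
  have h4 := Real.Gamma_pos_of_pos (add_pos ha hb)
  have h5 := rising_pos (add_pos ha hb) n
  rw [beta, beta, h1, Gamma_add_nat ha, Gamma_add_nat (add_pos ha hb)]
  field_simp

lemma beta_add_nat_right {a b : ℝ} (ha : 0 < a) (hb : 0 < b) (n : ℕ) :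
    beta a (b + n) / beta a b = rising b n / rising (a + b) n := by
  have h := beta_add_nat_left hb ha n
  rwa [beta, beta, mul_comm, add_comm (b + n) a, mul_comm (Real.Gamma b), add_comm b a] at h

lemma measurable_betaPDF (a b : ℝ) : Measurable (betaPDF a b) :=
  (measurable_betaPDFReal a b).ennreal_ofReal

lemma betaMeasure_ae_mem (a b : ℝ) : ∀ᵐ x ∂(betaMeasure a b), x ∈ Set.Ioo (0 : ℝ) 1 := by
  rw [betaMeasure, ae_withDensity_iff (measurable_betaPDF a b)]
  refine ae_of_all _ fun x hx => ?_
  by_contra hx'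
  refine hx ?_
  rw [betaPDF_eq, if_neg (show ¬(0 < x ∧ x < 1) from hx'), ENNReal.ofReal_zero]

/-- The factor `x ^ n` turns the Beta(`a`, `b`) density into a multiple of the Beta(`a + n`, `b`)
density, and the multiple is the integral. -/
lemma lintegral_pow_betaMeasure {a b : ℝ} (ha : 0 < a) (hb : 0 < b) (n : ℕ) :
    ∫⁻ x, ENNReal.ofReal x ^ n ∂(betaMeasure a b)
      = ENNReal.ofReal (rising a n / rising (a + b) n) := by
  have hn : 0 < a + n := by positivity
  rw [betaMeasure, lintegral_withDensity_eq_lintegral_mul _ (measurable_betaPDF a b)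
    (by fun_prop), ← beta_add_nat_left ha hb]
  have : ∀ x, (betaPDF a b * fun x => ENNReal.ofReal x ^ n) x
      = ENNReal.ofReal (beta (a + n) b / beta a b) * betaPDF (a + n) b x := by
    intro x
    rw [Pi.mul_apply]
    by_cases hx : 0 < x ∧ x < 1
    · have h1 := beta_pos ha hb
      have h2 := beta_pos hn hb
      rw [betaPDF_of_pos_lt_one hx.1 hx.2, betaPDF_of_pos_lt_one hx.1 hx.2,
        ← ENNReal.ofReal_pow hx.1.le, ← ENNReal.ofReal_mul' (pow_nonneg hx.1.le n),
        ← ENNReal.ofReal_mul (by positivity)]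
      congr 1
      have : a + n - 1 = (a - 1) + n := by ring
      rw [this, Real.rpow_add_natCast hx.1.ne']
      field_simp
    · rw [betaPDF_eq, betaPDF_eq, if_neg hx, if_neg hx]
      simp
  rw [lintegral_congr this, lintegral_const_mul _ (measurable_betaPDF _ _),
    lintegral_betaPDF_eq_one hn hb, mul_one]

lemma lintegral_one_sub_pow_betaMeasure {a b : ℝ} (ha : 0 < a) (hb : 0 < b) (n : ℕ) :
    ∫⁻ x, ENNReal.ofReal (1 - x) ^ n ∂(betaMeasure a b)
      = ENNReal.ofReal (rising b n / rising (a + b) n) := by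
  have hn : 0 < b + n := by positivity
  rw [betaMeasure, lintegral_withDensity_eq_lintegral_mul _ (measurable_betaPDF a b)
    (by fun_prop), ← beta_add_nat_right ha hb]
  have : ∀ x, (betaPDF a b * fun x => ENNReal.ofReal (1 - x) ^ n) x
      = ENNReal.ofReal (beta a (b + n) / beta a b) * betaPDF a (b + n) x := by
    intro x
    rw [Pi.mul_apply]
    by_cases hx : 0 < x ∧ x < 1
    · have h1 := beta_pos ha hb
      have h2 := beta_pos ha hn
      have hx1 : 0 < 1 - x := sub_pos.2 hx.2
      rw [betaPDF_of_pos_lt_one hx.1 hx.2, betaPDF_of_pos_lt_one hx.1 hx.2,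
        ← ENNReal.ofReal_pow hx1.le, ← ENNReal.ofReal_mul' (pow_nonneg hx1.le n),
        ← ENNReal.ofReal_mul (by positivity)]
      congr 1
      have : b + n - 1 = (b - 1) + n := by ring
      rw [this, Real.rpow_add_natCast hx1.ne']
      field_simp
    · rw [betaPDF_eq, betaPDF_eq, if_neg hx, if_neg hx]
      simp
  rw [lintegral_congr this, lintegral_const_mul _ (measurable_betaPDF _ _),
    lintegral_betaPDF_eq_one ha hn, mul_one]

lemma measurable_gammaPDF (a r : ℝ) : Measurable (gammaPDF a r) :=
  (measurable_gammaPDFReal a r).ennreal_ofReal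

lemma gammaMeasure_ae_nonneg (a r : ℝ) : ∀ᵐ x ∂(gammaMeasure a r), 0 ≤ x := by
  rw [gammaMeasure, ae_withDensity_iff (measurable_gammaPDF a r)]
  refine ae_of_all _ fun x hx => ?_
  by_contra hx'
  exact hx (gammaPDF_of_neg (not_le.1 hx'))

/-- Exponential tilting: the factor `exp (-n x)` only changes the rate from `r` to `r + n`, up to
the normalizing constant. -/
lemma lintegral_exp_neg_pow_gammaMeasure {r : ℝ} (hr : 0 < r) (k n : ℕ) :
    ∫⁻ x, ENNReal.ofReal (Real.exp (-x)) ^ n ∂(gammaMeasure (k + 1) r)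
      = ENNReal.ofReal ((r / (r + n)) ^ (k + 1)) := by
  have hrn : 0 < r + n := by positivity
  have hk : (0 : ℝ) < k + 1 := by positivity
  rw [gammaMeasure, lintegral_withDensity_eq_lintegral_mul _ (measurable_gammaPDF _ r)
    (by fun_prop)]
  have : ∀ x, (gammaPDF (k + 1) r * fun x => ENNReal.ofReal (Real.exp (-x)) ^ n) x
      = ENNReal.ofReal ((r / (r + n)) ^ (k + 1)) * gammaPDF (k + 1) (r + n) x := by
    intro x
    rw [Pi.mul_apply]
    by_cases hx : 0 ≤ x
    · have h1 := Real.Gamma_pos_of_pos hk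
      rw [gammaPDF_of_nonneg hx, gammaPDF_of_nonneg hx, ← ENNReal.ofReal_pow (by positivity),
        ← ENNReal.ofReal_mul' (by positivity), ← ENNReal.ofReal_mul (by positivity)]
      congr 1
      have e1 : Real.exp (-x) ^ n = Real.exp (-(n * x)) := by
        rw [← Real.exp_nat_mul]; ring_nf
      have e2 : Real.exp (-((r + n) * x)) = Real.exp (-(r * x)) * Real.exp (-(n * x)) := by
        rw [← Real.exp_add]; ring_nf
      have e3 : ∀ y : ℝ, 0 < y → y ^ ((k : ℝ) + 1) = y ^ (k + 1) := by
        intro y _; rw [← Real.rpow_natCast]; push_cast; rfl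
      rw [e1, e2, e3 r hr, e3 _ hrn, div_pow]
      field_simp
    · rw [gammaPDF_of_neg (not_le.1 hx), gammaPDF_of_neg (not_le.1 hx)]
      simp
  rw [lintegral_congr this, lintegral_const_mul _ (measurable_gammaPDF _ _),
    lintegral_gammaPDF_eq_one hk hrn, mul_one]

end Moments

/-! ### Moment identities for the rate measure of the beta process. -/

section Rates

open Filter Topology

lemma betaMeasure_eq_restrict (a b : ℝ) :
    betaMeasure a b = (volume.restrict (Set.Ioc (0 : ℝ) 1)).withDensity fun x =>
      ENNReal.ofReal (1 / beta a b * x ^ (a - 1) * (1 - x) ^ (b - 1)) := by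
  rw [Measure.restrict_congr_set (Ioo_ae_eq_Ioc (a := (0 : ℝ)) (b := 1)).symm, betaMeasure,
    ← withDensity_indicator measurableSet_Ioo]
  congr 1
  ext x
  by_cases hx : x ∈ Set.Ioo (0 : ℝ) 1
  · rw [Set.indicator_of_mem hx, betaPDF_of_pos_lt_one hx.1 hx.2]
  · rw [Set.indicator_of_notMem hx, betaPDF_eq, if_neg (show ¬(0 < x ∧ x < 1) from hx),
      ENNReal.ofReal_zero]

/-- The size-biased rate measure of the beta process is a multiple of a beta distribution. -/
lemma betaProcessRate_withDensity {γ α d : ℝ} (hγ : 0 < γ) (hd1 : d < 1) (hα : -d < α) :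
    (betaProcessRate γ α d).withDensity ENNReal.ofReal
      = ENNReal.ofReal γ • betaMeasure (1 - d) (α + d) := by
  rw [betaMeasure_eq_restrict, betaProcessRate, ← withDensity_mul _ (by fun_prop) (by fun_prop),
    ← withDensity_smul _ (by fun_prop)]
  refine withDensity_congr_ae ?_
  filter_upwards [ae_restrict_mem measurableSet_Ioc] with x hx
  have h1 : 0 < 1 - d := by linarith
  have h2 : 0 < α + d := by linarith
  have hx1 : 0 ≤ 1 - x := sub_nonneg.2 hx.2
  have g1 := Real.Gamma_pos_of_pos h1
  have g2 := Real.Gamma_pos_of_pos h2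
  have g3 := Real.Gamma_pos_of_pos (show (0 : ℝ) < α + 1 by linarith)
  rw [Pi.mul_apply, Pi.smul_apply, smul_eq_mul, ← ENNReal.ofReal_mul' hx.1.le,
    ← ENNReal.ofReal_mul hγ.le, beta]
  congr 1
  have e1 : (1 : ℝ) - d - 1 = (-1 - d) + 1 := by ring
  have e2 : 1 - d + (α + d) = α + 1 := by ring
  rw [e1, e2, Real.rpow_add_one hx.1.ne']
  field_simp

lemma betaProcessRate_ae_mem (γ α d : ℝ) :
    ∀ᵐ x ∂(betaProcessRate γ α d), x ∈ Set.Ioc (0 : ℝ) 1 :=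
  (withDensity_absolutelyContinuous _ _).ae_le (ae_restrict_mem measurableSet_Ioc)

/-- A measure on the positive reals is determined by its size-biased version. -/
lemma measure_ext_of_withDensity_ofReal {μ ν : Measure ℝ} (hμ : ∀ᵐ x ∂μ, 0 < x)
    (hν : ∀ᵐ x ∂ν, 0 < x)
    (h : μ.withDensity ENNReal.ofReal = ν.withDensity ENNReal.ofReal) : μ = ν := by
  have key : ∀ ρ : Measure ℝ, (∀ᵐ x ∂ρ, 0 < x) →
      (ρ.withDensity ENNReal.ofReal).withDensity (fun x => (ENNReal.ofReal x)⁻¹) = ρ := by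
    intro ρ hρ
    refine withDensity_inv_same ENNReal.measurable_ofReal ?_ (ae_of_all _ fun x => by simp)
    filter_upwards [hρ] with x hx
    simpa using hx
  rw [← key μ hμ, h, key ν hν]

/-- The intensity of a sequence of Poisson rounds is the rate measure of the beta process as soon
as its moments are correct. -/
lemma sum_smul_eq_betaProcessRate {γ α d : ℝ} (hγ : 0 < γ) (hd1 : d < 1) (hα : -d < α)
    {lam : ℝ≥0} {η : ℕ → Measure ℝ} (hη : ∀ k, ∀ᵐ x ∂(η k), x ∈ Set.Ioc (0 : ℝ) 1)
    (hmom : ∀ n : ℕ, ∑' k, (lam : ℝ≥0∞) * ∫⁻ x, ENNReal.ofReal x ^ (n + 1) ∂(η k)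
      = ENNReal.ofReal (γ * (rising (1 - d) n / rising (α + 1) n))) :
    Measure.sum (fun k => (lam : ℝ≥0∞) • η k) = betaProcessRate γ α d := by
  have hsum : ∀ᵐ x ∂(Measure.sum fun k => (lam : ℝ≥0∞) • η k), x ∈ Set.Ioc (0 : ℝ) 1 :=
    (Measure.ae_sum_iff (μ := fun k => (lam : ℝ≥0∞) • η k)).2 fun k =>
      Measure.ae_smul_measure (hη k) _
  -- The rate measure has infinite mass, so the moments are compared after size-biasing, which
  -- raises the exponent in `hmom` to `n + 1`.
  refine measure_ext_of_withDensity_ofReal (hsum.mono fun x hx => hx.1)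
    ((betaProcessRate_ae_mem γ α d).mono fun x hx => hx.1) ?_
  have h1 : 0 < 1 - d := by linarith
  have h2 : 0 < α + d := by linarith
  have hmomS : ∀ n : ℕ, ∫⁻ x, ENNReal.ofReal x ^ n
      ∂((Measure.sum fun k => (lam : ℝ≥0∞) • η k).withDensity ENNReal.ofReal)
      = ENNReal.ofReal (γ * (rising (1 - d) n / rising (α + 1) n)) := by
    intro n
    rw [lintegral_withDensity_eq_lintegral_mul _ ENNReal.measurable_ofReal (by fun_prop),
      lintegral_sum_measure, ← hmom]
    refine tsum_congr fun k => ?_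
    rw [lintegral_smul_measure, smul_eq_mul]
    congr 1
    refine lintegral_congr fun x => ?_
    rw [Pi.mul_apply, pow_succ']
  have : IsProbabilityMeasure (betaMeasure (1 - d) (α + d)) := isProbabilityMeasureBeta h1 h2
  have hfin : IsFiniteMeasure
      ((Measure.sum fun k => (lam : ℝ≥0∞) • η k).withDensity ENNReal.ofReal) := by
    constructor
    have := hmomS 0
    simp only [pow_zero, lintegral_one] at this
    rw [this]
    exact ENNReal.ofReal_lt_top
  rw [betaProcessRate_withDensity hγ hd1 hα]
  have : IsFiniteMeasure (ENNReal.ofReal γ • betaMeasure (1 - d) (α + d)) := by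
    constructor
    simp
  refine measure_ext_of_moments ?_ ?_ fun n => ?_
  · exact (withDensity_absolutelyContinuous _ _).ae_le
      (hsum.mono fun x hx => Set.Ioc_subset_Icc_self hx)
  · exact Measure.ae_smul_measure
      ((betaMeasure_ae_mem _ _).mono fun x hx => Set.Ioo_subset_Icc_self hx) _
  · rw [hmomS, lintegral_smul_measure, lintegral_pow_betaMeasure h1 h2, smul_eq_mul,
      ← ENNReal.ofReal_mul hγ.le]
    congr 4
    ring

/-- The product of moments of the residual sticks after `k` breaks. -/
noncomputable def stickResidual (α d : ℝ) (n k : ℕ) : ℝ :=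
  ∏ j ∈ Finset.range k, rising (α + (j + 1) * d) n / rising (α + j * d + 1) n

/-- With `U` of law Beta(`1 - d`, `x + d`) and `U'` of law Beta(`1 - d`, `x + 2d`) this reads `E U^n
= E U^(n+1) + E (1 - U)^(n+1) * E U'^n`: a round contributes its own stick and leaves a scaled copy
of the process with `x + d` in place of `x`. Over the common denominator it is `(1 - d + n) + (x +
d) = x + 1 + n`. -/
lemma rising_ratio_recursion {x d : ℝ} (hd1 : d < 1) (hx : 0 < x + d) (n : ℕ) :
    rising (1 - d) n / rising (x + 1) n
      = rising (1 - d) (n + 1) / rising (x + 1) (n + 1)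
        + rising (x + d) (n + 1) / rising (x + 1) (n + 1)
          * (rising (1 - d) n / rising (x + d + 1) n) := by
  have h1 := rising_pos (show (0 : ℝ) < x + 1 by linarith) n
  have h2 := rising_pos (show (0 : ℝ) < x + d + 1 by linarith) n
  have h3 : 0 < x + 1 + n := by have : (0 : ℝ) ≤ n := by positivity
                                linarith
  rw [rising_succ' (x + d), rising_succ (1 - d), rising_succ (x + 1)]
  field_simp
  ring

lemma add_mul_pos {α d : ℝ} (hd0 : 0 ≤ d) (hα : -d < α) (k : ℕ) : 0 < α + k * d + d := by
  have : 0 ≤ k * d := by positivity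
  linarith

lemma stickResidual_pos {α d : ℝ} (hd0 : 0 ≤ d) (hd1 : d < 1) (hα : -d < α) (n k : ℕ) :
    0 < stickResidual α d n k := by
  refine Finset.prod_pos fun j _ => div_pos (rising_pos ?_ _) (rising_pos ?_ _)
  · linarith [add_mul_pos hd0 hα j]
  · linarith [add_mul_pos hd0 hα j]

/-- Telescoping of `rising_ratio_recursion` at `x = α + k * d`; the subtracted term is the share of
the rounds not yet summed. -/
lemma sum_range_stickMoment {α d : ℝ} (hd0 : 0 ≤ d) (hd1 : d < 1) (hα : -d < α) (n K : ℕ) :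
    ∑ k ∈ Finset.range K, rising (1 - d) (n + 1) / rising (α + k * d + 1) (n + 1)
        * stickResidual α d (n + 1) k
      = rising (1 - d) n / rising (α + 1) n
        - stickResidual α d (n + 1) K * (rising (1 - d) n / rising (α + K * d + 1) n) := by
  induction K with
  | zero => simp [stickResidual]
  | succ K ih =>
    have h := rising_ratio_recursion hd1 (add_mul_pos hd0 hα K) n
    have e : α + K * d + d = α + ((K : ℝ) + 1) * d := by ring
    rw [Finset.sum_range_succ, ih, h, stickResidual, stickResidual, Finset.prod_range_succ, e]
    push_cast
    ring

lemma rising_le_rising {x y : ℝ} (hx : 0 < x) (hxy : x ≤ y) (n : ℕ) : rising x n ≤ rising y n :=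
  Finset.prod_le_prod (fun i _ => by positivity) fun i _ => by linarith

/-- Each factor is at most `1 - (1 - d) / (α + j * d + 1)`, since the first quotient of the rising
factorials equals this and the others are at most 1. Hence it is at most `exp (-c / (j + 1))` with
`c = (1 - d) / (α + 2)`, and the harmonic series diverges. -/
lemma tendsto_stickResidual {α d : ℝ} (hd0 : 0 ≤ d) (hd1 : d < 1) (hα : -d < α) (n : ℕ) :
    Tendsto (stickResidual α d (n + 1)) atTop (𝓝 0) := by
  have hα1 : 0 < α + 1 := by linarith
  have hbound : ∀ K, stickResidual α d (n + 1) K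
      ≤ Real.exp (-((1 - d) / (α + 2) * ∑ j ∈ Finset.range K, 1 / ((j : ℝ) + 1))) := by
    intro K
    rw [Finset.mul_sum, ← Finset.sum_neg_distrib, Real.exp_sum]
    refine Finset.prod_le_prod (fun j _ => ?_) fun j _ => ?_
    · exact (div_pos (rising_pos (by linarith [add_mul_pos hd0 hα j]) _)
        (rising_pos (by linarith [add_mul_pos hd0 hα j]) _)).le
    · have hpos := add_mul_pos hd0 hα j
      have hj : (0 : ℝ) ≤ j := by positivity
      have hx : 0 < α + j * d + 1 := by linarith
      rw [rising_succ', rising_succ']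
      have e : α + ((j : ℝ) + 1) * d = α + j * d + d := by ring
      rw [e, mul_div_mul_comm]
      calc (α + j * d + d) / (α + j * d + 1)
            * (rising (α + j * d + d + 1) n / rising (α + j * d + 1 + 1) n)
          ≤ (α + j * d + d) / (α + j * d + 1) * 1 := by
            refine mul_le_mul_of_nonneg_left ?_ (by positivity)
            exact (div_le_one (rising_pos (by linarith) n)).2
              (rising_le_rising (by linarith) (by linarith) n)
        _ = 1 - (1 - d) / (α + j * d + 1) := by field_simp; ring
        -- The constant `α + 2` satisfies `α + j * d + 1 ≤ (α + 2) * (j + 1)`, because `α + 2 - d`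
        -- is positive.
        _ ≤ 1 - (1 - d) / (α + 2) * (1 / ((j : ℝ) + 1)) := by
            refine sub_le_sub_left ?_ _
            rw [div_mul_div_comm, mul_one]
            refine div_le_div_of_nonneg_left (by linarith) hx ?_
            nlinarith [mul_nonneg hj (show 0 ≤ α + 2 - d by linarith)]
        _ ≤ _ := by
            have := Real.add_one_le_exp (-((1 - d) / (α + 2) * (1 / ((j : ℝ) + 1))))
            linarith
  refine squeeze_zero (fun K => (stickResidual_pos hd0 hd1 hα _ K).le) hbound ?_
  refine Real.tendsto_exp_atBot.comp (tendsto_neg_atTop_atBot.comp ?_)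
  refine Tendsto.const_mul_atTop (div_pos (by linarith) (by linarith)) ?_
  exact Real.tendsto_sum_range_one_div_nat_succ_atTop

lemma stickMoment_nonneg {α d : ℝ} (hd0 : 0 ≤ d) (hd1 : d < 1) (hα : -d < α) (n k : ℕ) :
    0 ≤ rising (1 - d) n / rising (α + k * d + 1) n * stickResidual α d n k :=
  mul_nonneg (div_pos (rising_pos (by linarith) _)
    (rising_pos (by linarith [add_mul_pos hd0 hα k]) _)).le
    (stickResidual_pos hd0 hd1 hα _ _).le

/-- The stick-breaking moments add up to the moments of the beta process. -/
lemma hasSum_stickMoment {α d : ℝ} (hd0 : 0 ≤ d) (hd1 : d < 1) (hα : -d < α) (n : ℕ) :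
    HasSum (fun k : ℕ => rising (1 - d) (n + 1) / rising (α + k * d + 1) (n + 1)
      * stickResidual α d (n + 1) k) (rising (1 - d) n / rising (α + 1) n) := by
  rw [hasSum_iff_tendsto_nat_of_nonneg fun k => stickMoment_nonneg hd0 hd1 hα _ k]
  simp_rw [sum_range_stickMoment hd0 hd1 hα]
  have hr := rising_pos (show (0 : ℝ) < 1 - d by linarith) n
  -- The moment factor is largest at `K = 0`, so the residual sticks alone force the limit.
  have : Tendsto (fun K : ℕ => stickResidual α d (n + 1) K
      * (rising (1 - d) n / rising (α + K * d + 1) n)) atTop (𝓝 0) := by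
    have hα1 : 0 < α + 1 := by linarith
    have h0 := (tendsto_stickResidual hd0 hd1 hα n).mul_const
      (rising (1 - d) n / rising (α + 1) n)
    rw [zero_mul] at h0
    refine squeeze_zero (fun K => mul_nonneg (stickResidual_pos hd0 hd1 hα _ K).le
      (div_pos hr (rising_pos (by linarith [add_mul_pos hd0 hα K]) _)).le) (fun K => ?_) h0
    have hK : 0 ≤ K * d := by positivity
    exact mul_le_mul_of_nonneg_left (div_le_div_of_nonneg_left hr.le (rising_pos hα1 n)
      (rising_le_rising hα1 (by linarith) n)) (stickResidual_pos hd0 hd1 hα _ K).le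
  have h1 := (tendsto_const_nhds (x := rising (1 - d) n / rising (α + 1) n)).sub this
  rwa [sub_zero] at h1

/-- For first moments the total is 1 and the telescoped remainder is the residual stick itself; the
product in the truncation bound is this residual with its index shifted by one. -/
lemma hasSum_stickMean_tail {α d : ℝ} (hd0 : 0 ≤ d) (hd1 : d < 1) (hα : -d < α) (K : ℕ) :
    HasSum (fun k : ℕ => rising (1 - d) 1 / rising (α + (k + K : ℕ) * d + 1) 1
      * stickResidual α d 1 (k + K)) (∏ k ∈ Finset.Icc 1 K, (α + k * d) / (α + k * d - d + 1)) := by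
  have h := (hasSum_nat_add_iff' K).2 (hasSum_stickMoment hd0 hd1 hα 0)
  have hs := sum_range_stickMoment hd0 hd1 hα 0 K
  simp only [zero_add] at h hs
  rw [hs, rising_zero, rising_zero, rising_zero, div_one, mul_one, sub_sub_cancel] at h
  have e : ∀ K : ℕ, ∏ k ∈ Finset.Icc 1 K, (α + k * d) / (α + k * d - d + 1)
      = stickResidual α d 1 K := by
    intro K
    induction K with
    | zero => simp [stickResidual]
    | succ K ih =>
      rw [Finset.prod_Icc_succ_top (by omega), ih, stickResidual, stickResidual,
        Finset.prod_range_succ, rising_one, rising_one]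
      congr 1
      push_cast
      congr 1
      ring
  rw [e]
  exact h

/-- The moments of a decoupled Bondesson representation of `BP(γ, α, 0)` add up. -/
lemma hasSum_bondessonMoment {γ α ξ : ℝ} (hα : 0 < α) (hξ : 0 < ξ) (n : ℕ) :
    HasSum (fun k : ℕ => γ * α / ξ * (rising 1 (n + 1) / rising α (n + 1)
      * (ξ / (ξ + (n + 1 : ℕ))) ^ (k + 1))) (γ * (rising 1 n / rising (α + 1) n)) := by
  have hn : (0 : ℝ) < (n + 1 : ℕ) := by positivity
  have hr : ξ / (ξ + (n + 1 : ℕ)) < 1 := (div_lt_one (by positivity)).2 (by linarith)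
  -- The series `∑ r ^ (k + 1)` with ratio `r = ξ / (ξ + n + 1)` equals `ξ / (n + 1)`, so `ξ`
  -- cancels against the Poisson rate `γ * α / ξ`.
  have h := ((hasSum_geometric_of_lt_one (by positivity) hr).mul_left
    (ξ / (ξ + (n + 1 : ℕ)))).mul_left (γ * α / ξ * (rising 1 (n + 1) / rising α (n + 1)))
  convert! h using 1
  · ext k; ring
  · have h1 := rising_pos (show (0 : ℝ) < α + 1 by linarith) n
    rw [rising_succ, rising_succ']
    have : 1 - ξ / (ξ + (n + 1 : ℕ)) = (n + 1 : ℕ) / (ξ + (n + 1 : ℕ)) := by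
      field_simp; ring
    rw [this]
    push_cast at hn ⊢
    field_simp
    ring

/-- Starting a geometric series `K` terms later multiplies its sum by the `K`-th power of the ratio.
-/
lemma hasSum_bondessonMean_tail {γ α ξ : ℝ} (hα : 0 < α) (hξ : 0 < ξ) (K : ℕ) :
    HasSum (fun k : ℕ => γ * α / ξ * (rising 1 1 / rising α 1 * (ξ / (ξ + (1 : ℕ))) ^ (k + K + 1)))
      (γ * (ξ / (1 + ξ)) ^ K) := by
  have h := (hasSum_bondessonMoment (γ := γ) hα hξ 0).mul_left ((ξ / (1 + ξ)) ^ K)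
  convert! h using 1
  · ext k
    simp only [zero_add, Nat.cast_one, add_comm ξ 1]
    ring
  · simp [mul_comm]

end Rates

/-! ### Independent Poisson rounds: mean measure and generating functional. -/

section Rounds

open Filter Topology

variable {Ω : Type*} {E : Type*} [mE : MeasurableSpace E]

/-- The point process formed by the atoms of all rounds. -/
noncomputable def pointMeasure (C : ℕ → Ω → ℕ) (e : ℕ → ℕ → Ω → E) (ω : Ω) : Measure E :=
  Measure.sum fun k => ∑ i ∈ Finset.range (C k ω), Measure.dirac (e k i ω)

lemma pointMeasure_apply (C : ℕ → Ω → ℕ) (e : ℕ → ℕ → Ω → E) (ω : Ω) {B : Set E}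
    (hB : MeasurableSet B) : pointMeasure C e ω B
      = ∑' k, ∑ i ∈ Finset.range (C k ω), B.indicator 1 (e k i ω) := by
  simp only [pointMeasure, Measure.sum_apply _ hB, Measure.coe_finsetSum, Finset.sum_apply,
    Measure.dirac_apply' _ hB]

variable [mΩ : MeasurableSpace Ω]

/-- Rounds with independent Poisson numbers of atoms `e k i`, all independent, with law `η k` in
round `k`. -/
structure PoissonRounds (P : Measure Ω) (lam : ℝ≥0) (η : ℕ → Measure E) (C : ℕ → Ω → ℕ)
    (e : ℕ → ℕ → Ω → E) : Prop where
  measurable_C : ∀ k, Measurable (C k)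
  measurable_e : ∀ k i, Measurable (e k i)
  law_C : ∀ k, P.map (C k) = poissonMeasure lam
  law_e : ∀ k i, P.map (e k i) = η k
  indep : iIndep (Sum.elim (fun k : ℕ => MeasurableSpace.comap (C k) inferInstance)
    (fun q : ℕ × ℕ => MeasurableSpace.comap (e q.1 q.2) inferInstance)) P

/-- Used for sums and products over a random number of atoms: the count takes countably many values,
so measurability for each fixed count suffices. -/
lemma measurable_nat_dependent {F : Type*} [MeasurableSpace F] {C : Ω → ℕ} (hC : Measurable C)
    {f : ℕ → Ω → F} (hf : ∀ n, Measurable (f n)) : Measurable fun ω => f (C ω) ω :=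
  (measurable_from_prod_countable_right (f := fun p : ℕ × Ω => f p.1 p.2) hf).comp
    (hC.prodMk measurable_id)

lemma measurable_pointMeasure {C : ℕ → Ω → ℕ} {e : ℕ → ℕ → Ω → E} (hC : ∀ k, Measurable (C k))
    (he : ∀ k i, Measurable (e k i)) : Measurable (pointMeasure C e) := by
  refine Measure.measurable_of_measurable_coe _ fun s hs => ?_
  simp only [pointMeasure, Measure.sum_apply _ hs, Measure.coe_finsetSum, Finset.sum_apply]
  refine Measurable.tsum fun k => ?_
  refine measurable_nat_dependent (hC k)
    (f := fun n ω => ∑ i ∈ Finset.range n, Measure.dirac (e k i ω) s) fun n => ?_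
  exact Finset.measurable_sum _ fun i _ =>
    (Measure.measurable_coe hs).comp (Measure.measurable_dirac.comp (he k i))

lemma lintegral_natCast_poissonMeasure (lam : ℝ≥0) :
    ∫⁻ n : ℕ, (n : ℝ≥0∞) ∂(poissonMeasure lam) = lam := by
  rw [lintegral_countable']
  simp only [poissonMeasure_singleton]
  rw [tsum_eq_zero_add' ENNReal.summable]
  have h : ∀ n : ℕ, ((n + 1 : ℕ) : ℝ≥0∞)
      * ENNReal.ofReal (Real.exp (-lam) * lam ^ (n + 1) / ((n + 1).factorial))
      = lam * ENNReal.ofReal (Real.exp (-lam) * lam ^ n / (n.factorial)) := by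
    intro n
    rw [← ENNReal.ofReal_natCast, ← ENNReal.ofReal_coe_nnreal (p := lam),
      ← ENNReal.ofReal_mul (by positivity), ← ENNReal.ofReal_mul (by positivity)]
    congr 1
    rw [Nat.factorial_succ]
    push_cast
    field_simp
    ring
  simp_rw [h]
  rw [ENNReal.tsum_mul_left, ← ENNReal.ofReal_tsum_of_nonneg (fun n => by positivity)
    (hasSum_one_poissonMeasure lam).summable, (hasSum_one_poissonMeasure lam).tsum_eq]
  simp

namespace PoissonRounds

variable {P : Measure Ω} {lam : ℝ≥0} {η : ℕ → Measure E} {C : ℕ → Ω → ℕ} {e : ℕ → ℕ → Ω → E}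

lemma isProbabilityMeasure (H : PoissonRounds P lam η C e) : IsProbabilityMeasure P :=
  H.indep.isProbabilityMeasure

lemma isProbabilityMeasure_law (H : PoissonRounds P lam η C e) (k : ℕ) :
    IsProbabilityMeasure (η k) := by
  have := H.isProbabilityMeasure
  rw [← H.law_e k 0]
  exact Measure.isProbabilityMeasure_map (H.measurable_e k 0).aemeasurable

lemma shift (H : PoissonRounds P lam η C e) (K : ℕ) :
    PoissonRounds P lam (fun k => η (k + K)) (fun k => C (k + K)) (fun k => e (k + K)) where
  measurable_C k := H.measurable_C _
  measurable_e k i := H.measurable_e _ i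
  law_C k := H.law_C _
  law_e k i := H.law_e _ i
  indep := by
    have h := H.indep.precomp (g := Sum.map (fun k => k + K) (fun q : ℕ × ℕ => (q.1 + K, q.2)))
      ((add_left_injective K).sumMap fun a b hab => by
        simp only [Prod.mk.injEq, add_left_inj] at hab
        exact Prod.ext hab.1 hab.2)
    convert h using 1
    funext i
    rcases i with k | q <;> rfl

lemma comp {F : Type*} [MeasurableSpace F] (H : PoissonRounds P lam η C e) {f : E → F}
    (hf : Measurable f) :
    PoissonRounds P lam (fun k => (η k).map f) C (fun k i ω => f (e k i ω)) where
  measurable_C := H.measurable_C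
  measurable_e k i := hf.comp (H.measurable_e k i)
  law_C := H.law_C
  law_e k i := by
    rw [← H.law_e k i, Measure.map_map hf (H.measurable_e k i)]
    rfl
  indep := by
    refine iIndep_of_iIndep_of_le H.indep fun i => ?_
    rcases i with k | q
    · exact le_rfl
    · exact Measurable.comap_le (hf.comp (comap_measurable _))

lemma comap_le (H : PoissonRounds P lam η C e) (i : ℕ ⊕ ℕ × ℕ) :
    Sum.elim (fun k : ℕ => MeasurableSpace.comap (C k) inferInstance)
      (fun q : ℕ × ℕ => MeasurableSpace.comap (e q.1 q.2) inferInstance) i ≤ mΩ := by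
  rcases i with k | q
  · exact (H.measurable_C k).comap_le
  · exact (H.measurable_e q.1 q.2).comap_le

lemma iIndepFun_atoms (H : PoissonRounds P lam η C e) (k : ℕ) : iIndepFun (e k) P := by
  rw [iIndepFun_iff_iIndep]
  exact H.indep.precomp (g := fun i : ℕ => Sum.inr (k, i)) fun a b hab => by simpa using hab

lemma indepFun_count_atoms (H : PoissonRounds P lam η C e) (k : ℕ) :
    IndepFun (C k) (fun ω i => e k i ω) P := by
  have h := indep_iSup_of_disjoint H.comap_le H.indep
    (S := {Sum.inl k}) (T := Set.range fun i : ℕ => Sum.inr (k, i)) (by simp)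
  rw [IndepFun_iff_Indep]
  refine indep_of_indep_of_le h ?_ ?_
  · exact le_iSup₂_of_le (Sum.inl k) rfl le_rfl
  · refine Measurable.comap_le ?_
    refine @measurable_pi_lambda _ _ _ (_) _ _ fun i => ?_
    refine Measurable.mono (comap_measurable (e k i)) ?_ le_rfl
    exact le_iSup₂_of_le (f := fun j (_ : j ∈ Set.range fun i : ℕ => Sum.inr (k, i)) => Sum.elim
      (fun k : ℕ => MeasurableSpace.comap (C k) inferInstance)
      (fun q : ℕ × ℕ => MeasurableSpace.comap (e q.1 q.2) inferInstance) j)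
      (Sum.inr (k, i)) ⟨i, rfl⟩ le_rfl

/-- Allows conditioning on the number of atoms by Fubini's theorem. -/
lemma map_count_atoms (H : PoissonRounds P lam η C e) (k : ℕ) :
    P.map (fun ω => (C k ω, fun i => e k i ω))
      = (poissonMeasure lam).prod (P.map fun ω i => e k i ω) := by
  have := H.isProbabilityMeasure
  rw [(indepFun_iff_map_prod_eq_prod_map_map (H.measurable_C k).aemeasurable
    (measurable_pi_lambda _ fun i => H.measurable_e k i).aemeasurable).1
      (H.indepFun_count_atoms k), H.law_C]

lemma measurable_seq (H : PoissonRounds P lam η C e) (k : ℕ) :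
    Measurable fun ω i => e k i ω := measurable_pi_lambda _ fun i => H.measurable_e k i

/-- Wald's identity: given `n` atoms the mean is `n * η k B`, and the Poisson mean of `n` is `lam`.
-/
lemma lintegral_round (H : PoissonRounds P lam η C e) (k : ℕ) {B : Set E}
    (hB : MeasurableSet B) :
    ∫⁻ ω, ∑ i ∈ Finset.range (C k ω), B.indicator 1 (e k i ω) ∂P = lam * η k B := by
  have := H.isProbabilityMeasure
  have hI : Measurable (B.indicator (1 : E → ℝ≥0∞)) := measurable_one.indicator hB
  set F : ℕ × (ℕ → E) → ℝ≥0∞ := fun p => ∑ i ∈ Finset.range p.1, B.indicator 1 (p.2 i) with hF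
  have hFm : Measurable F := measurable_from_prod_countable_right fun n => by
    simp only [hF]
    exact Finset.measurable_sum _ fun i _ => hI.comp (measurable_pi_apply i)
  have h1 : ∫⁻ ω, ∑ i ∈ Finset.range (C k ω), B.indicator 1 (e k i ω) ∂P
      = ∫⁻ p, F p ∂(P.map (fun ω => (C k ω, fun i => e k i ω))) := by
    rw [lintegral_map hFm ((H.measurable_C k).prodMk (H.measurable_seq k))]
  have := Measure.isProbabilityMeasure_map (μ := P) (H.measurable_seq k).aemeasurable
  rw [h1, H.map_count_atoms, lintegral_prod _ hFm.aemeasurable]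
  have h2 : ∀ n : ℕ, ∫⁻ y, F (n, y) ∂(P.map fun ω i => e k i ω) = n * η k B := by
    intro n
    have hIi : ∀ i, Measurable fun y : ℕ → E => B.indicator (1 : E → ℝ≥0∞) (y i) :=
      fun i => hI.comp (measurable_pi_apply i)
    simp only [hF]
    rw [lintegral_finsetSum _ fun i _ => hIi i]
    have h3 : ∀ i, ∫⁻ y, B.indicator 1 (y i) ∂(P.map fun ω i => e k i ω) = η k B := by
      intro i
      rw [lintegral_map (hIi i) (H.measurable_seq k),
        ← lintegral_map hI (H.measurable_e k i), H.law_e, lintegral_indicator_one hB]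
    simp [h3]
  simp_rw [h2]
  rw [lintegral_mul_const _ (measurable_of_countable _), lintegral_natCast_poissonMeasure]

/-- The mean measure of the point process formed by the atoms. -/
lemma bind_pointMeasure (H : PoissonRounds P lam η C e) :
    P.bind (pointMeasure C e) = Measure.sum fun k => (lam : ℝ≥0∞) • η k := by
  ext B hB
  rw [Measure.bind_apply hB (measurable_pointMeasure H.measurable_C H.measurable_e).aemeasurable,
    Measure.sum_apply _ hB]
  simp_rw [pointMeasure_apply C e _ hB]
  rw [lintegral_tsum]
  · exact tsum_congr fun k => by rw [H.lintegral_round k hB]; rfl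
  · intro k
    refine (measurable_nat_dependent (H.measurable_C k)
      (f := fun n ω => ∑ i ∈ Finset.range n, B.indicator 1 (e k i ω)) fun n => ?_).aemeasurable
    exact Finset.measurable_sum _ fun i _ =>
      (measurable_one.indicator hB).comp (H.measurable_e k i)

lemma integral_prod_atoms (H : PoissonRounds P lam η C e) (k n : ℕ) {h : E → ℂ}
    (hm : Measurable h) :
    ∫ ω, ∏ i ∈ Finset.range n, h (e k i ω) ∂P = (∫ x, h x ∂(η k)) ^ n := by
  have hind := (H.iIndepFun_atoms k).precomp (g := fun i : Fin n => (i : ℕ)) Fin.val_injective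
  have h1 := hind.integral_fun_prod_comp (f := fun _ => h)
    (fun i => (H.measurable_e k i).aemeasurable)
    (fun i => hm.aestronglyMeasurable)
  simp_rw [Finset.prod_range]
  refine h1.trans ?_
  have h2 : ∀ i, ∫ ω, h (e k i ω) ∂P = ∫ x, h x ∂(η k) := by
    intro i
    rw [← H.law_e k i, integral_map (H.measurable_e k i).aemeasurable hm.aestronglyMeasurable]
  simp [h2]

/-- The probability generating functional of one round. -/
lemma integral_prod_round (H : PoissonRounds P lam η C e) (k : ℕ) {h : E → ℂ}
    (hm : Measurable h) (hb : ∀ x, ‖h x‖ ≤ 1) :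
    ∫ ω, ∏ i ∈ Finset.range (C k ω), h (e k i ω) ∂P
      = Complex.exp (lam * (∫ x, h x ∂(η k) - 1)) := by
  have := H.isProbabilityMeasure
  set F : ℕ × (ℕ → E) → ℂ := fun p => ∏ i ∈ Finset.range p.1, h (p.2 i) with hF
  have hFm : Measurable F := measurable_from_prod_countable_right fun n => by
    simp only [hF]
    exact Finset.measurable_prod _ fun i _ => hm.comp (measurable_pi_apply i)
  have h1 : ∫ ω, ∏ i ∈ Finset.range (C k ω), h (e k i ω) ∂P
      = ∫ p, F p ∂(P.map (fun ω => (C k ω, fun i => e k i ω))) := by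
    rw [integral_map ((H.measurable_C k).prodMk (H.measurable_seq k)).aemeasurable
      hFm.aestronglyMeasurable]
  have := Measure.isProbabilityMeasure_map (μ := P) (H.measurable_seq k).aemeasurable
  have hFb : ∀ p, ‖F p‖ ≤ 1 := by
    intro p
    rw [hF, norm_prod]
    exact Finset.prod_le_one (fun i _ => norm_nonneg _) fun i _ => hb _
  have hFi : Integrable F ((poissonMeasure lam).prod (P.map fun ω i => e k i ω)) :=
    Integrable.of_bound hFm.aestronglyMeasurable 1 (ae_of_all _ hFb)
  rw [h1, H.map_count_atoms, integral_prod _ hFi]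
  have h2 : ∀ n : ℕ, ∫ y, F (n, y) ∂(P.map fun ω i => e k i ω) = (∫ x, h x ∂(η k)) ^ n := by
    intro n
    have hFn : Measurable fun y => F (n, y) := hFm.comp measurable_prodMk_left
    rw [integral_map (H.measurable_seq k).aemeasurable hFn.aestronglyMeasurable]
    exact H.integral_prod_atoms k n hm
  simp_rw [h2]
  set z := ∫ x, h x ∂(η k) with hz
  rw [integral_poissonMeasure]
  -- The Poisson generating function: averaging `z ^ n` gives `exp (-lam) * exp (lam * z)`.
  have h3 := (NormedSpace.expSeries_div_hasSum_exp ((lam : ℂ) * z)).mul_left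
    (Complex.exp (-lam))
  rw [← Complex.exp_eq_exp_ℂ, ← Complex.exp_add] at h3
  have h4 : (lam : ℂ) * (z - 1) = -lam + lam * z := by ring
  rw [h4, ← h3.tsum_eq]
  refine tsum_congr fun n => ?_
  rw [Complex.real_smul]
  push_cast
  rw [mul_pow]
  ring

/-- The probability generating functional of the first `K` rounds. -/
lemma integral_prod_rounds (H : PoissonRounds P lam η C e) (K : ℕ) {h : E → ℂ}
    (hm : Measurable h) (hb : ∀ x, ‖h x‖ ≤ 1) :
    ∫ ω, ∏ k ∈ Finset.range K, ∏ i ∈ Finset.range (C k ω), h (e k i ω) ∂P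
      = Complex.exp (∑ k ∈ Finset.range K, lam * (∫ x, h x ∂(η k) - 1)) := by
  set R : ℕ → Ω → ℂ := fun k ω => ∏ i ∈ Finset.range (C k ω), h (e k i ω) with hR
  -- The σ-algebra is left free: the ambient one serves integrability, the one generated by a single
  -- round serves independence.
  have hRm : ∀ (m : MeasurableSpace Ω) (k : ℕ), Measurable[m] (C k) →
      (∀ i, Measurable[m] (e k i)) → Measurable[m] (R k) := by
    intro m k h1 h2
    exact @measurable_nat_dependent _ m _ _ _ h1
      (fun n ω => ∏ i ∈ Finset.range n, h (e k i ω)) fun n =>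
        Finset.measurable_prod _ fun i _ => hm.comp (h2 i)
  have hgrp := iIndep_iSup_fiber H.comap_le H.indep (Sum.elim id Prod.fst)
  have hRi : iIndepFun R P := by
    rw [iIndepFun_iff_iIndep]
    refine iIndep_of_iIndep_of_le hgrp fun k => Measurable.comap_le (hRm _ k ?_ fun i => ?_)
    · exact Measurable.mono (comap_measurable (C k)) (le_iSup₂_of_le
        (f := fun j (_ : j ∈ {i | Sum.elim id Prod.fst i = k}) => Sum.elim
        (fun k : ℕ => MeasurableSpace.comap (C k) inferInstance)
        (fun q : ℕ × ℕ => MeasurableSpace.comap (e q.1 q.2) inferInstance) j)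
        (Sum.inl k) rfl le_rfl) le_rfl
    · exact Measurable.mono (comap_measurable (e k i)) (le_iSup₂_of_le
        (f := fun j (_ : j ∈ {i | Sum.elim id Prod.fst i = k}) => Sum.elim
        (fun k : ℕ => MeasurableSpace.comap (C k) inferInstance)
        (fun q : ℕ × ℕ => MeasurableSpace.comap (e q.1 q.2) inferInstance) j)
        (Sum.inr (k, i)) rfl le_rfl) le_rfl
  have h1 := (hRi.precomp (g := fun i : Fin K => (i : ℕ))
    Fin.val_injective).integral_fun_prod_eq_prod_integral
      (fun i => (hRm _ i (H.measurable_C i) (H.measurable_e i)).aestronglyMeasurable)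
  rw [Complex.exp_sum]
  simp_rw [Finset.prod_range (n := K)]
  refine h1.trans (Finset.prod_congr rfl fun k _ => ?_)
  exact H.integral_prod_round k hm hb

end PoissonRounds

end Rounds

/-! ### The atoms of Poisson rounds form a Poisson point process. -/

section PoissonProcess

open Filter Topology

variable {Ω : Type*} {E : Type*} [mE : MeasurableSpace E]

lemma hasSum_toReal_pointMeasure {C : ℕ → Ω → ℕ} {e : ℕ → ℕ → Ω → E} {ω : Ω} {B : Set E} (hB : MeasurableSet B)
    (h : pointMeasure C e ω B ≠ ∞) :
    HasSum (fun k => ∑ i ∈ Finset.range (C k ω), B.indicator (1 : E → ℝ) (e k i ω))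
      (pointMeasure C e ω B).toReal := by
  rw [pointMeasure_apply C e ω hB] at h ⊢
  have hind : ∀ x, (B.indicator (1 : E → ℝ≥0∞) x).toReal = B.indicator (1 : E → ℝ) x := by
    intro x
    by_cases hx : x ∈ B <;> simp [hx]
  have hne : ∀ x, B.indicator (1 : E → ℝ≥0∞) x ≠ ∞ := by
    intro x
    by_cases hx : x ∈ B <;> simp [hx]
  have h2 := ENNReal.hasSum_toReal h
  rw [← ENNReal.tsum_toReal_eq (fun k => ENNReal.ne_top_of_tsum_ne_top h k)] at h2
  convert! h2 using 1
  ext k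
  rw [ENNReal.toReal_sum fun i _ => hne _]
  exact Finset.sum_congr rfl fun i _ => (hind _).symm

lemma hasSum_toReal_sum_smul (η : ℕ → Measure E) (lam : ℝ≥0) {B : Set E} (hB : MeasurableSet B)
    (hfin : (Measure.sum fun k => (lam : ℝ≥0∞) • η k) B ≠ ∞) :
    HasSum (fun k => lam * (η k).real B)
      ((Measure.sum fun k => (lam : ℝ≥0∞) • η k) B).toReal := by
  rw [Measure.sum_apply _ hB] at hfin ⊢
  have h2 := ENNReal.hasSum_toReal hfin
  rw [← ENNReal.tsum_toReal_eq (fun k => ENNReal.ne_top_of_tsum_ne_top hfin k)] at h2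
  convert! h2 using 1
  ext k
  simp [Measure.real]

variable [mΩ : MeasurableSpace Ω]

namespace PoissonRounds

variable {P : Measure Ω} {lam : ℝ≥0} {η : ℕ → Measure E} {C : ℕ → Ω → ℕ} {e : ℕ → ℕ → Ω → E}

lemma measurable_pointMeasure_apply (H : PoissonRounds P lam η C e) {B : Set E}
    (hB : MeasurableSet B) : Measurable fun ω => pointMeasure C e ω B :=
  (Measure.measurable_coe hB).comp (measurable_pointMeasure H.measurable_C H.measurable_e)

lemma lintegral_pointMeasure (H : PoissonRounds P lam η C e) {B : Set E}
    (hB : MeasurableSet B) : ∫⁻ ω, pointMeasure C e ω B ∂P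
      = (Measure.sum fun k => (lam : ℝ≥0∞) • η k) B := by
  rw [← H.bind_pointMeasure, Measure.bind_apply hB
    (measurable_pointMeasure H.measurable_C H.measurable_e).aemeasurable]

lemma ae_pointMeasure_ne_top (H : PoissonRounds P lam η C e) {B : Set E}
    (hB : MeasurableSet B) (hfin : (Measure.sum fun k => (lam : ℝ≥0∞) • η k) B ≠ ∞) :
    ∀ᵐ ω ∂P, pointMeasure C e ω B ≠ ∞ := by
  rw [← H.lintegral_pointMeasure hB] at hfin
  filter_upwards [ae_lt_top (H.measurable_pointMeasure_apply hB) hfin] with ω h using h.ne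

/-- The joint characteristic function of the numbers of points in disjoint sets. -/
lemma integral_exp_pointMeasure (H : PoissonRounds P lam η C e) {ι : Type*} [Fintype ι]
    {B : ι → Set E} (hB : ∀ j, MeasurableSet (B j)) (hdis : ∀ i j, i ≠ j → Disjoint (B i) (B j))
    (hfin : ∀ j, (Measure.sum fun k => (lam : ℝ≥0∞) • η k) (B j) ≠ ∞) (t : ι → ℝ) :
    ∫ ω, Complex.exp ((∑ j, t j * (pointMeasure C e ω (B j)).toReal : ℝ) * Complex.I) ∂P
      = Complex.exp (∑ j, (Complex.exp (t j * Complex.I) - 1)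
          * ((Measure.sum fun k => (lam : ℝ≥0∞) • η k) (B j)).toReal) := by
  classical
  have := H.isProbabilityMeasure
  have hindm : ∀ j, Measurable ((B j).indicator (1 : E → ℝ)) :=
    fun j => measurable_one.indicator (hB j)
  -- Chosen so that the product of `h` over the atoms is the exponential of `i ∑ t j` times the
  -- counts in `B j`.
  set h : E → ℂ := fun x => Complex.exp ((∑ j, t j * (B j).indicator 1 x : ℝ) * Complex.I) with hh
  have hm : Measurable h := by
    refine Complex.measurable_exp.comp (Measurable.mul_const ?_ _)
    exact Complex.measurable_ofReal.comp (Finset.measurable_sum _ fun j _ => (hindm j).const_mul _)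
  have hb : ∀ x, ‖h x‖ ≤ 1 := fun x => (Complex.norm_exp_ofReal_mul_I _).le
  -- A point lies in at most one of the disjoint sets, which makes the exponential affine in the
  -- indicators.
  have hexp : ∀ x, h x = 1 + ∑ j, (Complex.exp (t j * Complex.I) - 1)
      * ((B j).indicator (1 : E → ℝ) x : ℝ) := by
    intro x
    by_cases hx : ∃ j, x ∈ B j
    · obtain ⟨j, hj⟩ := hx
      have hz : ∀ i, i ≠ j → (B i).indicator (1 : E → ℝ) x = 0 := fun i hi =>
        Set.indicator_of_notMem (fun hxi => Set.disjoint_left.1 (hdis i j hi) hxi hj) _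
      simp only [hh]
      rw [Finset.sum_eq_single j (fun i _ hi => by rw [hz i hi, mul_zero]) (by simp),
        Finset.sum_eq_single j (fun i _ hi => by rw [hz i hi, Complex.ofReal_zero, mul_zero])
          (by simp), Set.indicator_of_mem hj]
      simp
    · push Not at hx
      have hz : ∀ i, (B i).indicator (1 : E → ℝ) x = 0 := fun i =>
        Set.indicator_of_notMem (hx i) _
      simp [hh, hz]
  have hint : ∀ k, ∫ x, h x ∂(η k) - 1
      = ∑ j, (Complex.exp (t j * Complex.I) - 1) * ((η k).real (B j) : ℝ) := by
    intro k
    have := H.isProbabilityMeasure_law k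
    have hi : ∀ j, Integrable (fun x => (((B j).indicator (1 : E → ℝ) x : ℝ) : ℂ)) (η k) :=
      fun j => ((integrable_const (1 : ℝ)).indicator (hB j)).ofReal
    simp_rw [hexp]
    rw [integral_add (integrable_const _) (integrable_finsetSum _ fun j _ => (hi j).const_mul _),
      integral_finsetSum _ fun j _ => (hi j).const_mul _]
    simp only [integral_const, probReal_univ, one_smul, add_sub_cancel_left]
    refine Finset.sum_congr rfl fun j _ => ?_
    rw [integral_const_mul, integral_complex_ofReal, integral_indicator_one (hB j)]
  have hpart : ∀ K ω, ∏ k ∈ Finset.range K, ∏ i ∈ Finset.range (C k ω), h (e k i ω)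
      = Complex.exp ((∑ j, t j * ∑ k ∈ Finset.range K, ∑ i ∈ Finset.range (C k ω),
          (B j).indicator 1 (e k i ω) : ℝ) * Complex.I) := by
    intro K ω
    simp only [hh, ← Complex.exp_sum, ← Finset.sum_mul, ← Complex.ofReal_sum]
    congr 3
    simp only [Finset.mul_sum]
    rw [Finset.sum_comm]
    rw [Finset.sum_congr rfl fun k _ => Finset.sum_comm, Finset.sum_comm]
  -- All integrands have modulus at most 1, and the partial counts converge because the full counts
  -- are almost surely finite.
  have hlim1 : Tendsto (fun K => ∫ ω, ∏ k ∈ Finset.range K, ∏ i ∈ Finset.range (C k ω),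
      h (e k i ω) ∂P) atTop (𝓝 (∫ ω, Complex.exp
        ((∑ j, t j * (pointMeasure C e ω (B j)).toReal : ℝ) * Complex.I) ∂P)) := by
    refine tendsto_integral_of_dominated_convergence (fun _ => 1) (fun K => ?_)
      (integrable_const _) (fun K => ae_of_all _ fun ω => ?_) ?_
    · refine (Finset.measurable_prod _ fun k _ => ?_).aestronglyMeasurable
      exact measurable_nat_dependent (H.measurable_C k)
        (f := fun n ω => ∏ i ∈ Finset.range n, h (e k i ω)) fun n =>
          Finset.measurable_prod _ fun i _ => hm.comp (H.measurable_e k i)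
    · rw [hpart]
      exact (Complex.norm_exp_ofReal_mul_I _).le
    · filter_upwards [ae_all_iff.2 fun j => H.ae_pointMeasure_ne_top (hB j) (hfin j)] with ω hω
      simp_rw [hpart]
      refine (Complex.continuous_exp.tendsto _).comp (Tendsto.mul_const _ ?_)
      refine (Complex.continuous_ofReal.tendsto _).comp (tendsto_finsetSum _ fun j _ => ?_)
      exact (hasSum_toReal_pointMeasure (hB j) (hω j)).tendsto_sum_nat.const_mul _
  refine tendsto_nhds_unique hlim1 ?_
  simp_rw [H.integral_prod_rounds _ hm hb, hint]
  refine (Complex.continuous_exp.tendsto _).comp ?_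
  have hre : ∀ K : ℕ, ∑ k ∈ Finset.range K, (lam : ℂ) * ∑ j, (Complex.exp (t j * Complex.I) - 1)
        * ((η k).real (B j) : ℝ)
      = ∑ j, (Complex.exp (t j * Complex.I) - 1)
        * ((∑ k ∈ Finset.range K, lam * (η k).real (B j) : ℝ) : ℂ) := by
    intro K
    simp only [Finset.mul_sum, Complex.ofReal_sum]
    rw [Finset.sum_comm]
    refine Finset.sum_congr rfl fun j _ => Finset.sum_congr rfl fun k _ => ?_
    push_cast
    ring
  simp_rw [hre]
  refine tendsto_finsetSum _ fun j _ => Tendsto.const_mul _ ?_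
  exact (Complex.continuous_ofReal.tendsto _).comp
    (hasSum_toReal_sum_smul η lam (hB j) (hfin j)).tendsto_sum_nat

lemma integral_exp_pointMeasure_single (H : PoissonRounds P lam η C e) {B : Set E}
    (hB : MeasurableSet B) (hfin : (Measure.sum fun k => (lam : ℝ≥0∞) • η k) B ≠ ∞) (t : ℝ) :
    ∫ ω, Complex.exp (t * (pointMeasure C e ω B).toReal * Complex.I) ∂P
      = Complex.exp ((Complex.exp (t * Complex.I) - 1)
          * ((Measure.sum fun k => (lam : ℝ≥0∞) • η k) B).toReal) := by
  have h := H.integral_exp_pointMeasure (ι := Unit) (B := fun _ => B) (fun _ => hB)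
    (fun i j hij => (hij rfl).elim) (fun _ => hfin) (fun _ => t)
  simpa using h

lemma map_toReal_pointMeasure (H : PoissonRounds P lam η C e) {B : Set E}
    (hB : MeasurableSet B) (hfin : (Measure.sum fun k => (lam : ℝ≥0∞) • η k) B ≠ ∞) :
    P.map (fun ω => (pointMeasure C e ω B).toReal)
      = (poissonMeasure ((Measure.sum fun k => (lam : ℝ≥0∞) • η k) B).toNNReal).map
        (fun n : ℕ => (n : ℝ)) := by
  have := H.isProbabilityMeasure
  have hm := (H.measurable_pointMeasure_apply hB).ennreal_toReal
  have := Measure.isProbabilityMeasure_map (μ := P) hm.aemeasurable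
  refine Measure.ext_of_charFun (funext fun t => ?_)
  rw [charFun_map_cast_poissonMeasure, charFun_apply_real, integral_map hm.aemeasurable
    (by fun_prop), H.integral_exp_pointMeasure_single hB hfin, mul_comm]
  rfl

lemma pointMeasure_law_of_finite (H : PoissonRounds P lam η C e) {B : Set E}
    (hB : MeasurableSet B) (hfin : (Measure.sum fun k => (lam : ℝ≥0∞) • η k) B ≠ ∞) :
    P.map (fun ω => pointMeasure C e ω B)
      = (poissonMeasure ((Measure.sum fun k => (lam : ℝ≥0∞) • η k) B).toNNReal).map
        (fun n : ℕ => (n : ℝ≥0∞)) := by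
  have hm := (H.measurable_pointMeasure_apply hB).ennreal_toReal
  have h1 : (fun ω => pointMeasure C e ω B)
      =ᵐ[P] ENNReal.ofReal ∘ fun ω => (pointMeasure C e ω B).toReal := by
    filter_upwards [H.ae_pointMeasure_ne_top hB hfin] with ω hω
    exact (ENNReal.ofReal_toReal hω).symm
  rw [Measure.map_congr h1, ← Measure.map_map ENNReal.measurable_ofReal hm,
    H.map_toReal_pointMeasure hB hfin, Measure.map_map ENNReal.measurable_ofReal
      (measurable_of_countable _)]
  congr 1
  ext n
  simp

/-- The joint characteristic function is the exponential of a sum over `j`, hence the product of the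
marginal ones. -/
lemma iIndepFun_toReal_pointMeasure (H : PoissonRounds P lam η C e) {ι : Type*} [Fintype ι]
    {B : ι → Set E} (hB : ∀ j, MeasurableSet (B j)) (hdis : ∀ i j, i ≠ j → Disjoint (B i) (B j))
    (hfin : ∀ j, (Measure.sum fun k => (lam : ℝ≥0∞) • η k) (B j) ≠ ∞) :
    iIndepFun (fun j ω => (pointMeasure C e ω (B j)).toReal) P := by
  have := H.isProbabilityMeasure
  have hm := fun j => (H.measurable_pointMeasure_apply (hB j)).ennreal_toReal
  rw [iIndepFun_iff_charFun_pi fun j => (hm j).aemeasurable]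
  intro t
  have h1 : ∀ j, charFun (P.map fun ω => (pointMeasure C e ω (B j)).toReal) (t j)
      = Complex.exp ((Complex.exp (t j * Complex.I) - 1)
        * ((Measure.sum fun k => (lam : ℝ≥0∞) • η k) (B j)).toReal) := by
    intro j
    rw [charFun_apply_real, integral_map (hm j).aemeasurable (by fun_prop),
      H.integral_exp_pointMeasure_single (hB j) (hfin j)]
  have hL : Measurable fun ω => WithLp.toLp 2 fun j => (pointMeasure C e ω (B j)).toReal :=
    (WithLp.measurable_toLp 2 _).comp (measurable_pi_lambda _ hm)
  simp_rw [h1]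
  rw [← Complex.exp_sum, ← H.integral_exp_pointMeasure hB hdis hfin, charFun_apply,
    integral_map hL.aemeasurable (by fun_prop)]
  refine integral_congr_ae (ae_of_all _ fun ω => ?_)
  simp [PiLp.inner_apply]

/-- The Laplace transform of the count `S K` in `B` from the first `K` rounds is `exp (-c * ∑ lam *
η k B)`, which tends to 0 since the series diverges. By Markov's inequality the counts are almost
surely unbounded. -/
lemma pointMeasure_law_of_infinite (H : PoissonRounds P lam η C e) {B : Set E}
    (hB : MeasurableSet B) (hinf : (Measure.sum fun k => (lam : ℝ≥0∞) • η k) B = ∞) :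
    ∀ᵐ ω ∂P, pointMeasure C e ω B = ∞ := by
  classical
  have := H.isProbabilityMeasure
  have hindm : Measurable (B.indicator (1 : E → ℝ)) := measurable_one.indicator hB
  -- With this constant `exp (-1_B) = 1 - c * 1_B`, so the generating functional involves only `η k
  -- B`.
  set c : ℝ := 1 - Real.exp (-1) with hc
  have hc0 : 0 < c := by
    have : Real.exp (-1) < 1 := by simp
    rw [hc]; linarith
  set h : E → ℂ := fun x => Complex.exp ((-B.indicator 1 x : ℝ)) with hh
  have hm : Measurable h :=
    Complex.measurable_exp.comp (Complex.measurable_ofReal.comp hindm.neg)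
  have hb : ∀ x, ‖h x‖ ≤ 1 := by
    intro x
    rw [hh, Complex.norm_exp, Complex.ofReal_re, Real.exp_le_one_iff, neg_nonpos]
    exact Set.indicator_nonneg (fun _ _ => zero_le_one) _
  have hexp : ∀ x, h x = 1 - (c * B.indicator 1 x : ℝ) := by
    intro x
    by_cases hx : x ∈ B <;> simp [hh, hx, hc]
  have hint : ∀ k, ∫ x, h x ∂(η k) - 1 = ((-(c * (η k).real B) : ℝ) : ℂ) := by
    intro k
    have := H.isProbabilityMeasure_law k
    have hi : Integrable (fun x => c * B.indicator (1 : E → ℝ) x) (η k) :=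
      ((integrable_const (1 : ℝ)).indicator hB).const_mul _
    simp_rw [hexp]
    rw [integral_sub (integrable_const _) hi.ofReal, integral_complex_ofReal, integral_const_mul,
      integral_indicator_one hB]
    simp
  set S : ℕ → Ω → ℝ := fun K ω => ∑ k ∈ Finset.range K, ∑ i ∈ Finset.range (C k ω),
    B.indicator 1 (e k i ω) with hS
  have hSm : ∀ K, Measurable (S K) := fun K => Finset.measurable_sum _ fun k _ =>
    measurable_nat_dependent (H.measurable_C k)
      (f := fun n ω => ∑ i ∈ Finset.range n, B.indicator (1 : E → ℝ) (e k i ω)) fun n =>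
        Finset.measurable_sum _ fun i _ => hindm.comp (H.measurable_e k i)
  have hS0 : ∀ K ω, 0 ≤ S K ω := fun K ω => Finset.sum_nonneg fun k _ =>
    Finset.sum_nonneg fun i _ => Set.indicator_nonneg (fun _ _ => zero_le_one) _
  have hES : ∀ K, ∫ ω, Real.exp (-S K ω) ∂P
      = Real.exp (-(c * ∑ k ∈ Finset.range K, lam * (η k).real B)) := by
    intro K
    have h1 := H.integral_prod_rounds K hm hb
    have h2 : ∀ ω, ∏ k ∈ Finset.range K, ∏ i ∈ Finset.range (C k ω), h (e k i ω)
        = (Real.exp (-S K ω) : ℂ) := by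
      intro ω
      simp only [hh, hS, ← Complex.exp_sum, ← Complex.ofReal_sum, Complex.ofReal_exp,
        Finset.sum_neg_distrib]
    simp_rw [h2, hint] at h1
    rw [integral_complex_ofReal] at h1
    have h3 : ∑ k ∈ Finset.range K, (lam : ℂ) * ((-(c * (η k).real B) : ℝ) : ℂ)
        = ((-(c * ∑ k ∈ Finset.range K, lam * (η k).real B) : ℝ) : ℂ) := by
      push_cast
      rw [Finset.mul_sum, ← Finset.sum_neg_distrib]
      refine Finset.sum_congr rfl fun k _ => ?_
      ring
    rw [h3, ← Complex.ofReal_exp] at h1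
    exact_mod_cast h1
  have hdiv : Tendsto (fun K => ∑ k ∈ Finset.range K, lam * (η k).real B) atTop atTop := by
    have hnn : ∀ k, 0 ≤ (lam : ℝ) * (η k).real B := fun k => by positivity
    rw [← not_summable_iff_tendsto_nat_atTop_of_nonneg hnn]
    intro hsum
    rw [Measure.sum_apply _ hB] at hinf
    have h3 : ∀ k, ((lam : ℝ≥0∞) • η k) B = ENNReal.ofReal (lam * (η k).real B) := by
      intro k
      have := H.isProbabilityMeasure_law k
      rw [ENNReal.ofReal_mul lam.coe_nonneg, ofReal_measureReal, ENNReal.ofReal_coe_nnreal]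
      rfl
    simp_rw [h3] at hinf
    rw [← ENNReal.ofReal_tsum_of_nonneg hnn hsum] at hinf
    exact ENNReal.ofReal_ne_top hinf
  have hlim : Tendsto (fun K => ∫ ω, Real.exp (-S K ω) ∂P) atTop (𝓝 0) := by
    simp_rw [hES]
    exact Real.tendsto_exp_atBot.comp (tendsto_neg_atTop_atBot.comp (hdiv.const_mul_atTop hc0))
  have hint' : ∀ K, Integrable (fun ω => Real.exp (-S K ω)) P := fun K =>
    Integrable.of_bound (hSm K).neg.exp.aestronglyMeasurable 1 (ae_of_all _ fun ω => by
      rw [Real.norm_eq_abs, abs_of_pos (Real.exp_pos _), Real.exp_le_one_iff]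
      linarith [hS0 K ω])
  -- If all partial counts stay below `M`, then `exp (-S K) ≥ exp (-M)` for every `K`, an event of
  -- vanishing probability.
  have hnull : ∀ M : ℕ, P.real {ω | ∀ K, S K ω ≤ M} = 0 := by
    intro M
    refine le_antisymm ?_ measureReal_nonneg
    refine ge_of_tendsto (f := fun K => Real.exp M * ∫ ω, Real.exp (-S K ω) ∂P) (x := atTop)
      (by simpa using hlim.const_mul (Real.exp M)) (Eventually.of_forall fun K => ?_)
    have h1 := mul_meas_ge_le_integral_of_nonneg (μ := P) (f := fun ω => Real.exp (-S K ω))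
      (ae_of_all _ fun ω => (Real.exp_pos _).le) (hint' K) (Real.exp (-M))
    have h2 : P.real {ω | ∀ K, S K ω ≤ M} ≤ P.real {ω | Real.exp (-M) ≤ Real.exp (-S K ω)} := by
      refine measureReal_mono fun ω hω => ?_
      exact Real.exp_le_exp.2 (neg_le_neg (hω K))
    have h3 : Real.exp M * Real.exp (-M) = 1 := by rw [← Real.exp_add]; simp
    calc P.real {ω | ∀ K, S K ω ≤ M} ≤ P.real {ω | Real.exp (-M) ≤ Real.exp (-S K ω)} := h2
      _ = Real.exp M * (Real.exp (-M) * P.real {ω | Real.exp (-M) ≤ Real.exp (-S K ω)}) := by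
        rw [← mul_assoc, h3, one_mul]
      _ ≤ _ := mul_le_mul_of_nonneg_left h1 (Real.exp_pos _).le
  have hae : ∀ᵐ ω ∂P, ∀ M : ℕ, ¬ ∀ K, S K ω ≤ M := by
    refine ae_all_iff.2 fun M => ?_
    have h1 := (measureReal_eq_zero_iff (measure_ne_top P _)).1 (hnull M)
    rw [ae_iff]
    simpa using h1
  filter_upwards [hae] with ω hω
  by_contra hne
  have hs := hasSum_toReal_pointMeasure hB hne
  obtain ⟨M, hM⟩ := exists_nat_ge (pointMeasure C e ω B).toReal
  refine hω M fun K => le_trans ?_ hM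
  exact sum_le_hasSum _ (fun k _ => Finset.sum_nonneg fun i _ =>
    Set.indicator_nonneg (fun _ _ => zero_le_one) _) hs

/-- The atoms of independent Poisson rounds form a Poisson point process. -/
theorem isPoisson_pointMeasure (H : PoissonRounds P lam η C e) :
    IsPoissonProcess P (pointMeasure C e) (Measure.sum fun k => (lam : ℝ≥0∞) • η k) where
  measurable := measurable_pointMeasure H.measurable_C H.measurable_e
  law_of_finite _ hB hfin := H.pointMeasure_law_of_finite hB hfin
  law_of_infinite _ hB hinf := H.pointMeasure_law_of_infinite hB hinf
  indep m B hB hdis := by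
    classical
    set μ := Measure.sum fun k => (lam : ℝ≥0∞) • η k with hμ
    -- Sets of infinite intensity carry the almost sure constant `∞`. They are replaced by `∅`, the
    -- characteristic function argument is applied, and the constants are put back.
    set B' : Fin m → Set E := fun j => if μ (B j) = ∞ then ∅ else B j with hB'
    have h1 := H.iIndepFun_toReal_pointMeasure (B := B')
      (fun j => by simp only [hB']; split_ifs; exacts [MeasurableSet.empty, hB j])
      (fun i j hij => by
        simp only [hB']
        split_ifs
        exacts [disjoint_bot_left, disjoint_bot_left, disjoint_bot_right, hdis i j hij])
      (fun j => by
        simp only [hB']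
        split_ifs with h
        exacts [by simp, h])
    refine (h1.comp (fun j x => if μ (B j) = ∞ then ∞ else ENNReal.ofReal x) fun j => ?_).congr
      fun j => ?_
    · split_ifs
      exacts [measurable_const, ENNReal.measurable_ofReal]
    · by_cases h : μ (B j) = ∞
      · filter_upwards [H.pointMeasure_law_of_infinite (hB j) h] with ω hω
        simp [h, hω]
      · filter_upwards [H.ae_pointMeasure_ne_top (hB j) h] with ω hω
        simp [h, hω, hB']

end PoissonRounds

end PoissonProcess

/-! ### Rounds of weighted atoms, completely random measures and tail intensities. -/

section AtomRounds

open Filter Topology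

variable {Ω : Type*} [mΩ : MeasurableSpace Ω] {Ψ : Type*} [mΨ : MeasurableSpace Ψ]

/-- Poisson rounds of atoms with independent weights and locations. -/
structure AtomRounds (P : Measure Ω) (lam : ℝ≥0) (η : ℕ → Measure ℝ) (G : Measure Ψ)
    (C : ℕ → Ω → ℕ) (θ : ℕ → ℕ → Ω → ℝ) (ψ : ℕ → ℕ → Ω → Ψ) : Prop where
  measurable_C : ∀ k, Measurable (C k)
  measurable_θ : ∀ k i, Measurable (θ k i)
  measurable_ψ : ∀ k i, Measurable (ψ k i)
  law_C : ∀ k, P.map (C k) = poissonMeasure lam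
  law_θ : ∀ k i, P.map (θ k i) = η k
  law_ψ : ∀ k i, P.map (ψ k i) = G
  indep : iIndep (Sum.elim (fun k : ℕ => MeasurableSpace.comap (C k) inferInstance)
    (Sum.elim (fun q : ℕ × ℕ => MeasurableSpace.comap (θ q.1 q.2) inferInstance)
      (fun q : ℕ × ℕ => MeasurableSpace.comap (ψ q.1 q.2) inferInstance))) P

namespace AtomRounds

variable {P : Measure Ω} {lam : ℝ≥0} {η : ℕ → Measure ℝ} {G : Measure Ψ} {C : ℕ → Ω → ℕ}
  {θ : ℕ → ℕ → Ω → ℝ} {ψ : ℕ → ℕ → Ω → Ψ}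

lemma isProbabilityMeasure (H : AtomRounds P lam η G C θ ψ) : IsProbabilityMeasure P :=
  H.indep.isProbabilityMeasure

lemma isProbabilityMeasure_location (H : AtomRounds P lam η G C θ ψ) :
    IsProbabilityMeasure G := by
  have := H.isProbabilityMeasure
  rw [← H.law_ψ 0 0]
  exact Measure.isProbabilityMeasure_map (H.measurable_ψ 0 0).aemeasurable

lemma isProbabilityMeasure_weight (H : AtomRounds P lam η G C θ ψ) (k : ℕ) :
    IsProbabilityMeasure (η k) := by
  have := H.isProbabilityMeasure
  rw [← H.law_θ k 0]
  exact Measure.isProbabilityMeasure_map (H.measurable_θ k 0).aemeasurable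

lemma comap_le (H : AtomRounds P lam η G C θ ψ) (i : ℕ ⊕ (ℕ × ℕ ⊕ ℕ × ℕ)) :
    Sum.elim (fun k : ℕ => MeasurableSpace.comap (C k) inferInstance)
      (Sum.elim (fun q : ℕ × ℕ => MeasurableSpace.comap (θ q.1 q.2) inferInstance)
        (fun q : ℕ × ℕ => MeasurableSpace.comap (ψ q.1 q.2) inferInstance)) i ≤ mΩ := by
  rcases i with k | q | q
  · exact (H.measurable_C k).comap_le
  · exact (H.measurable_θ q.1 q.2).comap_le
  · exact (H.measurable_ψ q.1 q.2).comap_le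

lemma map_pair (H : AtomRounds P lam η G C θ ψ) (k i : ℕ) :
    P.map (fun ω => (θ k i ω, ψ k i ω)) = (η k).prod G := by
  have := H.isProbabilityMeasure
  have h : IndepFun (θ k i) (ψ k i) P := by
    rw [IndepFun_iff_Indep]
    exact H.indep.indep (i := Sum.inr (Sum.inl (k, i))) (j := Sum.inr (Sum.inr (k, i)))
      (by simp)
  rw [(indepFun_iff_map_prod_eq_prod_map_map (H.measurable_θ k i).aemeasurable
    (H.measurable_ψ k i).aemeasurable).1 h, H.law_θ, H.law_ψ]

/-- The pairs of weights and locations form Poisson rounds. -/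
lemma pair (H : AtomRounds P lam η G C θ ψ) :
    PoissonRounds P lam (fun k => (η k).prod G) C (fun k i ω => (θ k i ω, ψ k i ω)) where
  measurable_C := H.measurable_C
  measurable_e k i := (H.measurable_θ k i).prodMk (H.measurable_ψ k i)
  law_C := H.law_C
  law_e := H.map_pair
  indep := by
    set m := Sum.elim (fun k : ℕ => MeasurableSpace.comap (C k) inferInstance)
      (Sum.elim (fun q : ℕ × ℕ => MeasurableSpace.comap (θ q.1 q.2) inferInstance)
        (fun q : ℕ × ℕ => MeasurableSpace.comap (ψ q.1 q.2) inferInstance)) with hm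
    set f : ℕ ⊕ (ℕ × ℕ ⊕ ℕ × ℕ) → ℕ ⊕ ℕ × ℕ := Sum.map id (Sum.elim id id) with hf
    have hle : ∀ i, m i ≤ ⨆ j ∈ {j | f j = f i}, m j := fun i =>
      le_iSup₂_of_le (f := fun j (_ : j ∈ {j | f j = f i}) => m j) i rfl le_rfl
    refine iIndep_of_iIndep_of_le (iIndep_iSup_fiber H.comap_le H.indep f) fun i => ?_
    rcases i with k | q
    · exact hle (Sum.inl k)
    · refine Measurable.comap_le (Measurable.prodMk ?_ ?_)
      · exact Measurable.mono (comap_measurable (θ q.1 q.2)) (hle (Sum.inr (Sum.inl q))) le_rfl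
      · exact Measurable.mono (comap_measurable (ψ q.1 q.2)) (hle (Sum.inr (Sum.inr q))) le_rfl

/-- The weights alone form Poisson rounds. -/
lemma weights (H : AtomRounds P lam η G C θ ψ) : PoissonRounds P lam η C θ := by
  have := H.isProbabilityMeasure_location
  have h := H.pair.comp measurable_fst
  convert! h using 2 with k
  rw [Measure.map_fst_prod, measure_univ, one_smul]

/-- The superposition of Poisson rounds of atoms is a completely random measure. -/
theorem isCRM (H : AtomRounds P lam η G C θ ψ) {ν : Measure ℝ}
    (hν : Measure.sum (fun k => (lam : ℝ≥0∞) • η k) = ν) :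
    IsCRM P (superposition C θ ψ) ν G := by
  have := H.isProbabilityMeasure_location
  have := H.isProbabilityMeasure_weight
  refine ⟨pointMeasure C fun k i ω => (θ k i ω, ψ k i ω), ?_, ae_of_all _ fun ω => ?_⟩
  · have h := H.pair.isPoisson_pointMeasure
    convert! h using 1
    rw [← hν, Measure.prod_sum_left]
    congr 1
    funext k
    rw [Measure.prod_smul_left]
  · ext s hs
    have hf : Measurable fun p : ℝ × Ψ => ENNReal.ofReal p.1 := by fun_prop
    have hs' : MeasurableSet (Prod.snd ⁻¹' s : Set (ℝ × Ψ)) := measurable_snd hs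
    rw [Measure.map_apply measurable_snd hs, withDensity_apply _ hs', ← lintegral_indicator hs',
      pointMeasure, lintegral_sum_measure, superposition, Measure.sum_apply _ hs]
    refine tsum_congr fun k => ?_
    rw [lintegral_finsetSum_measure, Measure.coe_finsetSum, Finset.sum_apply]
    refine Finset.sum_congr rfl fun i _ => ?_
    rw [lintegral_dirac' _ (hf.indicator hs'), Measure.smul_apply, Measure.dirac_apply' _ hs,
      smul_eq_mul]
    by_cases hψ : ψ k i ω ∈ s <;> simp [hψ]

end AtomRounds

lemma tsum_ite_lt_eq_tsum_add (f : ℕ → ℝ≥0∞) (K : ℕ) :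
    ∑' k, (if k < K then 0 else f k) = ∑' k, f (k + K) := by
  rw [← Summable.sum_add_tsum_nat_add' (f := fun k => if k < K then 0 else f k) (k := K)
    ENNReal.summable, Finset.sum_eq_zero fun k hk => if_pos (Finset.mem_range.1 hk), zero_add]
  exact tsum_congr fun k => if_neg (by omega)

/-- The rounds after the first `K` are again Poisson rounds, so their mean measure is known. -/
lemma tailRate_eq {P : Measure Ω} {lam : ℝ≥0} {η : ℕ → Measure ℝ} {C : ℕ → Ω → ℕ}
    {θ : ℕ → ℕ → Ω → ℝ} (H : PoissonRounds P lam η C θ) (K : ℕ) :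
    tailRate P C θ K = Measure.sum fun k => (lam : ℝ≥0∞) • η (k + K) := by
  rw [← (H.shift K).bind_pointMeasure, tailRate]
  congr 1
  funext ω
  refine Measure.ext fun s hs => ?_
  rw [pointMeasure, Measure.sum_apply _ hs, Measure.sum_apply _ hs, ← tsum_ite_lt_eq_tsum_add
    (fun k => (∑ i ∈ Finset.range (C k ω), Measure.dirac (θ k i ω) : Measure ℝ) s)]
  refine tsum_congr fun k => ?_
  split_ifs
  · rfl
  · rfl

/-- The Laplace functional of a Poisson process, stated as a limit over finitely many rounds to
match the events that no atom among the first rounds is charged. -/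
lemma PoissonRounds.tendsto_integral_prod {E : Type*} [MeasurableSpace E] {P : Measure Ω}
    {lam : ℝ≥0} {η : ℕ → Measure E} {C : ℕ → Ω → ℕ} {e : ℕ → ℕ → Ω → E}
    (H : PoissonRounds P lam η C e) {g : E → ℝ} (hm : Measurable g) (h0 : ∀ x, 0 ≤ g x)
    (h1 : ∀ x, g x ≤ 1) (hg : Integrable g (Measure.sum fun k => (lam : ℝ≥0∞) • η k)) :
    Tendsto (fun K => ∫ ω, ∏ k ∈ Finset.range K, ∏ i ∈ Finset.range (C k ω), (1 - g (e k i ω)) ∂P)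
      atTop (𝓝 (Real.exp (-∫ x, g x ∂(Measure.sum fun k => (lam : ℝ≥0∞) • η k)))) := by
  have key : ∀ K, ∫ ω, ∏ k ∈ Finset.range K, ∏ i ∈ Finset.range (C k ω), (1 - g (e k i ω)) ∂P
      = Real.exp (-∑ k ∈ Finset.range K, ∫ x, g x ∂((lam : ℝ≥0∞) • η k)) := by
    intro K
    have h2 := H.integral_prod_rounds K (h := fun x => ((1 - g x : ℝ) : ℂ))
      (Complex.measurable_ofReal.comp (measurable_const.sub hm)) (fun x => by
        rw [Complex.norm_real, Real.norm_eq_abs, abs_le]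
        constructor <;> linarith [h0 x, h1 x])
    simp_rw [← Complex.ofReal_prod] at h2
    rw [integral_complex_ofReal] at h2
    have h3 : ∀ k, (lam : ℂ) * (∫ x, ((1 - g x : ℝ) : ℂ) ∂(η k) - 1)
        = ((-∫ x, g x ∂((lam : ℝ≥0∞) • η k) : ℝ) : ℂ) := by
      intro k
      have := H.isProbabilityMeasure_law k
      have hgi : Integrable g (η k) := Integrable.of_bound hm.aestronglyMeasurable 1
        (ae_of_all _ fun x => by rw [Real.norm_eq_abs, abs_of_nonneg (h0 x)]; exact h1 x)
      rw [integral_complex_ofReal, integral_sub (integrable_const _) hgi, integral_smul_measure]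
      simp
    simp_rw [h3, ← Complex.ofReal_sum, ← Complex.ofReal_exp] at h2
    rw [Complex.ofReal_inj, Finset.sum_neg_distrib] at h2
    exact h2
  simp_rw [key]
  exact (Real.continuous_exp.tendsto _).comp (hasSum_integral_measure hg).tendsto_sum_nat.neg

end AtomRounds

/-! ### Likelihood draws and the coupling bound on total variation. -/

section Truncation

open Filter Topology

variable {Ω : Type*} [mΩ : MeasurableSpace Ω] {Ψ : Type*} [mΨ : MeasurableSpace Ψ]
  {P : Measure Ω} {C : ℕ → Ω → ℕ} {θ : ℕ → ℕ → Ω → ℝ} {ψ : ℕ → ℕ → Ω → Ψ}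

lemma measurable_atomData (hC : ∀ k, Measurable (C k)) (hθ : ∀ k i, Measurable (θ k i))
    (hψ : ∀ k i, Measurable (ψ k i)) : Measurable (atomData C θ ψ) :=
  (measurable_pi_lambda _ hC).prodMk
    ((measurable_pi_lambda _ fun k => measurable_pi_lambda _ fun i => hθ k i).prodMk
      (measurable_pi_lambda _ fun k => measurable_pi_lambda _ fun i => hψ k i))

lemma measurableSet_truncationGood {N : ℕ} {x : Fin N → ℕ → ℕ → Ω → ℕ}
    (hC : ∀ k, Measurable (C k)) (hx : ∀ n k i, Measurable (x n k i)) (K : ℕ) :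
    MeasurableSet {ω | ∀ n k i, i < C k ω → x n k i ω ≠ 0 → k < K} := by
  have : {ω | ∀ n k i, i < C k ω → x n k i ω ≠ 0 → k < K}
      = ⋂ n, ⋂ k, ⋂ i, ({ω | i < C k ω}ᶜ ∪ ({ω | x n k i ω = 0} ∪ {_ω | k < K})) := by
    ext ω
    simp only [Set.mem_iInter, Set.mem_union, Set.mem_compl_iff, Set.mem_ofPred_eq]
    refine forall_congr' fun n => forall_congr' fun k => forall_congr' fun i => ?_
    tauto
  rw [this]
  refine MeasurableSet.iInter fun n => MeasurableSet.iInter fun k => MeasurableSet.iInter fun i => ?_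
  exact (measurableSet_lt measurable_const (hC k)).compl.union
    ((hx n k i (measurableSet_singleton 0)).union (MeasurableSet.const _))

namespace IsLikelihoodDraw

variable {N : ℕ} {h : ℕ → ℝ → ℝ} {x z : Fin N → ℕ → ℕ → Ω → ℕ}

/-- The conditional probability that all values in a random finite set of atoms vanish. -/
lemma measure_forall_eq_zero (hx : IsLikelihoodDraw P h C θ ψ x) (hC : ∀ k, Measurable (C k))
    (hθ : ∀ k i, Measurable (θ k i)) (hψ : ∀ k i, Measurable (ψ k i)) {V : Type*} [Countable V]
    {D : Ω → V} (hD : ∀ v,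
      MeasurableSet[MeasurableSpace.comap (atomData C θ ψ) inferInstance] (D ⁻¹' {v}))
    (J : V → Finset (Fin N × ℕ × ℕ)) :
    P {ω | ∀ j ∈ J (D ω), x j.1 j.2.1 j.2.2 ω = 0}
      = ∫⁻ ω, ∏ j ∈ J (D ω), ENNReal.ofReal (h 0 (θ j.2.1 j.2.2 ω)) ∂P := by
  have hle : MeasurableSpace.comap (atomData C θ ψ) inferInstance ≤ mΩ :=
    (measurable_atomData hC hθ hψ).comap_le
  have hdis : Pairwise (Function.onFun Disjoint fun v => D ⁻¹' {v}) := fun v w hvw =>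
    Disjoint.preimage _ (by simpa using hvw)
  have hU : ⋃ v, D ⁻¹' {v} = Set.univ :=
    Set.eq_univ_of_forall fun ω => Set.mem_iUnion.2 ⟨D ω, rfl⟩
  -- The conditional law is given for deterministic finite label sets only, so the event is split
  -- along the countably many values of `D`.
  have h1 : {ω | ∀ j ∈ J (D ω), x j.1 j.2.1 j.2.2 ω = 0}
      = ⋃ v, (D ⁻¹' {v} ∩ {ω | ∀ j ∈ J v, x j.1 j.2.1 j.2.2 ω = 0}) := by
    ext ω
    simp
  have hmx : ∀ v, MeasurableSet {ω | ∀ j ∈ J v, x j.1 j.2.1 j.2.2 ω = 0} := by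
    intro v
    have : {ω | ∀ j ∈ J v, x j.1 j.2.1 j.2.2 ω = 0}
        = ⋂ j ∈ J v, x j.1 j.2.1 j.2.2 ⁻¹' {0} := by ext ω; simp
    rw [this]
    exact Finset.measurableSet_biInter _ fun j _ => hx.measurable _ _ _ (measurableSet_singleton 0)
  rw [h1, measure_iUnion (fun v w hvw => (hdis hvw).mono Set.inter_subset_left
    Set.inter_subset_left) fun v => (hle _ (hD v)).inter (hmx v)]
  rw [← setLIntegral_univ, ← hU, lintegral_iUnion (fun v => hle _ (hD v)) hdis]
  refine tsum_congr fun v => ?_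
  rw [hx.cond_law _ (hD v) (J v) fun _ => 0]
  refine setLIntegral_congr_fun (hle _ (hD v)) fun ω hω => ?_
  rw [Set.mem_preimage, Set.mem_singleton_iff] at hω
  simp only [hω]

/-- A draw given all atoms is a draw given the atoms of the first rounds. -/
lemma truncCount (hx : IsLikelihoodDraw P h C θ ψ x) (K : ℕ) :
    IsLikelihoodDraw P h (truncCount K C) θ ψ x where
  measurable := hx.measurable
  cond_law A hA J a := by
    refine hx.cond_law A ?_ J a
    -- The truncated data are a function of the full data, so every event they determine is already
    -- covered by the conditional law given the full data.
    have hm : Measurable fun D : (ℕ → ℕ) × (ℕ → ℕ → ℝ) × (ℕ → ℕ → Ψ) =>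
        ((fun k => if k < K then D.1 k else 0 : ℕ → ℕ), D.2) := by
      refine Measurable.prodMk (measurable_pi_lambda _ fun k => ?_) measurable_snd
      split_ifs
      exacts [(measurable_pi_apply k).comp measurable_fst, measurable_const]
    have hc : Measurable[MeasurableSpace.comap (atomData C θ ψ) inferInstance]
        (atomData (CRM.truncCount K C) θ ψ) := hm.comp (comap_measurable (atomData C θ ψ))
    exact hc.comap_le A hA

/-- The joint law of the atoms and the values of a likelihood draw is unique. -/
lemma map_prodMk_eq [IsProbabilityMeasure P] (hx : IsLikelihoodDraw P h C θ ψ x)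
    (hz : IsLikelihoodDraw P h C θ ψ z) (hC : ∀ k, Measurable (C k))
    (hθ : ∀ k i, Measurable (θ k i)) (hψ : ∀ k i, Measurable (ψ k i)) :
    P.map (fun ω => (atomData C θ ψ ω, fun j : Fin N × ℕ × ℕ => x j.1 j.2.1 j.2.2 ω))
      = P.map (fun ω => (atomData C θ ψ ω, fun j : Fin N × ℕ × ℕ => z j.1 j.2.1 j.2.2 ω)) := by
  have hD := measurable_atomData hC hθ hψ
  have hxm : Measurable fun ω => fun j : Fin N × ℕ × ℕ => x j.1 j.2.1 j.2.2 ω :=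
    measurable_pi_lambda _ fun j => hx.measurable _ _ _
  have hzm : Measurable fun ω => fun j : Fin N × ℕ × ℕ => z j.1 j.2.1 j.2.2 ω :=
    measurable_pi_lambda _ fun j => hz.measurable _ _ _
  have := Measure.isProbabilityMeasure_map (μ := P) (hD.prodMk hxm).aemeasurable
  refine Measure.ext_prod fun {s t} hs ht => ?_
  set A := atomData C θ ψ ⁻¹' s with hA
  have hAm : MeasurableSet A := hD hs
  -- On a fixed event of the atoms, the conditional law prescribes every finite-dimensional marginal
  -- of the values. The default 0 off `I` is never read.
  have hproj : ∀ y : Fin N → ℕ → ℕ → Ω → ℕ, (hy : IsLikelihoodDraw P h C θ ψ y) →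
      ∀ I : Finset (Fin N × ℕ × ℕ), ∀ b : I → ℕ,
      (((P.restrict A).map fun ω => fun j : Fin N × ℕ × ℕ => y j.1 j.2.1 j.2.2 ω).map
        I.restrict) {b} = ∫⁻ ω in A, ∏ j ∈ I,
          ENNReal.ofReal (h (if hj : j ∈ I then b ⟨j, hj⟩ else 0) (θ j.2.1 j.2.2 ω)) ∂P := by
    intro y hy I b
    have hym : Measurable fun ω => fun j : Fin N × ℕ × ℕ => y j.1 j.2.1 j.2.2 ω :=
      measurable_pi_lambda _ fun j => hy.measurable _ _ _
    rw [Measure.map_map (Finset.measurable_restrict I) hym, Measure.map_apply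
      ((Finset.measurable_restrict I).comp hym) (measurableSet_singleton b),
      Measure.restrict_apply (((Finset.measurable_restrict I).comp hym)
        (measurableSet_singleton b)), Set.inter_comm,
      ← hy.cond_law A ⟨s, hs, rfl⟩ I fun j => if hj : j ∈ I then b ⟨j, hj⟩ else 0]
    congr 2
    ext ω
    simp only [Set.mem_preimage, Function.comp_apply, Set.mem_singleton_iff, funext_iff,
      Finset.restrict, Set.mem_ofPred_eq]
    refine ⟨fun H j hj => by rw [dif_pos hj]; exact H ⟨j, hj⟩, fun H j => ?_⟩
    have := H j.1 j.2
    rwa [dif_pos j.2] at this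
  have heq : (P.restrict A).map (fun ω => fun j : Fin N × ℕ × ℕ => x j.1 j.2.1 j.2.2 ω)
      = (P.restrict A).map (fun ω => fun j : Fin N × ℕ × ℕ => z j.1 j.2.1 j.2.2 ω) := by
    -- Finite measures on a product with the same finite-dimensional marginals are equal.
    refine IsProjectiveLimit.unique (P := fun I => ((P.restrict A).map
      fun ω => fun j : Fin N × ℕ × ℕ => z j.1 j.2.1 j.2.2 ω).map I.restrict) (fun I => ?_)
      fun I => rfl
    refine Measure.ext_of_singleton fun b => ?_
    rw [hproj x hx, hproj z hz]
  have hr : ∀ y : Fin N → ℕ → ℕ → Ω → ℕ,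
      (Measurable fun ω => fun j : Fin N × ℕ × ℕ => y j.1 j.2.1 j.2.2 ω) →
      P.map (fun ω => (atomData C θ ψ ω, fun j : Fin N × ℕ × ℕ => y j.1 j.2.1 j.2.2 ω)) (s ×ˢ t)
        = (P.restrict A).map (fun ω => fun j : Fin N × ℕ × ℕ => y j.1 j.2.1 j.2.2 ω) t := by
    intro y hy
    rw [Measure.map_apply (hD.prodMk hy) (hs.prod ht), Measure.map_apply hy ht,
      Measure.restrict_apply (hy ht), Set.inter_comm]
    rfl
  rw [hr x hxm, hr z hzm, heq]

end IsLikelihoodDraw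

lemma measurable_likelihoodProcess {N : ℕ} {x : Fin N → ℕ → ℕ → Ω → ℕ}
    (hC : ∀ k, Measurable (C k)) (hψ : ∀ k i, Measurable (ψ k i))
    (hx : ∀ n k i, Measurable (x n k i)) : Measurable (likelihoodProcess C ψ x) := by
  refine measurable_pi_lambda _ fun n => Measure.measurable_of_measurable_coe _ fun s hs => ?_
  simp only [likelihoodProcess, Measure.sum_apply _ hs, Measure.coe_finsetSum, Finset.sum_apply,
    Measure.smul_apply, smul_eq_mul]
  refine Measurable.tsum fun k => ?_
  refine measurable_nat_dependent (hC k) (f := fun m ω => ∑ i ∈ Finset.range m,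
    (x n k i ω : ℝ≥0∞) * Measure.dirac (ψ k i ω) s) fun m => ?_
  exact Finset.measurable_sum _ fun i _ => ((measurable_of_countable _).comp (hx n k i)).mul
    ((Measure.measurable_coe hs).comp (Measure.measurable_dirac.comp (hψ k i)))

lemma map_likelihoodProcess_eq [IsProbabilityMeasure P] {N : ℕ} {h : ℕ → ℝ → ℝ}
    {x z : Fin N → ℕ → ℕ → Ω → ℕ} (hx : IsLikelihoodDraw P h C θ ψ x)
    (hz : IsLikelihoodDraw P h C θ ψ z) (hC : ∀ k, Measurable (C k))
    (hθ : ∀ k i, Measurable (θ k i)) (hψ : ∀ k i, Measurable (ψ k i)) :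
    P.map (likelihoodProcess C ψ x) = P.map (likelihoodProcess C ψ z) := by
  -- The draws are one fixed measurable function of the atoms and values, whose joint law is unique.
  set Λ : ((ℕ → ℕ) × (ℕ → ℕ → ℝ) × (ℕ → ℕ → Ψ)) × (Fin N × ℕ × ℕ → ℕ) → Fin N → Measure Ψ :=
    likelihoodProcess (fun k p => p.1.1 k) (fun k i p => p.1.2.2 k i)
      (fun n k i p => p.2 (n, k, i)) with hΛ
  have hΛm : Measurable Λ := by
    refine measurable_likelihoodProcess (fun k => ?_) (fun k i => ?_) (fun n k i => ?_)
    · exact (measurable_pi_apply k).comp (measurable_fst.comp measurable_fst)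
    · exact (measurable_pi_apply i).comp ((measurable_pi_apply k).comp
        (measurable_snd.comp (measurable_snd.comp measurable_fst)))
    · exact (measurable_pi_apply _).comp measurable_snd
  have hD := measurable_atomData hC hθ hψ
  have key : ∀ y : Fin N → ℕ → ℕ → Ω → ℕ, (∀ n k i, Measurable (y n k i)) →
      P.map (likelihoodProcess C ψ y) = (P.map (fun ω => (atomData C θ ψ ω,
        fun j : Fin N × ℕ × ℕ => y j.1 j.2.1 j.2.2 ω))).map Λ := by
    intro y hy
    rw [Measure.map_map hΛm (hD.prodMk (measurable_pi_lambda _ fun j => hy _ _ _))]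
    rfl
  rw [key x hx.measurable, key z hz.measurable, hx.map_prodMk_eq hz hC hθ hψ]

/-- Measurability needs checking only on rectangles, where the product measure is a finite product
of measurable functions. -/
lemma measurable_pi_kernel {N : ℕ} {S : Type*} [MeasurableSpace S] (f : Kernel (Measure Ψ) S)
    [IsMarkovKernel f] :
    Measurable fun m : Fin N → Measure Ψ => Measure.pi fun n => f (m n) := by
  refine Measurable.measure_of_isPiSystem_of_isProbabilityMeasure generateFrom_pi.symm
    isPiSystem_pi ?_
  rintro _ ⟨s, hs, rfl⟩
  simp only [Measure.pi_pi]
  exact Finset.measurable_prod _ fun n _ =>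
    (f.measurable_coe (hs n (Set.mem_univ n))).comp (measurable_pi_apply n)

/-- The truncation error bounds the total variation distance of the laws of the observations. -/
theorem tvDist_obsLaw_le [IsProbabilityMeasure P] {N : ℕ} {h : ℕ → ℝ → ℝ}
    {x z : Fin N → ℕ → ℕ → Ω → ℕ} {K : ℕ} (hx : IsLikelihoodDraw P h C θ ψ x)
    (hz : IsLikelihoodDraw P h (truncCount K C) θ ψ z) (hC : ∀ k, Measurable (C k))
    (hθ : ∀ k i, Measurable (θ k i)) (hψ : ∀ k i, Measurable (ψ k i)) {S : Type*}
    [MeasurableSpace S] (f : Kernel (Measure Ψ) S) [IsMarkovKernel f] :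
    tvDist (obsLaw P (likelihoodProcess C ψ x) f)
      (obsLaw P (likelihoodProcess (truncCount K C) ψ z) f) ≤ truncationError P C x K := by
  have hCt : ∀ k, Measurable (truncCount K C k) := by
    intro k
    unfold truncCount
    split_ifs
    exacts [hC k, measurable_const]
  set good : Set Ω := {ω | ∀ n k i, i < C k ω → x n k i ω ≠ 0 → k < K} with hgood
  have hgm : MeasurableSet good := measurableSet_truncationGood hC hx.measurable K
  have herr : truncationError P C x K = P.real goodᶜ := by
    rw [truncationError, probReal_compl_eq_one_sub hgm]
  -- The coupling: `x` is also a draw given the truncated atoms, so it may replace `z` without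
  -- changing the law of the observations.
  have hlaw : obsLaw P (likelihoodProcess (truncCount K C) ψ z) f
      = obsLaw P (likelihoodProcess (truncCount K C) ψ x) f := by
    rw [obsLaw, obsLaw, map_likelihoodProcess_eq hz (hx.truncCount K) hCt hθ hψ]
  have hagree : ∀ ω ∈ good,
      likelihoodProcess C ψ x ω = likelihoodProcess (truncCount K C) ψ x ω := by
    intro ω hω
    funext n
    simp only [likelihoodProcess, truncCount]
    congr 1
    funext k
    by_cases hk : k < K
    · simp [hk]
    · rw [if_neg hk, Finset.range_zero, Finset.sum_empty]
      refine Finset.sum_eq_zero fun i hi => ?_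
      have h0 : x n k i ω = 0 := by
        by_contra hne
        exact hk (hω n k i (Finset.mem_range.1 hi) hne)
      simp [h0]
  have hκ := measurable_pi_kernel (N := N) f
  have hX := measurable_likelihoodProcess hC hψ hx.measurable
  have hX' := measurable_likelihoodProcess hCt hψ hx.measurable
  have hobs : ∀ X : Ω → Fin N → Measure Ψ, Measurable X → ∀ A, MeasurableSet A →
      obsLaw P X f A = ∫⁻ ω, (Measure.pi fun n => f (X ω n)) A ∂P := by
    intro X hXm A hA
    have hκA : Measurable fun m : Fin N → Measure Ψ => (Measure.pi fun n => f (m n)) A :=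
      (Measure.measurable_coe hA).comp hκ
    rw [obsLaw, Measure.bind_apply hA hκ.aemeasurable, lintegral_map hκA hXm]
  -- On `good` the conditional laws of the observations agree; off it they differ by at most 1.
  have hle : ∀ X Y : Ω → Fin N → Measure Ψ, Measurable X → Measurable Y →
      (∀ ω ∈ good, X ω = Y ω) → ∀ A, MeasurableSet A →
      obsLaw P X f A ≤ obsLaw P Y f A + P goodᶜ := by
    intro X Y hXm hYm hXY A hA
    rw [hobs X hXm A hA, hobs Y hYm A hA, ← lintegral_add_compl _ hgm]
    refine add_le_add ?_ ?_
    · rw [setLIntegral_congr_fun hgm fun ω hω => by rw [hXY ω hω]]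
      exact setLIntegral_le_lintegral _ _
    · calc ∫⁻ ω in goodᶜ, (Measure.pi fun n => f (X ω n)) A ∂P
          ≤ ∫⁻ _ω in goodᶜ, 1 ∂P := lintegral_mono fun ω => prob_le_one
        _ = P goodᶜ := by simp
  have hprob : ∀ X : Ω → Fin N → Measure Ψ, Measurable X → ∀ A, MeasurableSet A →
      obsLaw P X f A ≤ 1 := by
    intro X hXm A hA
    rw [hobs X hXm A hA]
    calc ∫⁻ ω, (Measure.pi fun n => f (X ω n)) A ∂P ≤ ∫⁻ _ω, 1 ∂P :=
          lintegral_mono fun ω => prob_le_one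
      _ = 1 := by simp
  rw [hlaw, herr, tvDist]
  have : Nonempty {A : Set (Fin N → S) // MeasurableSet A} := ⟨⟨∅, MeasurableSet.empty⟩⟩
  refine ciSup_le fun ⟨A, hA⟩ => ?_
  have hreal : ∀ X Y : Ω → Fin N → Measure Ψ, Measurable X → Measurable Y →
      (∀ ω ∈ good, X ω = Y ω) →
      (obsLaw P X f).real A ≤ (obsLaw P Y f).real A + P.real goodᶜ := by
    intro X Y hXm hYm hXY
    have h1 := ENNReal.toReal_mono (ENNReal.add_ne_top.2
      ⟨((hprob Y hYm A hA).trans_lt ENNReal.one_lt_top).ne, measure_ne_top P _⟩)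
      (hle X Y hXm hYm hXY A hA)
    rwa [ENNReal.toReal_add ((hprob Y hYm A hA).trans_lt ENNReal.one_lt_top).ne
      (measure_ne_top P _)] at h1
  have h1 := hreal _ _ hX hX' hagree
  have h2 := hreal _ _ hX' hX fun ω hω => (hagree ω hω).symm
  rw [abs_le]
  constructor <;> linarith

end Truncation

/-! ### The truncation error under the Bernoulli likelihood. -/

section TruncationFormula

open Filter Topology

variable {Ω : Type*} [mΩ : MeasurableSpace Ω] {Ψ : Type*} [mΨ : MeasurableSpace Ψ]
  {P : Measure Ω} {C : ℕ → Ω → ℕ} {θ : ℕ → ℕ → Ω → ℝ} {ψ : ℕ → ℕ → Ω → Ψ}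

lemma bernoulliLik_zero (θ : ℝ) : bernoulliLik 0 θ = 1 - θ := by simp [bernoulliLik]

/-- The labels of the draws and atoms in the rounds `K, …, K + L - 1`, given the numbers of
atoms. -/
def tailLabels (N K L : ℕ) (v : Fin L → ℕ) : Finset (Fin N × ℕ × ℕ) :=
  Finset.univ ×ˢ ((Finset.univ : Finset (Fin L)).sigma fun k => Finset.range (v k)).map
    ⟨fun s => ((s.1 : ℕ) + K, s.2), by
      rintro ⟨a, i⟩ ⟨b, j⟩ hab
      simp only [Prod.mk.injEq, add_left_inj] at hab
      obtain ⟨h1, h2⟩ := hab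
      obtain rfl := Fin.ext h1
      rw [h2]⟩

lemma mem_tailLabels {N K L : ℕ} {v : Fin L → ℕ} {n : Fin N} {k i : ℕ} :
    (n, k, i) ∈ tailLabels N K L v ↔ ∃ l : Fin L, i < v l ∧ (l : ℕ) + K = k := by
  simp only [tailLabels, Finset.mem_product, Finset.mem_univ, true_and, Finset.mem_map,
    Finset.mem_sigma, Finset.mem_range]
  constructor
  · rintro ⟨⟨l, j⟩, hj, he⟩
    obtain ⟨rfl, rfl⟩ : (l : ℕ) + K = k ∧ j = i := Prod.mk.inj he
    exact ⟨l, hj, rfl⟩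
  · rintro ⟨l, hi, rfl⟩
    exact ⟨⟨l, i⟩, hi, rfl⟩

/-- The factor does not depend on the draw, so the `N` draws contribute an `N`-th power. -/
lemma prod_tailLabels {M : Type*} [CommMonoid M] {N K L : ℕ} (v : Fin L → ℕ)
    (f : ℕ → ℕ → M) : ∏ j ∈ tailLabels N K L v, f j.2.1 j.2.2
      = ∏ k : Fin L, ∏ i ∈ Finset.range (v k), f (k + K) i ^ N := by
  rw [tailLabels, Finset.prod_product]
  simp only [Finset.prod_const, Finset.card_univ, Fintype.card_fin]
  rw [Finset.prod_map, Finset.prod_sigma, ← Finset.prod_pow]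
  refine Finset.prod_congr rfl fun k _ => ?_
  rw [← Finset.prod_pow]
  rfl

/-- The conditional probability given the weight `θ` that an atom is charged by some of `N`
Bernoulli draws, with `θ` clipped to the unit interval. -/
def hitProb (N : ℕ) (θ : ℝ) : ℝ := 1 - (1 - max 0 (min θ 1)) ^ N

lemma measurable_hitProb (N : ℕ) : Measurable (hitProb N) := by
  unfold hitProb
  fun_prop

/-- Clipping makes this bound and the next hold at every real `θ`, as
`PoissonRounds.tendsto_integral_prod` requires. -/
lemma hitProb_nonneg (N : ℕ) (θ : ℝ) : 0 ≤ hitProb N θ := by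
  have h1 : max 0 (min θ 1) ≤ 1 := max_le zero_le_one (min_le_right _ _)
  have h0 : 0 ≤ max 0 (min θ 1) := le_max_left _ _
  exact sub_nonneg.2 (pow_le_one₀ (by linarith) (by linarith))

lemma hitProb_le_one (N : ℕ) (θ : ℝ) : hitProb N θ ≤ 1 := by
  have h1 : max 0 (min θ 1) ≤ 1 := max_le zero_le_one (min_le_right _ _)
  exact sub_le_self _ (pow_nonneg (by linarith) _)

lemma hitProb_of_mem {N : ℕ} {θ : ℝ} (h : θ ∈ Set.Icc (0 : ℝ) 1) :
    hitProb N θ = 1 - (1 - θ) ^ N := by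
  rw [hitProb, min_eq_left h.2, max_eq_right h.1]

/-- Bernoulli's inequality. -/
lemma hitProb_le_mul {N : ℕ} {θ : ℝ} (h : θ ∈ Set.Icc (0 : ℝ) 1) : hitProb N θ ≤ N * θ := by
  rw [hitProb_of_mem h]
  have := one_add_mul_le_pow (a := -θ) (by linarith [h.2]) N
  rw [← sub_eq_add_neg] at this
  linarith

variable {lam : ℝ≥0} {η : ℕ → Measure ℝ} {G : Measure Ψ}

/-- The probability that no atom in the rounds `K, …, K + L - 1` is charged. -/
lemma measureReal_tailLabels_eq {N K L : ℕ} {x : Fin N → ℕ → ℕ → Ω → ℕ}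
    (H : AtomRounds P lam η G C θ ψ) (hη : ∀ k, ∀ᵐ x ∂(η k), x ∈ Set.Icc (0 : ℝ) 1)
    (hx : IsLikelihoodDraw P bernoulliLik C θ ψ x) :
    P.real {ω | ∀ j ∈ tailLabels N K L (fun k => C (k + K) ω), x j.1 j.2.1 j.2.2 ω = 0}
      = ∫ ω, ∏ k ∈ Finset.range L, ∏ i ∈ Finset.range (C (k + K) ω),
          (1 - hitProb N (θ (k + K) i ω)) ∂P := by
  have hθ01 : ∀ᵐ ω ∂P, ∀ k i, θ k i ω ∈ Set.Icc (0 : ℝ) 1 := by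
    refine ae_all_iff.2 fun k => ae_all_iff.2 fun i => ?_
    have := hη k
    rw [← H.law_θ k i] at this
    exact ae_of_ae_map (H.measurable_θ k i).aemeasurable this
  have hD : ∀ v : Fin L → ℕ, MeasurableSet[MeasurableSpace.comap (atomData C θ ψ) inferInstance]
      ((fun ω => fun k : Fin L => C (k + K) ω) ⁻¹' {v}) := by
    intro v
    have hm : Measurable fun D : (ℕ → ℕ) × (ℕ → ℕ → ℝ) × (ℕ → ℕ → Ψ) =>
        fun k : Fin L => D.1 (k + K) :=
      measurable_pi_lambda _ fun k => (measurable_pi_apply _).comp measurable_fst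
    exact ⟨_, hm (measurableSet_singleton v), rfl⟩
  have hmeas : Measurable fun ω => ∏ k ∈ Finset.range L, ∏ i ∈ Finset.range (C (k + K) ω),
      (1 - hitProb N (θ (k + K) i ω)) := by
    refine Finset.measurable_prod _ fun k _ => measurable_nat_dependent (H.measurable_C (k + K))
      (f := fun n ω => ∏ i ∈ Finset.range n, (1 - hitProb N (θ (k + K) i ω))) fun n => ?_
    exact Finset.measurable_prod _ fun i _ =>
      measurable_const.sub ((measurable_hitProb N).comp (H.measurable_θ _ _))
  rw [integral_eq_lintegral_of_nonneg_ae (ae_of_all _ fun ω => Finset.prod_nonneg fun k _ =>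
    Finset.prod_nonneg fun i _ => sub_nonneg.2 (hitProb_le_one _ _)) hmeas.aestronglyMeasurable,
    Measure.real, hx.measure_forall_eq_zero H.measurable_C H.measurable_θ H.measurable_ψ hD
      (tailLabels N K L)]
  congr 1
  refine lintegral_congr_ae ?_
  filter_upwards [hθ01] with ω hω
  rw [prod_tailLabels _ fun k i => ENNReal.ofReal (bernoulliLik 0 (θ k i ω)),
    ENNReal.ofReal_prod_of_nonneg fun k _ => Finset.prod_nonneg fun i _ =>
      sub_nonneg.2 (hitProb_le_one _ _), Finset.prod_range]
  refine Finset.prod_congr rfl fun k _ => ?_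
  rw [ENNReal.ofReal_prod_of_nonneg fun i _ => sub_nonneg.2 (hitProb_le_one _ _)]
  refine Finset.prod_congr rfl fun i _ => ?_
  rw [hitProb_of_mem (hω _ _), sub_sub_cancel, bernoulliLik_zero,
    ENNReal.ofReal_pow (sub_nonneg.2 (hω _ _).2)]

/-- The truncation error under the Bernoulli likelihood and its bound by the mean total weight of
the later rounds. -/
theorem truncationError_eq_and_le {N K : ℕ} {x : Fin N → ℕ → ℕ → Ω → ℕ}
    (H : AtomRounds P lam η G C θ ψ) (hη : ∀ k, ∀ᵐ x ∂(η k), x ∈ Set.Icc (0 : ℝ) 1)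
    (hx : IsLikelihoodDraw P bernoulliLik C θ ψ x) {b : ℝ} (hb : 0 ≤ b)
    (hmean : ∑' k, (lam : ℝ≥0∞) * ∫⁻ x, ENNReal.ofReal x ∂(η (k + K)) ≤ ENNReal.ofReal b) :
    truncationError P C x K
        = 1 - Real.exp (-∫ θ, (1 - bernoulliLik 0 θ ^ N) ∂(tailRate P C θ K)) ∧
      truncationError P C x K ≤ N * b := by
  have := H.isProbabilityMeasure
  rw [tailRate_eq H.weights]
  set μ := Measure.sum fun k => (lam : ℝ≥0∞) • η (k + K) with hμ
  have hμ01 : ∀ᵐ x ∂μ, x ∈ Set.Icc (0 : ℝ) 1 :=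
    (Measure.ae_sum_iff (μ := fun k => (lam : ℝ≥0∞) • η (k + K))).2 fun k =>
      Measure.ae_smul_measure (hη _) _
  have hmeanμ : ∫⁻ x, ENNReal.ofReal x ∂μ ≤ ENNReal.ofReal b := by
    rw [hμ, lintegral_sum_measure]
    simpa only [lintegral_smul_measure, smul_eq_mul] using hmean
  have hid : Integrable (fun x : ℝ => x) μ := by
    refine ⟨measurable_id.aestronglyMeasurable, ?_⟩
    rw [hasFiniteIntegral_iff_ofReal (hμ01.mono fun x hx => hx.1)]
    exact hmeanμ.trans_lt ENNReal.ofReal_lt_top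
  have hidle : ∫ x, x ∂μ ≤ b := by
    rw [integral_eq_lintegral_of_nonneg_ae (hμ01.mono fun x hx => hx.1)
      measurable_id.aestronglyMeasurable]
    exact ENNReal.toReal_le_of_le_ofReal hb hmeanμ
  have hgi : Integrable (hitProb N) μ := by
    refine (hid.const_mul (N : ℝ)).mono' (measurable_hitProb N).aestronglyMeasurable ?_
    filter_upwards [hμ01] with x hx
    rw [Real.norm_eq_abs, abs_of_nonneg (hitProb_nonneg N x)]
    exact hitProb_le_mul hx
  have hgle : ∫ x, hitProb N x ∂μ ≤ N * b := by
    calc ∫ x, hitProb N x ∂μ ≤ ∫ x, N * x ∂μ :=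
          integral_mono_ae hgi (hid.const_mul _) (hμ01.mono fun x hx => hitProb_le_mul hx)
      _ = N * ∫ x, x ∂μ := integral_const_mul _ _
      _ ≤ N * b := mul_le_mul_of_nonneg_left hidle (Nat.cast_nonneg _)
  have hgeq : ∫ θ, (1 - bernoulliLik 0 θ ^ N) ∂μ = ∫ x, hitProb N x ∂μ := by
    refine integral_congr_ae (hμ01.mono fun x hx => ?_)
    simp only
    rw [bernoulliLik_zero, hitProb_of_mem hx]
  -- Only finitely many labels can be treated at once, so the event that no later atom is charged is
  -- written as a decreasing intersection over blocks of `L` rounds.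
  set A : ℕ → Set Ω := fun L =>
    {ω | ∀ j ∈ tailLabels N K L (fun k => C (k + K) ω), x j.1 j.2.1 j.2.2 ω = 0} with hA
  have hAm : ∀ L, MeasurableSet (A L) := by
    intro L
    have : A L = ⋂ n, ⋂ l : Fin L, ⋂ i, ({ω | i < C (l + K) ω}ᶜ ∪ {ω | x n (l + K) i ω = 0}) := by
      ext ω
      simp only [hA, Set.mem_iInter, Set.mem_union, Set.mem_compl_iff, Set.mem_ofPred_eq]
      constructor
      · intro h n l i
        by_cases hi : i < C (l + K) ω
        · exact Or.inr (h (n, l + K, i) (mem_tailLabels.2 ⟨l, hi, rfl⟩))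
        · exact Or.inl hi
      · rintro h ⟨n, k, i⟩ hj
        obtain ⟨l, hi, rfl⟩ := mem_tailLabels.1 hj
        exact (h n l i).resolve_left (not_not.2 hi)
    rw [this]
    exact MeasurableSet.iInter fun n => MeasurableSet.iInter fun l => MeasurableSet.iInter fun i =>
      (measurableSet_lt measurable_const (H.measurable_C _)).compl.union
        (hx.measurable n _ i (measurableSet_singleton 0))
  have hanti : Antitone A := by
    rintro L L' hL ω hω ⟨n, k, i⟩ hj
    obtain ⟨l, hi, rfl⟩ := mem_tailLabels.1 hj
    exact hω (n, l + K, i) (mem_tailLabels.2 ⟨Fin.castLE hL l, hi, rfl⟩)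
  have hinter : {ω | ∀ n k i, i < C k ω → x n k i ω ≠ 0 → k < K} = ⋂ L, A L := by
    ext ω
    simp only [hA, Set.mem_iInter, Set.mem_ofPred_eq]
    constructor
    · rintro h L ⟨n, k, i⟩ hj
      obtain ⟨l, hi, rfl⟩ := mem_tailLabels.1 hj
      by_contra hne
      have := h n (l + K) i hi hne
      omega
    · intro h n k i hi hne
      by_contra hk
      refine hne (h (k - K + 1) (n, k, i) (mem_tailLabels.2 ⟨⟨k - K, by omega⟩, ?_, ?_⟩))
      · have : k - K + K = k := by omega
        simpa [this] using hi
      · simp only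
        omega
  have hlim1 : Tendsto (fun L => P.real (A L)) atTop (𝓝 (P.real (⋂ L, A L))) :=
    (ENNReal.tendsto_toReal (measure_ne_top P _)).comp
      (tendsto_measure_iInter_atTop (fun L => (hAm L).nullMeasurableSet) hanti
        ⟨0, measure_ne_top P _⟩)
  have hlim2 := (H.weights.shift K).tendsto_integral_prod (measurable_hitProb N)
    (hitProb_nonneg N) (hitProb_le_one N) hgi
  have heq : P.real (⋂ L, A L) = Real.exp (-∫ x, hitProb N x ∂μ) := by
    refine tendsto_nhds_unique hlim1 ?_
    refine hlim2.congr fun L => ?_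
    rw [hA, measureReal_tailLabels_eq H hη hx]
  have herr : truncationError P C x K = 1 - Real.exp (-∫ x, hitProb N x ∂μ) := by
    rw [truncationError, hinter, heq]
  refine ⟨by rw [herr, hgeq], ?_⟩
  -- This gives `1 - exp (-a) ≤ a`, and `a ≤ N * b` is `hgle`.
  have := Real.add_one_le_exp (-∫ x, hitProb N x ∂μ)
  rw [herr]
  linarith

end TruncationFormula

/-! ### Uniqueness of the joint law of counts, weights and locations. -/

section JointLaw

variable {Ω : Type*} [mΩ : MeasurableSpace Ω] {Ω' : Type*} [mΩ' : MeasurableSpace Ω']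
  {Ψ : Type*} [mΨ : MeasurableSpace Ψ]
  {P : Measure Ω} {P' : Measure Ω'} {C : ℕ → Ω → ℕ} {θ : ℕ → ℕ → Ω → ℝ} {ψ : ℕ → ℕ → Ω → Ψ}
  {lam : ℝ≥0} {η : ℕ → Measure ℝ} {G : Measure Ψ}

/-- Full independence makes the joint law the product of its one-dimensional marginals, so it
depends on `lam`, `η` and `G` only. -/
lemma AtomRounds.map_triple (H : AtomRounds P lam η G C θ ψ) :
    P.map (fun ω => (fun k => C k ω, fun q : ℕ × ℕ => θ q.1 q.2 ω, fun q : ℕ × ℕ => ψ q.1 q.2 ω))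
      = (Measure.infinitePi fun _ : ℕ => poissonMeasure lam).prod
        ((Measure.infinitePi fun q : ℕ × ℕ => η q.1).prod
          (Measure.infinitePi fun _ : ℕ × ℕ => G)) := by
  have := H.isProbabilityMeasure
  have hC : Measurable fun ω => fun k => C k ω := measurable_pi_lambda _ H.measurable_C
  have hθ : Measurable fun ω => fun q : ℕ × ℕ => θ q.1 q.2 ω :=
    measurable_pi_lambda _ fun q => H.measurable_θ _ _
  have hψ : Measurable fun ω => fun q : ℕ × ℕ => ψ q.1 q.2 ω :=
    measurable_pi_lambda _ fun q => H.measurable_ψ _ _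
  set m := Sum.elim (fun k : ℕ => MeasurableSpace.comap (C k) inferInstance)
    (Sum.elim (fun q : ℕ × ℕ => MeasurableSpace.comap (θ q.1 q.2) inferInstance)
      (fun q : ℕ × ℕ => MeasurableSpace.comap (ψ q.1 q.2) inferInstance)) with hm
  have hle : ∀ (S : Set (ℕ ⊕ (ℕ × ℕ ⊕ ℕ × ℕ))) (i), i ∈ S → m i ≤ ⨆ j ∈ S, m j := fun S i hi =>
    le_iSup₂_of_le (f := fun j (_ : j ∈ S) => m j) i hi le_rfl
  have hCS : MeasurableSpace.comap (fun ω => fun k => C k ω) inferInstance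
      ≤ ⨆ j ∈ Set.range Sum.inl, m j := by
    refine Measurable.comap_le (@measurable_pi_lambda _ _ _ (_) _ _ fun k => ?_)
    exact Measurable.mono (comap_measurable (C k)) (hle _ (Sum.inl k) ⟨k, rfl⟩) le_rfl
  have hθS : ∀ S : Set (ℕ ⊕ (ℕ × ℕ ⊕ ℕ × ℕ)), (∀ q, Sum.inr (Sum.inl q) ∈ S) →
      Measurable[⨆ j ∈ S, m j] (fun ω => fun q : ℕ × ℕ => θ q.1 q.2 ω) := by
    intro S hS
    refine @measurable_pi_lambda _ _ _ (_) _ _ fun q => ?_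
    exact Measurable.mono (comap_measurable (θ q.1 q.2)) (hle _ _ (hS q)) le_rfl
  have hψS : ∀ S : Set (ℕ ⊕ (ℕ × ℕ ⊕ ℕ × ℕ)), (∀ q, Sum.inr (Sum.inr q) ∈ S) →
      Measurable[⨆ j ∈ S, m j] (fun ω => fun q : ℕ × ℕ => ψ q.1 q.2 ω) := by
    intro S hS
    refine @measurable_pi_lambda _ _ _ (_) _ _ fun q => ?_
    exact Measurable.mono (comap_measurable (ψ q.1 q.2)) (hle _ _ (hS q)) le_rfl
  have hi1 : IndepFun (fun ω => fun k => C k ω)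
      (fun ω => (fun q : ℕ × ℕ => θ q.1 q.2 ω, fun q : ℕ × ℕ => ψ q.1 q.2 ω)) P := by
    rw [IndepFun_iff_Indep]
    refine indep_of_indep_of_le (indep_iSup_of_disjoint H.comap_le H.indep
      (S := Set.range Sum.inl) (T := Set.range Sum.inr) ?_) hCS ?_
    · rw [Set.disjoint_left]
      rintro _ ⟨a, rfl⟩ ⟨b, hb⟩
      simp at hb
    · exact Measurable.comap_le (Measurable.prodMk (hθS _ fun q => ⟨_, rfl⟩)
        (hψS _ fun q => ⟨_, rfl⟩))
  have hi2 : IndepFun (fun ω => fun q : ℕ × ℕ => θ q.1 q.2 ω)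
      (fun ω => fun q : ℕ × ℕ => ψ q.1 q.2 ω) P := by
    rw [IndepFun_iff_Indep]
    refine indep_of_indep_of_le (indep_iSup_of_disjoint H.comap_le H.indep
      (S := Set.range (Sum.inr ∘ Sum.inl)) (T := Set.range (Sum.inr ∘ Sum.inr)) ?_)
      (hθS (Set.range (Sum.inr ∘ Sum.inl)) fun q => ⟨q, rfl⟩).comap_le
      (hψS (Set.range (Sum.inr ∘ Sum.inr)) fun q => ⟨q, rfl⟩).comap_le
    rw [Set.disjoint_left]
    rintro _ ⟨a, rfl⟩ ⟨b, hb⟩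
    simp at hb
  have lC : P.map (fun ω => fun k => C k ω)
      = Measure.infinitePi fun _ : ℕ => poissonMeasure lam := by
    have h : iIndepFun C P := by
      rw [iIndepFun_iff_iIndep]
      exact H.indep.precomp (g := Sum.inl) Sum.inl_injective
    rw [h.map_fun_eq_infinitePi_map H.measurable_C]
    simp_rw [H.law_C]
  have lθ : P.map (fun ω => fun q : ℕ × ℕ => θ q.1 q.2 ω)
      = Measure.infinitePi fun q : ℕ × ℕ => η q.1 := by
    have h : iIndepFun (fun q : ℕ × ℕ => θ q.1 q.2) P := by
      rw [iIndepFun_iff_iIndep]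
      exact H.indep.precomp (g := Sum.inr ∘ Sum.inl)
        (Sum.inr_injective.comp Sum.inl_injective)
    rw [h.map_fun_eq_infinitePi_map fun q => H.measurable_θ _ _]
    simp_rw [H.law_θ]
  have lψ : P.map (fun ω => fun q : ℕ × ℕ => ψ q.1 q.2 ω)
      = Measure.infinitePi fun _ : ℕ × ℕ => G := by
    have h : iIndepFun (fun q : ℕ × ℕ => ψ q.1 q.2) P := by
      rw [iIndepFun_iff_iIndep]
      exact H.indep.precomp (g := Sum.inr ∘ Sum.inr)
        (Sum.inr_injective.comp Sum.inr_injective)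
    rw [h.map_fun_eq_infinitePi_map fun q => H.measurable_ψ _ _]
    simp_rw [H.law_ψ]
  rw [(indepFun_iff_map_prod_eq_prod_map_map hC.aemeasurable
    (hθ.prodMk hψ).aemeasurable).1 hi1, (indepFun_iff_map_prod_eq_prod_map_map hθ.aemeasurable
    hψ.aemeasurable).1 hi2, lC, lθ, lψ]

lemma AtomRounds.map_atomData (H : AtomRounds P lam η G C θ ψ) :
    P.map (atomData C θ ψ) = ((Measure.infinitePi fun _ : ℕ => poissonMeasure lam).prod
      ((Measure.infinitePi fun q : ℕ × ℕ => η q.1).prod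
        (Measure.infinitePi fun _ : ℕ × ℕ => G))).map
      (fun D => (D.1, fun k i => D.2.1 (k, i), fun k i => D.2.2 (k, i))) := by
  have hm : Measurable fun D : (ℕ → ℕ) × (ℕ × ℕ → ℝ) × (ℕ × ℕ → Ψ) =>
      (D.1, (fun k i => D.2.1 (k, i) : ℕ → ℕ → ℝ), (fun k i => D.2.2 (k, i) : ℕ → ℕ → Ψ)) := by
    refine measurable_fst.prodMk (Measurable.prodMk ?_ ?_)
    · exact measurable_pi_lambda _ fun k => measurable_pi_lambda _ fun i =>
        (measurable_pi_apply _).comp (measurable_fst.comp measurable_snd)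
    · exact measurable_pi_lambda _ fun k => measurable_pi_lambda _ fun i =>
        (measurable_pi_apply _).comp (measurable_snd.comp measurable_snd)
  rw [← H.map_triple, Measure.map_map hm]
  · rfl
  · exact (measurable_pi_lambda _ H.measurable_C).prodMk
      ((measurable_pi_lambda _ fun q => H.measurable_θ _ _).prodMk
        (measurable_pi_lambda _ fun q => H.measurable_ψ _ _))

/-- The joint law of the counts, weights and locations is determined by the parameters. -/
theorem AtomRounds.identDistrib {C' : ℕ → Ω' → ℕ} {θ' : ℕ → ℕ → Ω' → ℝ} {ψ' : ℕ → ℕ → Ω' → Ψ}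
    (H : AtomRounds P lam η G C θ ψ) (H' : AtomRounds P' lam η G C' θ' ψ') :
    IdentDistrib (atomData C θ ψ) (atomData C' θ' ψ') P P' where
  aemeasurable_fst :=
    (measurable_atomData H.measurable_C H.measurable_θ H.measurable_ψ).aemeasurable
  aemeasurable_snd :=
    (measurable_atomData H'.measurable_C H'.measurable_θ H'.measurable_ψ).aemeasurable
  map_eq := by rw [H.map_atomData, H'.map_atomData]

end JointLaw

/-! ### Power-law and decoupled Bondesson representations as Poisson rounds of atoms. -/

section Representations

variable {Ω : Type*} [mΩ : MeasurableSpace Ω] {Ψ : Type*} [mΨ : MeasurableSpace Ψ]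
  {P : Measure Ω} {C : ℕ → Ω → ℕ} {θ : ℕ → ℕ → Ω → ℝ} {ψ : ℕ → ℕ → Ω → Ψ} {G : Measure Ψ}

/-- Weights in the unit interval whose moments depend on the round only have a law that depends on
the round only. -/
lemma map_eq_of_moments [IsProbabilityMeasure P] {X Y : Ω → ℝ} (hX : Measurable X)
    (hY : Measurable Y) (hX01 : ∀ᵐ ω ∂P, X ω ∈ Set.Ioc (0 : ℝ) 1)
    (hY01 : ∀ᵐ ω ∂P, Y ω ∈ Set.Ioc (0 : ℝ) 1)
    (h : ∀ n : ℕ, ∫⁻ ω, ENNReal.ofReal (X ω) ^ n ∂P = ∫⁻ ω, ENNReal.ofReal (Y ω) ^ n ∂P) :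
    P.map X = P.map Y := by
  have := Measure.isProbabilityMeasure_map (μ := P) hX.aemeasurable
  have := Measure.isProbabilityMeasure_map (μ := P) hY.aemeasurable
  refine measure_ext_of_moments ?_ ?_ fun n => ?_
  · exact (ae_map_iff hX.aemeasurable measurableSet_Icc).2
      (hX01.mono fun ω hω => Set.Ioc_subset_Icc_self hω)
  · exact (ae_map_iff hY.aemeasurable measurableSet_Icc).2
      (hY01.mono fun ω hω => Set.Ioc_subset_Icc_self hω)
  · rw [lintegral_map (by fun_prop) hX, lintegral_map (by fun_prop) hY, h]

/-- Weights of a round: laws on `(0, 1]` with given moments. -/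
structure HasMoments (η : ℕ → Measure ℝ) (m : ℕ → ℕ → ℝ) : Prop where
  mem_Ioc : ∀ k, ∀ᵐ x ∂(η k), x ∈ Set.Ioc (0 : ℝ) 1
  lintegral_pow : ∀ k n, ∫⁻ x, ENNReal.ofReal x ^ n ∂(η k) = ENNReal.ofReal (m k n)

lemma hasMoments_map {m : ℕ → ℕ → ℝ} (hθ : ∀ k i, Measurable (θ k i))
    (h01 : ∀ k i, ∀ᵐ ω ∂P, θ k i ω ∈ Set.Ioc (0 : ℝ) 1)
    (hmom : ∀ k i n, ∫⁻ ω, ENNReal.ofReal (θ k i ω) ^ n ∂P = ENNReal.ofReal (m k n)) :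
    HasMoments (fun k => P.map (θ k 0)) m where
  mem_Ioc k := (ae_map_iff (hθ k 0).aemeasurable measurableSet_Ioc).2 (h01 k 0)
  lintegral_pow k n := by rw [lintegral_map (by fun_prop) (hθ k 0), hmom]

lemma HasMoments.unique {η η' : ℕ → Measure ℝ} {m : ℕ → ℕ → ℝ} (h : HasMoments η m)
    (h' : HasMoments η' m) : η = η' := by
  have hfin : ∀ {ρ : ℕ → Measure ℝ}, HasMoments ρ m → ∀ k, IsFiniteMeasure (ρ k) := by
    intro ρ hρ k
    have := hρ.lintegral_pow k 0
    simp only [pow_zero, lintegral_one] at this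
    exact ⟨this ▸ ENNReal.ofReal_lt_top⟩
  funext k
  have := hfin h k
  have := hfin h' k
  exact measure_ext_of_moments ((h.mem_Ioc k).mono fun x hx => Set.Ioc_subset_Icc_self hx)
    ((h'.mem_Ioc k).mono fun x hx => Set.Ioc_subset_Icc_self hx)
    fun n => by rw [h.lintegral_pow, h'.lintegral_pow]

lemma tsum_toNNReal_mul_ofReal {c s : ℝ} (hc : 0 ≤ c) {f : ℕ → ℝ} (hf : ∀ k, 0 ≤ f k)
    (h : HasSum (fun k => c * f k) s) :
    ∑' k, (c.toNNReal : ℝ≥0∞) * ENNReal.ofReal (f k) = ENNReal.ofReal s := by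
  rw [← h.tsum_eq, ENNReal.ofReal_tsum_of_nonneg (fun k => mul_nonneg hc (hf k)) h.summable]
  refine tsum_congr fun k => ?_
  rw [ENNReal.ofReal_mul hc]
  rfl

/-- The construction of Broderick et al. is the power-law representation with unit factors. -/
theorem isBroderick_iff_isPLRep [IsProbabilityMeasure P] {γ α d : ℝ} {U : ℕ → ℕ → ℕ → Ω → ℝ} :
    IsBroderick P γ α d G C U ψ
      ↔ IsPLRep P γ α d (Measure.dirac 1) G C (fun _ _ _ => 1) U ψ := by
  constructor
  · intro H
    refine ⟨H.measurable_C, fun _ _ => measurable_const, H.measurable_U, H.measurable_ψ, H.law_C,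
      fun _ _ => by rw [Measure.map_const, measure_univ, one_smul], H.law_U, H.law_ψ, ?_⟩
    -- The constant factors generate trivial σ-algebras, which do not affect independence.
    refine iIndep_of_trivial_off (e := Sum.map id (Sum.map id Sum.inr))
      (Function.injective_id.sumMap (Function.injective_id.sumMap Sum.inr_injective)) ?_ ?_
    · convert! H.indep using 1
      funext i
      rcases i with k | q | q <;> rfl
    · rintro (k | q | q | q) hk
      · exact (hk ⟨Sum.inl k, rfl⟩).elim
      · exact (hk ⟨Sum.inr (Sum.inl q), rfl⟩).elim
      · exact MeasurableSpace.comap_const _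
      · exact (hk ⟨Sum.inr (Sum.inr q), rfl⟩).elim
  · intro H
    refine ⟨H.measurable_C, H.measurable_U, H.measurable_ψ, H.law_C, H.law_U, H.law_ψ, ?_⟩
    have h := H.indep.precomp (g := Sum.map id (Sum.map id Sum.inr))
      (Function.injective_id.sumMap (Function.injective_id.sumMap Sum.inr_injective))
    convert! h using 1
    funext i
    rcases i with k | q | q <;> rfl

namespace IsPLRep

variable {γ α d : ℝ} {g : Measure ℝ} {V : ℕ → ℕ → Ω → ℝ} {U : ℕ → ℕ → ℕ → Ω → ℝ}

lemma isBroderick (H : IsPLRep P γ α d g G C V U ψ) : IsBroderick P γ α d G C U ψ := by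
  refine ⟨H.measurable_C, H.measurable_U, H.measurable_ψ, H.law_C, H.law_U, H.law_ψ, ?_⟩
  have h := H.indep.precomp (g := Sum.map id (Sum.map id Sum.inr))
    (Function.injective_id.sumMap (Function.injective_id.sumMap Sum.inr_injective))
  convert! h using 1
  funext i
  rcases i with k | q | q <;> rfl

lemma ae_plWeight_eq (H : IsPLRep P γ α d (Measure.dirac 1) G C V U ψ) :
    ∀ᵐ ω ∂P, ∀ k i, plWeight V U k i ω = stickWeight U k i ω := by
  refine ae_all_iff.2 fun k => ae_all_iff.2 fun i => ?_
  have h : ∀ᵐ x ∂(P.map (V k i)), x = 1 := by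
    rw [H.law_V, ae_dirac_eq]
    rfl
  filter_upwards [ae_of_ae_map (H.measurable_V k i).aemeasurable h] with ω hω
  rw [plWeight, stickWeight, hω, one_mul]

/-- The σ-algebra is arbitrary because `indep_weights` needs the one generated by the variables of a
single atom. -/
lemma measurable_plWeight_of {Ω : Type*} {m : MeasurableSpace Ω} {V : ℕ → ℕ → Ω → ℝ}
    {U : ℕ → ℕ → ℕ → Ω → ℝ} {k i : ℕ} (hV : Measurable (V k i))
    (hU : ∀ j : Fin (k + 1), Measurable (U k i j)) : Measurable (plWeight V U k i) := by
  refine Measurable.mul (hV.mul ?_) (Finset.measurable_prod _ fun j hj => ?_)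
  · exact hU (Fin.last k)
  · exact measurable_const.sub (hU ⟨j, (Finset.mem_range.1 hj).trans k.lt_succ_self⟩)

lemma measurable_plWeight (H : IsPLRep P γ α d g G C V U ψ) (k i : ℕ) :
    Measurable (plWeight V U k i) :=
  measurable_plWeight_of (H.measurable_V k i) fun j =>
    H.measurable_U k i j (Nat.lt_succ_iff.1 j.2)

/-- Each weight uses only its own `V` and sticks, so grouping the variables by atom preserves
independence. -/
lemma indep_weights (H : IsPLRep P γ α d g G C V U ψ) :
    iIndep (Sum.elim (fun k : ℕ => MeasurableSpace.comap (C k) inferInstance)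
      (Sum.elim (fun q : ℕ × ℕ => MeasurableSpace.comap (plWeight V U q.1 q.2) inferInstance)
        (fun q : ℕ × ℕ => MeasurableSpace.comap (ψ q.1 q.2) inferInstance))) P := by
  set m := Sum.elim (fun k : ℕ => MeasurableSpace.comap (C k) inferInstance)
    (Sum.elim (fun q : ℕ × ℕ => MeasurableSpace.comap (ψ q.1 q.2) inferInstance)
      (Sum.elim (fun q : ℕ × ℕ => MeasurableSpace.comap (V q.1 q.2) inferInstance)
        (fun q : Σ k : ℕ, ℕ × Fin (k + 1) =>
          MeasurableSpace.comap (U q.1 q.2.1 q.2.2) inferInstance))) with hm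
  have hmle : ∀ i, m i ≤ mΩ := by
    rintro (k | q | q | q)
    · exact (H.measurable_C k).comap_le
    · exact (H.measurable_ψ q.1 q.2).comap_le
    · exact (H.measurable_V q.1 q.2).comap_le
    · exact (H.measurable_U q.1 q.2.1 q.2.2 (Nat.lt_succ_iff.1 q.2.2.2)).comap_le
  set f : ℕ ⊕ (ℕ × ℕ ⊕ (ℕ × ℕ ⊕ Σ k : ℕ, ℕ × Fin (k + 1))) → ℕ ⊕ (ℕ × ℕ ⊕ ℕ × ℕ) :=
    Sum.elim Sum.inl (Sum.elim (fun q => Sum.inr (Sum.inr q))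
      (Sum.elim (fun q => Sum.inr (Sum.inl q)) fun q => Sum.inr (Sum.inl (q.1, q.2.1)))) with hf
  have hle : ∀ i, m i ≤ ⨆ j ∈ {j | f j = f i}, m j := fun i =>
    le_iSup₂_of_le (f := fun j (_ : j ∈ {j | f j = f i}) => m j) i rfl le_rfl
  refine iIndep_of_iIndep_of_le (iIndep_iSup_fiber hmle H.indep f) ?_
  rintro (k | q | q)
  · exact hle (Sum.inl k)
  · refine Measurable.comap_le (measurable_plWeight_of ?_ fun j => ?_)
    · exact Measurable.mono (comap_measurable (V q.1 q.2)) (hle (Sum.inr (Sum.inr (Sum.inl q))))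
        le_rfl
    · exact Measurable.mono (comap_measurable (U q.1 q.2 j))
        (hle (Sum.inr (Sum.inr (Sum.inr ⟨q.1, q.2, j⟩)))) le_rfl
  · exact hle (Sum.inr (Sum.inl q))

lemma ae_mem_Ioo (H : IsPLRep P γ α d g G C V U ψ) {k i j : ℕ} (hj : j ≤ k) :
    ∀ᵐ ω ∂P, U k i j ω ∈ Set.Ioo (0 : ℝ) 1 := by
  have h := betaMeasure_ae_mem (1 - d) (α + (j + 1) * d)
  rw [← H.law_U k i j hj] at h
  exact ae_of_ae_map (H.measurable_U k i j hj).aemeasurable h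

lemma ae_plWeight_mem (H : IsPLRep P γ α d (Measure.dirac 1) G C V U ψ) (k i : ℕ) :
    ∀ᵐ ω ∂P, plWeight V U k i ω ∈ Set.Ioc (0 : ℝ) 1 := by
  have h : ∀ᵐ ω ∂P, ∀ j, j ≤ k → U k i j ω ∈ Set.Ioo (0 : ℝ) 1 :=
    ae_all_iff.2 fun j => by
      by_cases hj : j ≤ k
      · exact (H.ae_mem_Ioo hj).mono fun ω hω _ => hω
      · exact ae_of_all _ fun ω hj' => absurd hj' hj
  filter_upwards [h, H.ae_plWeight_eq] with ω hω heq
  rw [heq, stickWeight]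
  have hp : ∀ j ∈ Finset.range k, 0 < 1 - U k i j ω ∧ 1 - U k i j ω ≤ 1 := fun j hj => by
    have := hω j (Finset.mem_range.1 hj).le
    exact ⟨sub_pos.2 this.2, by linarith [this.1]⟩
  refine ⟨mul_pos (hω k le_rfl).1 (Finset.prod_pos fun j hj => (hp j hj).1), ?_⟩
  exact mul_le_one₀ (hω k le_rfl).2.le (Finset.prod_nonneg fun j hj => (hp j hj).1.le)
    (Finset.prod_le_one (fun j hj => (hp j hj).1.le) fun j hj => (hp j hj).2)

/-- The moments of the weights of a power-law representation. -/
lemma lintegral_plWeight_pow (H : IsPLRep P γ α d (Measure.dirac 1) G C V U ψ) (hd0 : 0 ≤ d)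
    (hd1 : d < 1) (hα : -d < α) (k i n : ℕ) :
    ∫⁻ ω, ENNReal.ofReal (plWeight V U k i ω) ^ n ∂P
      = ENNReal.ofReal (rising (1 - d) n / rising (α + k * d + 1) n * stickResidual α d n k) := by
  have h1d : 0 < 1 - d := by linarith
  have hpos : ∀ j : ℕ, 0 < α + ((j : ℝ) + 1) * d := fun j => by
    have := add_mul_pos hd0 hα j
    linarith
  -- The last stick enters as `U`, the earlier ones as `1 - U`; the moment is then an expectation of
  -- a product of independent factors.
  set F : Fin (k + 1) → ℝ → ℝ≥0∞ := fun j u =>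
    if (j : ℕ) = k then ENNReal.ofReal u ^ n else ENNReal.ofReal (1 - u) ^ n with hF
  have hFm : ∀ j, Measurable (F j) := by
    intro j
    simp only [hF]
    split_ifs <;> fun_prop
  have hUm : ∀ j : Fin (k + 1), Measurable (U k i j) := fun j =>
    H.measurable_U k i j (Nat.lt_succ_iff.1 j.2)
  have hind : iIndepFun (fun j : Fin (k + 1) => U k i j) P := by
    rw [iIndepFun_iff_iIndep]
    refine H.indep.precomp (g := fun j : Fin (k + 1) => Sum.inr (Sum.inr (Sum.inr ⟨k, i, j⟩))) ?_
    intro a b hab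
    simpa using hab
  have hprod : ∫⁻ ω, ENNReal.ofReal (plWeight V U k i ω) ^ n ∂P
      = ∫⁻ ω, ∏ j : Fin (k + 1), F j (U k i j ω) ∂P := by
    have h : ∀ᵐ ω ∂P, ∀ j, j ≤ k → U k i j ω ∈ Set.Ioo (0 : ℝ) 1 :=
      ae_all_iff.2 fun j => by
        by_cases hj : j ≤ k
        · exact (H.ae_mem_Ioo hj).mono fun ω hω _ => hω
        · exact ae_of_all _ fun ω hj' => absurd hj' hj
    refine lintegral_congr_ae ?_
    filter_upwards [h, H.ae_plWeight_eq] with ω hω heq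
    have hlast : F (Fin.last k) (U k i (Fin.last k) ω) = ENNReal.ofReal (U k i k ω) ^ n := by
      simp [hF]
    have hcast : ∀ j : Fin k, F j.castSucc (U k i j.castSucc ω)
        = ENNReal.ofReal (1 - U k i j ω) ^ n := by
      intro j
      simp [hF, j.2.ne]
    rw [Fin.prod_univ_castSucc, hlast, Finset.prod_congr rfl fun j _ => hcast j, heq, stickWeight,
      ENNReal.ofReal_mul (hω k le_rfl).1.le, ENNReal.ofReal_prod_of_nonneg fun j hj =>
        sub_nonneg.2 (hω j (Finset.mem_range.1 hj).le).2.le, mul_pow, ← Finset.prod_pow,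
      Finset.prod_range, mul_comm]
  rw [hprod, lintegral_prod_eq_prod_lintegral_of_indepFun Finset.univ
    (fun j ω => F j (U k i j ω)) (hind.comp F hFm) fun j => (hFm j).comp (hUm j),
    Fin.prod_univ_castSucc]
  have hlast : ∫⁻ ω, F (Fin.last k) (U k i (Fin.last k) ω) ∂P
      = ENNReal.ofReal (rising (1 - d) n / rising (α + k * d + 1) n) := by
    have hl : ∀ u, F (Fin.last k) u = ENNReal.ofReal u ^ n := fun u => by simp [hF]
    simp_rw [hl]
    rw [← lintegral_map (f := fun u => ENNReal.ofReal u ^ n) (by fun_prop) (hUm (Fin.last k)),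
      Fin.val_last, H.law_U k i k le_rfl, lintegral_pow_betaMeasure h1d (hpos k)]
    congr 3
    ring
  have hcast : ∀ j : Fin k, ∫⁻ ω, F j.castSucc (U k i j.castSucc ω) ∂P
      = ENNReal.ofReal (rising (α + (j + 1) * d) n / rising (α + j * d + 1) n) := by
    intro j
    have hl : ∀ u, F j.castSucc u = ENNReal.ofReal (1 - u) ^ n := fun u => by
      simp [hF, j.2.ne]
    simp_rw [hl]
    rw [← lintegral_map (f := fun u => ENNReal.ofReal (1 - u) ^ n) (by fun_prop)
      (hUm j.castSucc), Fin.val_castSucc, H.law_U k i j j.2.le,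
      lintegral_one_sub_pow_betaMeasure h1d (hpos j)]
    congr 3
    ring
  have hnn : ∀ j : Fin k, 0 ≤ rising (α + ((j : ℕ) + 1) * d) n / rising (α + (j : ℕ) * d + 1) n :=
    fun j => (div_pos (rising_pos (hpos j) n)
      (rising_pos (by linarith [add_mul_pos hd0 hα j]) n)).le
  rw [hlast, Finset.prod_congr rfl fun j _ => hcast j,
    ← ENNReal.ofReal_prod_of_nonneg fun j _ => hnn j,
    ← ENNReal.ofReal_mul (Finset.prod_nonneg fun j _ => hnn j), mul_comm, stickResidual,
    Finset.prod_range]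

/-- A power-law representation with unit factors consists of Poisson rounds of atoms. -/
lemma atomRounds [IsProbabilityMeasure P] (H : IsPLRep P γ α d (Measure.dirac 1) G C V U ψ)
    (hd0 : 0 ≤ d) (hd1 : d < 1) (hα : -d < α) :
    AtomRounds P γ.toNNReal (fun k => P.map (plWeight V U k 0)) G C (plWeight V U) ψ where
  measurable_C := H.measurable_C
  measurable_θ := H.measurable_plWeight
  measurable_ψ := H.measurable_ψ
  law_C := H.law_C
  -- The atom with index 0 serves as reference; the others share its law because the moments do not
  -- involve `i`.
  law_θ k i := map_eq_of_moments (H.measurable_plWeight k i) (H.measurable_plWeight k 0)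
    (H.ae_plWeight_mem k i) (H.ae_plWeight_mem k 0) fun n => by
      rw [H.lintegral_plWeight_pow hd0 hd1 hα, H.lintegral_plWeight_pow hd0 hd1 hα]
  law_ψ := H.law_ψ
  indep := H.indep_weights

lemma hasMoments (H : IsPLRep P γ α d (Measure.dirac 1) G C V U ψ)
    (hd0 : 0 ≤ d) (hd1 : d < 1) (hα : -d < α) :
    HasMoments (fun k => P.map (plWeight V U k 0)) fun k n =>
      rising (1 - d) n / rising (α + k * d + 1) n * stickResidual α d n k :=
  hasMoments_map H.measurable_plWeight H.ae_plWeight_mem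
    (H.lintegral_plWeight_pow hd0 hd1 hα)

end IsPLRep

lemma betaBondessonLaw_ae_mem (α : ℝ) :
    ∀ᵐ x ∂(betaBondessonLaw α), x ∈ Set.Ioc (0 : ℝ) 1 := by
  unfold betaBondessonLaw
  split_ifs
  · exact (ae_dirac_iff (p := (· ∈ Set.Ioc (0 : ℝ) 1)) measurableSet_Ioc).2 (by simp)
  · exact (betaMeasure_ae_mem _ _).mono fun x hx => Set.Ioo_subset_Ioc_self hx

/-- At `α = 1` the quotient is 1, so the point mass at 1 fits the same formula. -/
lemma lintegral_pow_betaBondessonLaw {α : ℝ} (hα : 1 ≤ α) (n : ℕ) :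
    ∫⁻ x, ENNReal.ofReal x ^ n ∂(betaBondessonLaw α)
      = ENNReal.ofReal (rising 1 n / rising α n) := by
  unfold betaBondessonLaw
  split_ifs with h
  · rw [lintegral_dirac' _ (by fun_prop), h, div_self (rising_pos one_pos n).ne']
    simp
  · have h1 : 1 < α := lt_of_le_of_ne hα (Ne.symm h)
    rw [lintegral_pow_betaMeasure one_pos (sub_pos.2 h1)]
    congr 3
    ring

namespace IsDBRep

variable {c ξ α : ℝ} {g : Measure ℝ} {V T : ℕ → ℕ → Ω → ℝ}

lemma measurable_dbWeight (H : IsDBRep P c g ξ G C V T ψ) (k i : ℕ) :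
    Measurable (dbWeight V T k i) :=
  (H.measurable_V k i).mul (H.measurable_T k i).neg.exp

lemma indep_weights (H : IsDBRep P c g ξ G C V T ψ) :
    iIndep (Sum.elim (fun k : ℕ => MeasurableSpace.comap (C k) inferInstance)
      (Sum.elim (fun q : ℕ × ℕ => MeasurableSpace.comap (dbWeight V T q.1 q.2) inferInstance)
        (fun q : ℕ × ℕ => MeasurableSpace.comap (ψ q.1 q.2) inferInstance))) P := by
  set m := Sum.elim (fun k : ℕ => MeasurableSpace.comap (C k) inferInstance)
    (Sum.elim (fun q : ℕ × ℕ => MeasurableSpace.comap (ψ q.1 q.2) inferInstance)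
      (Sum.elim (fun q : ℕ × ℕ => MeasurableSpace.comap (V q.1 q.2) inferInstance)
        (fun q : ℕ × ℕ => MeasurableSpace.comap (T q.1 q.2) inferInstance))) with hm
  have hmle : ∀ i, m i ≤ mΩ := by
    rintro (k | q | q | q)
    · exact (H.measurable_C k).comap_le
    · exact (H.measurable_ψ q.1 q.2).comap_le
    · exact (H.measurable_V q.1 q.2).comap_le
    · exact (H.measurable_T q.1 q.2).comap_le
  set f : ℕ ⊕ (ℕ × ℕ ⊕ (ℕ × ℕ ⊕ ℕ × ℕ)) → ℕ ⊕ (ℕ × ℕ ⊕ ℕ × ℕ) :=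
    Sum.elim Sum.inl (Sum.elim (fun q => Sum.inr (Sum.inr q))
      (Sum.elim (fun q => Sum.inr (Sum.inl q)) fun q => Sum.inr (Sum.inl q))) with hf
  have hle : ∀ i, m i ≤ ⨆ j ∈ {j | f j = f i}, m j := fun i =>
    le_iSup₂_of_le (f := fun j (_ : j ∈ {j | f j = f i}) => m j) i rfl le_rfl
  refine iIndep_of_iIndep_of_le (iIndep_iSup_fiber hmle H.indep f) ?_
  rintro (k | q | q)
  · exact hle (Sum.inl k)
  · have hV := Measurable.mono (comap_measurable (V q.1 q.2))
      (hle (Sum.inr (Sum.inr (Sum.inl q)))) le_rfl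
    have hT := Measurable.mono (comap_measurable (T q.1 q.2))
      (hle (Sum.inr (Sum.inr (Sum.inr q)))) le_rfl
    exact Measurable.comap_le (hV.mul hT.neg.exp)
  · exact hle (Sum.inr (Sum.inl q))

lemma ae_mem (H : IsDBRep P c (betaBondessonLaw α) ξ G C V T ψ) (k i : ℕ) :
    ∀ᵐ ω ∂P, V k i ω ∈ Set.Ioc (0 : ℝ) 1 ∧ 0 ≤ T k i ω := by
  have hV := betaBondessonLaw_ae_mem α
  have hT := gammaMeasure_ae_nonneg (k + 1) ξ
  rw [← H.law_V k i] at hV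
  rw [← H.law_T k i] at hT
  filter_upwards [ae_of_ae_map (H.measurable_V k i).aemeasurable hV,
    ae_of_ae_map (H.measurable_T k i).aemeasurable hT] with ω h1 h2 using ⟨h1, h2⟩

lemma ae_dbWeight_mem (H : IsDBRep P c (betaBondessonLaw α) ξ G C V T ψ) (k i : ℕ) :
    ∀ᵐ ω ∂P, dbWeight V T k i ω ∈ Set.Ioc (0 : ℝ) 1 := by
  filter_upwards [H.ae_mem k i] with ω hω
  exact ⟨mul_pos hω.1.1 (Real.exp_pos _), mul_le_one₀ hω.1.2 (Real.exp_pos _).le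
    (Real.exp_le_one_iff.2 (neg_nonpos.2 hω.2))⟩

/-- The moments of the weights of a decoupled Bondesson representation. -/
lemma lintegral_dbWeight_pow (H : IsDBRep P c (betaBondessonLaw α) ξ G C V T ψ) (hα : 1 ≤ α)
    (hξ : 0 < ξ) (k i n : ℕ) :
    ∫⁻ ω, ENNReal.ofReal (dbWeight V T k i ω) ^ n ∂P
      = ENNReal.ofReal (rising 1 n / rising α n * (ξ / (ξ + n)) ^ (k + 1)) := by
  have hind : IndepFun (V k i) (T k i) P := by
    rw [IndepFun_iff_Indep]
    exact H.indep.indep (i := Sum.inr (Sum.inr (Sum.inl (k, i))))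
      (j := Sum.inr (Sum.inr (Sum.inr (k, i)))) (by simp)
  have hf : Measurable fun x : ℝ => ENNReal.ofReal x ^ n := by fun_prop
  have hg : Measurable fun x : ℝ => ENNReal.ofReal (Real.exp (-x)) ^ n := by fun_prop
  have h1 : ∫⁻ ω, ENNReal.ofReal (dbWeight V T k i ω) ^ n ∂P
      = ∫⁻ ω, ENNReal.ofReal (V k i ω) ^ n * ENNReal.ofReal (Real.exp (-T k i ω)) ^ n ∂P := by
    refine lintegral_congr_ae ?_
    filter_upwards [H.ae_mem k i] with ω hω
    rw [dbWeight, ENNReal.ofReal_mul hω.1.1.le, mul_pow]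
  have h2 := lintegral_mul_eq_lintegral_mul_lintegral_of_indepFun
    (hf.comp (H.measurable_V k i)) (hg.comp (H.measurable_T k i)) (hind.comp hf hg)
  have h3 : ∫⁻ ω, ENNReal.ofReal (V k i ω) ^ n ∂P = ENNReal.ofReal (rising 1 n / rising α n) := by
    rw [← lintegral_map hf (H.measurable_V k i), H.law_V, lintegral_pow_betaBondessonLaw hα]
  have h4 : ∫⁻ ω, ENNReal.ofReal (Real.exp (-T k i ω)) ^ n ∂P
      = ENNReal.ofReal ((ξ / (ξ + n)) ^ (k + 1)) := by
    rw [← lintegral_map hg (H.measurable_T k i), H.law_T, lintegral_exp_neg_pow_gammaMeasure hξ]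
  rw [h1]
  refine h2.trans ?_
  simp only [Function.comp_apply]
  rw [h3, h4, ← ENNReal.ofReal_mul (div_pos (rising_pos one_pos n)
    (rising_pos (by linarith) n)).le]

/-- A decoupled Bondesson representation consists of Poisson rounds of atoms. -/
lemma atomRounds [IsProbabilityMeasure P] (H : IsDBRep P c (betaBondessonLaw α) ξ G C V T ψ)
    (hα : 1 ≤ α) (hξ : 0 < ξ) :
    AtomRounds P (c / ξ).toNNReal (fun k => P.map (dbWeight V T k 0)) G C (dbWeight V T) ψ where
  measurable_C := H.measurable_C
  measurable_θ := H.measurable_dbWeight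
  measurable_ψ := H.measurable_ψ
  law_C := H.law_C
  law_θ k i := map_eq_of_moments (H.measurable_dbWeight k i) (H.measurable_dbWeight k 0)
    (H.ae_dbWeight_mem k i) (H.ae_dbWeight_mem k 0) fun n => by
      rw [H.lintegral_dbWeight_pow hα hξ, H.lintegral_dbWeight_pow hα hξ]
  law_ψ := H.law_ψ
  indep := H.indep_weights

lemma hasMoments (H : IsDBRep P c (betaBondessonLaw α) ξ G C V T ψ) (hα : 1 ≤ α) (hξ : 0 < ξ) :
    HasMoments (fun k => P.map (dbWeight V T k 0)) fun k n =>
      rising 1 n / rising α n * (ξ / (ξ + n)) ^ (k + 1) :=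
  hasMoments_map H.measurable_dbWeight H.ae_dbWeight_mem (H.lintegral_dbWeight_pow hα hξ)

end IsDBRep

/-- For `d = 0` each `1 - U` has law Beta(`α`, 1), that of `exp (-E)` with `E` exponential of rate
`α`, with moments `α / (α + n)`. The final stick has the moments of Beta(1, `α`), which carry one
more such factor beside those of `betaBondessonLaw`. The `k + 1` factors match a gamma variable of
shape `k + 1`. -/
lemma stickMoment_zero_eq_bondessonMoment {α : ℝ} (hα : 0 < α) (k n : ℕ) :
    rising (1 - 0) n / rising (α + k * 0 + 1) n * stickResidual α 0 n k
      = rising 1 n / rising α n * (α / (α + n)) ^ (k + 1) := by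
  have h1 := rising_pos hα n
  have h2 := rising_pos (show (0 : ℝ) < α + 1 by linarith) n
  have h3 : rising α n / rising (α + 1) n = α / (α + n) := by
    have h4 : (0 : ℝ) < α + n := by positivity
    rw [div_eq_div_iff h2.ne' h4.ne', ← rising_succ, rising_succ']
  rw [stickResidual]
  simp only [mul_zero, add_zero, sub_zero]
  rw [Finset.prod_const, Finset.card_range, h3, pow_succ, ← h3]
  field_simp

end Representations

/-! ### The representations, their truncation errors and the comparison for `d = 0`. -/

section Main

variable {Ω : Type*} [mΩ : MeasurableSpace Ω] {Ψ : Type*} [mΨ : MeasurableSpace Ψ]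
  {P : Measure Ω} [IsProbabilityMeasure P] {C : ℕ → Ω → ℕ} {ψ : ℕ → ℕ → Ω → Ψ} {G : Measure Ψ}
  {γ α d ξ : ℝ} {V T : ℕ → ℕ → Ω → ℝ} {U : ℕ → ℕ → ℕ → Ω → ℝ}

theorem IsPLRep.isCRM (H : IsPLRep P γ α d (Measure.dirac 1) G C V U ψ) (hγ : 0 < γ)
    (hd0 : 0 ≤ d) (hd1 : d < 1) (hα : -d < α) :
    IsCRM P (superposition C (plWeight V U) ψ) (betaProcessRate γ α d) G := by
  have hm := H.hasMoments hd0 hd1 hα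
  refine (H.atomRounds hd0 hd1 hα).isCRM
    (sum_smul_eq_betaProcessRate hγ hd1 hα hm.mem_Ioc fun n => ?_)
  simp_rw [hm.lintegral_pow]
  exact tsum_toNNReal_mul_ofReal hγ.le (fun k => stickMoment_nonneg hd0 hd1 hα _ k)
    ((hasSum_stickMoment hd0 hd1 hα n).mul_left γ)

theorem IsPLRep.truncationError_eq_and_le (H : IsPLRep P γ α d (Measure.dirac 1) G C V U ψ)
    (hγ : 0 < γ) (hd0 : 0 ≤ d) (hd1 : d < 1) (hα : -d < α) {N K : ℕ}
    {x : Fin N → ℕ → ℕ → Ω → ℕ} (hx : IsLikelihoodDraw P bernoulliLik C (plWeight V U) ψ x) :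
    truncationError P C x K
        = 1 - Real.exp (-∫ θ, (1 - bernoulliLik 0 θ ^ N) ∂(tailRate P C (plWeight V U) K)) ∧
      truncationError P C x K
        ≤ N * γ * ∏ k ∈ Finset.Icc 1 K, (α + k * d) / (α + k * d - d + 1) := by
  have hm := H.hasMoments hd0 hd1 hα
  have hs := (hasSum_stickMean_tail hd0 hd1 hα K).mul_left γ
  have hnn : ∀ k : ℕ, 0 ≤ rising (1 - d) 1 / rising (α + (k + K : ℕ) * d + 1) 1
      * stickResidual α d 1 (k + K) := fun k => stickMoment_nonneg hd0 hd1 hα 1 (k + K)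
  rw [mul_assoc]
  refine CRM.truncationError_eq_and_le (H.atomRounds hd0 hd1 hα)
    (fun k => (hm.mem_Ioc k).mono fun x hx => Set.Ioc_subset_Icc_self hx) hx
    (hs.nonneg fun k => mul_nonneg hγ.le (hnn k)) ?_
  rw [← tsum_toNNReal_mul_ofReal hγ.le hnn hs]
  refine le_of_eq (tsum_congr fun k => ?_)
  rw [← hm.lintegral_pow (k + K) 1]
  simp only [pow_one]

theorem IsDBRep.isCRM (H : IsDBRep P (γ * α) (betaBondessonLaw α) ξ G C V T ψ) (hγ : 0 < γ)
    (hα : 1 ≤ α) (hξ : 0 < ξ) :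
    IsCRM P (superposition C (dbWeight V T) ψ) (betaProcessRate γ α 0) G := by
  have hα0 : 0 < α := by linarith
  have hm := H.hasMoments hα hξ
  refine (H.atomRounds hα hξ).isCRM
    (sum_smul_eq_betaProcessRate hγ one_pos (by linarith) hm.mem_Ioc fun n => ?_)
  simp_rw [hm.lintegral_pow, sub_zero]
  exact tsum_toNNReal_mul_ofReal (by positivity) (fun k => mul_nonneg
    (div_pos (rising_pos one_pos _) (rising_pos hα0 _)).le (by positivity))
    (hasSum_bondessonMoment hα0 hξ n)

theorem IsDBRep.truncationError_eq_and_le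
    (H : IsDBRep P (γ * α) (betaBondessonLaw α) ξ G C V T ψ) (hγ : 0 < γ)
    (hα : 1 ≤ α) (hξ : 0 < ξ) {N K : ℕ}
    {x : Fin N → ℕ → ℕ → Ω → ℕ} (hx : IsLikelihoodDraw P bernoulliLik C (dbWeight V T) ψ x) :
    truncationError P C x K
        = 1 - Real.exp (-∫ θ, (1 - bernoulliLik 0 θ ^ N) ∂(tailRate P C (dbWeight V T) K)) ∧
      truncationError P C x K ≤ N * γ * (ξ / (1 + ξ)) ^ K := by
  have hα0 : 0 < α := by linarith
  have hm := H.hasMoments hα hξ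
  have hs := hasSum_bondessonMean_tail (γ := γ) hα0 hξ K
  rw [mul_assoc]
  refine CRM.truncationError_eq_and_le (H.atomRounds hα hξ)
    (fun k => (hm.mem_Ioc k).mono fun x hx => Set.Ioc_subset_Icc_self hx) hx (by positivity) ?_
  rw [← tsum_toNNReal_mul_ofReal (by positivity) (fun k => mul_nonneg
    (div_pos (rising_pos one_pos _) (rising_pos hα0 _)).le (by positivity)) hs]
  refine le_of_eq (tsum_congr fun k => ?_)
  rw [← hm.lintegral_pow (k + K) 1]
  simp only [pow_one]

theorem IsPLRep.identDistrib_dbRep {Ω' : Type*} [MeasurableSpace Ω'] {P' : Measure Ω'}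
    [IsProbabilityMeasure P'] {C' : ℕ → Ω' → ℕ} {V' T' : ℕ → ℕ → Ω' → ℝ} {ψ' : ℕ → ℕ → Ω' → Ψ}
    (H : IsPLRep P γ α 0 (Measure.dirac 1) G C V U ψ)
    (H' : IsDBRep P' (γ * α) (betaBondessonLaw α) α G C' V' T' ψ') (hα : 1 ≤ α) :
    IdentDistrib (atomData C (plWeight V U) ψ) (atomData C' (dbWeight V' T') ψ') P P' := by
  have hα0 : 0 < α := by linarith
  have hα0' : -(0 : ℝ) < α := by linarith
  have hm := H.hasMoments le_rfl one_pos hα0'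
  have hA := H.atomRounds le_rfl one_pos hα0'
  have hA' := H'.atomRounds hα hα0
  simp_rw [stickMoment_zero_eq_bondessonMoment hα0] at hm
  -- At `ξ = α` the Poisson rate `γ * α / ξ` is `γ`, and equal moments identify the weight laws of
  -- all rounds.
  rw [mul_div_cancel_right₀ _ hα0.ne', ← hm.unique (H'.hasMoments hα hα0)] at hA'
  exact hA.identDistrib hA'

end Main

end CRM

theorem mainTheorem5
    {Ω : Type*} [MeasurableSpace Ω] (P : Measure Ω) [IsProbabilityMeasure P]
    {Ω' : Type*} [MeasurableSpace Ω'] (P' : Measure Ω') [IsProbabilityMeasure P']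
    {Ψ : Type*} [MeasurableSpace Ψ] (G : Measure Ψ) [IsProbabilityMeasure G]
    {S : Type*} [MeasurableSpace S]
    (γ α d : ℝ) (hγ : 0 < γ) (hd0 : 0 ≤ d) (hd1 : d < 1) (hα : -d < α) :
    -- the construction of Broderick et al. is the power-law representation with `V = 1`
    (∀ (C : ℕ → Ω → ℕ) (U : ℕ → ℕ → ℕ → Ω → ℝ) (ψ : ℕ → ℕ → Ω → Ψ),
      CRM.IsBroderick P γ α d G C U ψ ↔
        CRM.IsPLRep P γ α d (Measure.dirac 1) G C (fun _ _ _ => 1) U ψ) ∧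
    (∀ (C : ℕ → Ω → ℕ) (V : ℕ → ℕ → Ω → ℝ) (U : ℕ → ℕ → ℕ → Ω → ℝ) (ψ : ℕ → ℕ → Ω → Ψ),
      CRM.IsPLRep P γ α d (Measure.dirac 1) G C V U ψ →
      -- every such representation is a.s. the construction of Broderick et al.
      CRM.IsBroderick P γ α d G C U ψ ∧
      (∀ᵐ ω ∂P, ∀ k i, CRM.plWeight V U k i ω = CRM.stickWeight U k i ω) ∧
      -- it represents `BP(γ, α, d)`
      CRM.IsCRM P (CRM.superposition C (CRM.plWeight V U) ψ) (CRM.betaProcessRate γ α d) G ∧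
      -- its truncation error under the Bernoulli likelihood
      (∀ (N K : ℕ) (x z : Fin N → ℕ → ℕ → Ω → ℕ),
        CRM.IsLikelihoodDraw P CRM.bernoulliLik C (CRM.plWeight V U) ψ x →
        CRM.IsLikelihoodDraw P CRM.bernoulliLik (CRM.truncCount K C) (CRM.plWeight V U) ψ z →
        (∀ (f : Kernel (Measure Ψ) S) [IsMarkovKernel f],
          CRM.tvDist (CRM.obsLaw P (CRM.likelihoodProcess C ψ x) f)
            (CRM.obsLaw P (CRM.likelihoodProcess (CRM.truncCount K C) ψ z) f)
            ≤ CRM.truncationError P C x K) ∧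
        CRM.truncationError P C x K
          = 1 - Real.exp (-∫ θ, (1 - CRM.bernoulliLik 0 θ ^ N)
              ∂(CRM.tailRate P C (CRM.plWeight V U) K)) ∧
        CRM.truncationError P C x K
          ≤ N * γ * ∏ k ∈ Finset.Icc 1 K, (α + k * d) / (α + k * d - d + 1))) ∧
    -- the decoupled Bondesson representation
    (1 ≤ α → ∀ ξ : ℝ, 0 < ξ →
      ∀ (C : ℕ → Ω → ℕ) (V T : ℕ → ℕ → Ω → ℝ) (ψ : ℕ → ℕ → Ω → Ψ),
      CRM.IsDBRep P (γ * α) (CRM.betaBondessonLaw α) ξ G C V T ψ →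
      -- it represents `BP(γ, α, 0)`
      CRM.IsCRM P (CRM.superposition C (CRM.dbWeight V T) ψ) (CRM.betaProcessRate γ α 0) G ∧
      -- its truncation error under the Bernoulli likelihood
      (∀ (N K : ℕ) (x z : Fin N → ℕ → ℕ → Ω → ℕ),
        CRM.IsLikelihoodDraw P CRM.bernoulliLik C (CRM.dbWeight V T) ψ x →
        CRM.IsLikelihoodDraw P CRM.bernoulliLik (CRM.truncCount K C) (CRM.dbWeight V T) ψ z →
        (∀ (f : Kernel (Measure Ψ) S) [IsMarkovKernel f],
          CRM.tvDist (CRM.obsLaw P (CRM.likelihoodProcess C ψ x) f)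
            (CRM.obsLaw P (CRM.likelihoodProcess (CRM.truncCount K C) ψ z) f)
            ≤ CRM.truncationError P C x K) ∧
        CRM.truncationError P C x K
          = 1 - Real.exp (-∫ θ, (1 - CRM.bernoulliLik 0 θ ^ N)
              ∂(CRM.tailRate P C (CRM.dbWeight V T) K)) ∧
        CRM.truncationError P C x K ≤ N * γ * (ξ / (1 + ξ)) ^ K)) ∧
    -- for `d = 0`, the power-law representation is the decoupled Bondesson one with `ξ = α`
    (1 ≤ α →
      ∀ (C : ℕ → Ω → ℕ) (V : ℕ → ℕ → Ω → ℝ) (U : ℕ → ℕ → ℕ → Ω → ℝ) (ψ : ℕ → ℕ → Ω → Ψ)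
        (C' : ℕ → Ω' → ℕ) (V' T' : ℕ → ℕ → Ω' → ℝ) (ψ' : ℕ → ℕ → Ω' → Ψ),
      CRM.IsPLRep P γ α 0 (Measure.dirac 1) G C V U ψ →
      CRM.IsDBRep P' (γ * α) (CRM.betaBondessonLaw α) α G C' V' T' ψ' →
      IdentDistrib (CRM.atomData C (CRM.plWeight V U) ψ) (CRM.atomData C' (CRM.dbWeight V' T') ψ')
        P P') := by
  refine ⟨fun C U ψ => CRM.isBroderick_iff_isPLRep, fun C V U ψ H => ?_,
    fun hα1 ξ hξ C V T ψ H => ?_, fun hα1 C V U ψ C' V' T' ψ' H H' => H.identDistrib_dbRep H' hα1⟩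
  · refine ⟨H.isBroderick, H.ae_plWeight_eq, H.isCRM hγ hd0 hd1 hα, fun N K x z hx hz => ?_⟩
    exact ⟨fun f _ => CRM.tvDist_obsLaw_le hx hz H.measurable_C H.measurable_plWeight
      H.measurable_ψ f, H.truncationError_eq_and_le hγ hd0 hd1 hα hx⟩
  · refine ⟨H.isCRM hγ hα1 hξ, fun N K x z hx hz => ?_⟩
    exact ⟨fun f _ => CRM.tvDist_obsLaw_le hx hz H.measurable_C H.measurable_dbWeight
      H.measurable_ψ f, H.truncationError_eq_and_le hγ hα1 hξ hx⟩
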